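/- For a family $\mathcal A=(A_1,\dots,A_n)$ of subsets of $\mathbb R^2$ and $k\ge 0$, let $f_k(\mathcal A)$ be the number of sets $\sigma\subseteq\{1,\dots,n\}$ with $|\sigma|=k+1$ and $\bigcap_{i\in\sigma}A_i\neq\emptyset$. (a) For every integer $n\ge 6$ there is a family $\mathcal A$ of $n$ (pairwise distinct) open sets in $\mathbb R^2$ such that the intersection of every subfamily is either empty or path-connected, and for which $$f_3(\mathcal A)=0\quad\text{and}\quad f_2(\mathcal A)\ \ge\ \binom{n-1}{2}+\frac13\,(n^2-6n+3).$$ (b) For infinitely many $n$ there is a family $\mathcal B$ of $n$ (pairwise distinct) open sets in $\mathbb R^2$ such that the intersection of every subfamily is either empty or path-connected, and for which $$f_3(\mathcal B)=0\quad\text{and}\quad f_2(\mathcal B)\ =\ \binom{n-1}{2}+\frac13\,(n^2-4n+3).$$ Furthermore, in both cases the family can be chosen so that all but exactly one of its sets are contractible, the intersection of any two of its sets is contractible (in particular nonempty), and the intersection of any three of its sets is either empty or contractible. -/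

import Mathlib

/-- The Euclidean plane. -/
abbrev Plane : Type := EuclideanSpace ℝ (Fin 2)

/-- The intersection of the subfamily of `A` indexed by `σ` (the whole plane when `σ` is empty). -/
def interOf {n : ℕ} (A : Fin n → Set Plane) (σ : Finset (Fin n)) : Set Plane :=
  ⋂ i ∈ σ, A i

/-- The nerve of the family `A`: all index sets whose subfamily has nonempty intersection. -/
def nerve {n : ℕ} (A : Fin n → Set Plane) : Set (Finset (Fin n)) :=
  {σ | (interOf A σ).Nonempty}

/-- `fNum k A` is the number of `(k + 1)`-element index sets in the nerve of `A`. -/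
noncomputable def fNum {n : ℕ} (k : ℕ) (A : Fin n → Set Plane) : ℕ :=
  {σ : Finset (Fin n) | σ ∈ nerve A ∧ σ.card = k + 1}.ncard

/-- The properties shared by the two constructed families, apart from the value of `f₂`. -/
structure IsSpecialFamily {n : ℕ} (A : Fin n → Set Plane) : Prop where
  /-- The family consists of `n` different sets. -/
  injective : Function.Injective A
  isOpen : ∀ i, IsOpen (A i)
  /-- The intersection of every subfamily is empty or path-connected. -/
  empty_or_pathConnected : ∀ σ : Finset (Fin n), interOf A σ = ∅ ∨ IsPathConnected (interOf A σ)
  /-- No four of the sets have a common point. -/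
  f_three : fNum 3 A = 0
  /-- All but (exactly) one of the sets are contractible. -/
  all_but_one_contractible : ∃! i, ¬ ContractibleSpace (A i)
  /-- Any two of the sets have a contractible (in particular nonempty) intersection. -/
  pair_contractible : ∀ σ : Finset (Fin n), σ.card = 2 → ContractibleSpace (interOf A σ)
  /-- Any three of the sets have an empty or contractible intersection. -/
  triple_contractible : ∀ σ : Finset (Fin n), σ.card = 3 →
    interOf A σ = ∅ ∨ ContractibleSpace (interOf A σ)

/-!
Both families consist of `m` "lines", which are contractible open sets any two of which meet in a
contractible set and no four of which have a common point, and of one further set, the complement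
of a closed set called the core. The core is made of closed rectangles, and contains
every point common to three lines, so the further set meets no three lines at once. Still, it leaves
a contractible part of each line and of each intersection of two lines. Hence
`f₃ = 0`, and `f₂` is the number `m.choose 2` of pairs of lines plus the number `t` of triples of
lines with a common point (`Layout.Good.fNum_two`). The complement of a nonempty bounded set is not
contractible (`not_contractibleSpace_of_circle_subset`), all other sets are. What remains is to find
`m` lines with many triples: `t ≥ (m² - 3m) / 3` for the first claim, and `t = m(m - 2) / 3`, for
infinitely many `m`, for the second one.

The geometry is discretized. The plane is cut into vertical strips `s ≤ x ≤ s + 1`, the slots, and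
over each of them a line is the product with an open interval with integer ends. A `Layout` lists
these intervals, and `Layout.Good` lists the combinatorial conditions on them from which all
the topology follows (`Layout.Good.isSpecialFamily`). A set that is, slot by slot, an interval, with
consecutive intervals overlapping, has convex vertical fibres and retracts onto the graph of a
continuous section (`contractibleSpace_slotSet`). The only slots where an intersection need not be
an interval are those where a line `v` is crossed by two others at once, inside its tall interval,
called its foot. There the core cuts the foot in two, but the two halves lead to the same
neighbouring slot, while on the other side the foot narrows to one of them or ends; so the slot can
be emptied by a horizontal push (`contractibleSpace_slotSet_of_isolated`).

For the first claim, the lines are modelled on the tangents of a deltoid, three of which are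
concurrent when their parameters, in a cyclic group, have sum zero. Line `i` follows the graph of
`|x + 16 i| / 4`, so that lines `i` and `j` cross near the slot `-8 (i + j)`, and lines far from the
middle have one of their branches replaced by a foot. A foot occupies three slots, and both outer
ones carry triples: the triples are those with `i + j + k` congruent to `0` or `1` modulo `m`
(`Deltoid.three_near_iff`, `Deltoid.le_ncard_triples`).

For the second claim, a layout of `n + 1` lines with two feet each is doubled (`Doubling.next`): the
old lines are stretched and lifted, except at their feet, and between them `n` new lines are
inserted. Any two new lines cross below the old ones, and on either side of the crossing the foot of
an old line reaches down to them; this gives `n (n - 1)` new triples. Each new line has a spike that reaches one old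
line at its crossing with the foot of another, which gives `n` more. So the number of triples grows
by `n²` (`Doubling.Stage.ncard_triples_next`), and is `(n² - 1) / 3` when `n` is a power of two.
-/

section PlaneSets
open Set Topology

/-! ### Slot sets -/

/-- The slot set of a family `W` of sets of reals: over the vertical strip `s ≤ x ≤ s + 1` it is
cut out by `y ∈ W s`, so over the line `x = s` both `W (s - 1)` and `W s` are imposed. This makes
the slot set of open sets open. -/
def slotSet (W : ℤ → Set ℝ) : Set (ℝ × ℝ) :=
  {p | ∀ s : ℤ, (s : ℝ) ≤ p.1 → p.1 ≤ s + 1 → p.2 ∈ W s}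

theorem locallyFinite_unit_Icc : LocallyFinite fun s : ℤ => Icc (s : ℝ) (s + 1) :=
  locallyFinite_Icc_of_tendsto tendsto_intCast_atTop_atTop
    (Filter.tendsto_atBot_add_const_right _ _ (tendsto_intCast_atBot_iff.2 Filter.tendsto_id))

theorem isOpen_slotSet {W : ℤ → Set ℝ} (hW : ∀ s, IsOpen (W s)) : IsOpen (slotSet W) := by
  have hc : IsClosed (⋃ s : ℤ, (Icc (s : ℝ) (s + 1)) ×ˢ (W s)ᶜ) := by
    refine LocallyFinite.isClosed_iUnion ?_ fun s => isClosed_Icc.prod (hW s).isClosed_compl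
    refine (locallyFinite_unit_Icc.preimage_continuous
      (g := fun p : ℝ × ℝ => p.1) continuous_fst).subset ?_
    intro s p hp
    exact hp.1
  rw [← isClosed_compl_iff]
  convert hc using 1
  ext p
  simp [slotSet, and_assoc]

theorem mem_slotSet_iff {W : ℤ → Set ℝ} {p : ℝ × ℝ} :
    p ∈ slotSet W ↔ p.2 ∈ W ⌊p.1⌋ ∧ p.2 ∈ W (⌈p.1⌉ - 1) := by
  constructor
  · intro h
    refine ⟨h _ (Int.floor_le _) (Int.lt_floor_add_one _).le, h _ ?_ ?_⟩
    · push_cast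
      linarith [Int.ceil_lt_add_one p.1]
    · push_cast
      linarith [Int.le_ceil p.1]
  · rintro ⟨h1, h2⟩ s hs hs'
    rcases hs'.lt_or_eq with h | h
    · rwa [← Int.floor_eq_iff.2 ⟨hs, h⟩]
    · have : ⌈p.1⌉ - 1 = s := by
        rw [h, Int.ceil_add_one, Int.ceil_intCast]; ring
      rwa [← this]

theorem slotSet_mono {W V : ℤ → Set ℝ} (h : ∀ s, W s ⊆ V s) : slotSet W ⊆ slotSet V :=
  fun _ hp s h1 h2 => h s (hp s h1 h2)

theorem ceil_sub_one_eq (x : ℝ) : ⌈x⌉ - 1 = ⌊x⌋ ∨ ⌈x⌉ - 1 + 1 = ⌊x⌋ := by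
  have h1 := Int.ceil_le_floor_add_one x
  have h2 := Int.floor_le_ceil x
  omega

theorem slotSet_nonempty {W : ℤ → Set ℝ} {s : ℤ} (h : (W s).Nonempty) :
    (slotSet W).Nonempty := by
  obtain ⟨y, hy⟩ := h
  refine ⟨((s : ℝ) + 1 / 2, y), mem_slotSet_iff.2 ?_⟩
  have h1 : ⌊(s : ℝ) + 1 / 2⌋ = s := Int.floor_eq_iff.2 ⟨by linarith, by linarith⟩
  have h2 : ⌈(s : ℝ) + 1 / 2⌉ = s + 1 :=
    Int.ceil_eq_iff.2 ⟨by push_cast; linarith, by push_cast; linarith⟩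
  simp only [h1, h2]
  simpa using hy

theorem slotSet_eq_empty {W : ℤ → Set ℝ} (h : ∀ s, W s = ∅) : slotSet W = ∅ := by
  ext p
  simp [mem_slotSet_iff, h]

/-! ### Contractible slot sets -/

/-- An open subset of the plane with convex vertical fibres over a nonempty convex projection is
contractible: it retracts onto the graph of a continuous section. -/
theorem contractibleSpace_of_convex_fibres {U : Set (ℝ × ℝ)} (hU : IsOpen U)
    (hf : ∀ x, Convex ℝ {y | (x, y) ∈ U}) (hB : Convex ℝ (Prod.fst '' U)) (hne : U.Nonempty) :
    ContractibleSpace U := by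
  obtain ⟨g, hg⟩ : ∃ g : C(Prod.fst '' U, ℝ), ∀ x : Prod.fst '' U, g x ∈ {y : ℝ | ((x : ℝ), y) ∈ U} := by
    refine exists_continuous_forall_mem_convex_of_local_const (fun x => hf x) ?_
    rintro ⟨_, ⟨x, y⟩, hxy, rfl⟩
    refine ⟨y, ?_⟩
    have : Continuous fun z : Prod.fst '' U => ((z : ℝ), y) := by fun_prop
    exact this.continuousAt.preimage_mem_nhds (hU.mem_nhds hxy)
  have := hB.contractibleSpace (hne.image _)
  let π : C(U, Prod.fst '' U) := ⟨fun p => ⟨p.1.1, p.1, p.2, rfl⟩, by fun_prop⟩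
  let σ : C(Prod.fst '' U, U) := ⟨fun x => ⟨(x, g x), hg x⟩, by fun_prop⟩
  have key : (σ.comp π).Homotopic (ContinuousMap.id U) := by
    refine ⟨⟨⟨fun q => ⟨(q.2.1.1, (1 - (q.1 : ℝ)) * g (π q.2) + q.1 * q.2.1.2), ?_⟩, ?_⟩, ?_, ?_⟩⟩
    · exact hf q.2.1.1 (hg (π q.2)) q.2.2 (sub_nonneg.2 q.1.2.2) q.1.2.1 (sub_add_cancel _ _)
    · fun_prop
    · intro p
      simp [π, σ]
    · intro p
      simp
  exact ContinuousMap.HomotopyEquiv.contractibleSpace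
    (Y := Prod.fst '' U) ⟨π, σ, key, by
      have : π.comp σ = ContinuousMap.id _ := by ext x; rfl
      rw [this]⟩

/-- A slot set with open convex slots, the nonempty slots forming an interval in which consecutive
ones meet, is contractible. -/
theorem contractibleSpace_slotSet {W : ℤ → Set ℝ} (ho : ∀ s, IsOpen (W s))
    (hc : ∀ s, Convex ℝ (W s)) (hne : ∃ s, (W s).Nonempty)
    (hord : OrdConnected {s | (W s).Nonempty})
    (hcons : ∀ s, (W s).Nonempty → (W (s + 1)).Nonempty → (W s ∩ W (s + 1)).Nonempty) :
    ContractibleSpace (slotSet W) := by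
  refine contractibleSpace_of_convex_fibres (isOpen_slotSet ho) ?_ ?_
    (slotSet_nonempty hne.choose_spec)
  · intro x
    have : {y | (x, y) ∈ slotSet W} = W ⌊x⌋ ∩ W (⌈x⌉ - 1) := by
      ext y
      simp [mem_slotSet_iff]
    rw [this]
    exact (hc _).inter (hc _)
  · rw [convex_iff_ordConnected]
    refine ⟨?_⟩
    rintro _ ⟨⟨x, y⟩, hxy, rfl⟩ _ ⟨⟨x', y'⟩, hxy', rfl⟩ z ⟨h1, h2⟩
    rw [mem_slotSet_iff] at hxy hxy'
    have e1 : (W ⌊z⌋).Nonempty := hord.out (x := ⌊x⌋) (y := ⌊x'⌋) ⟨y, hxy.1⟩ ⟨y', hxy'.1⟩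
      ⟨Int.floor_mono h1, Int.floor_mono h2⟩
    have e2 : (W (⌈z⌉ - 1)).Nonempty :=
      hord.out (x := ⌈x⌉ - 1) (y := ⌈x'⌉ - 1) ⟨y, hxy.2⟩ ⟨y', hxy'.2⟩
      ⟨by have := Int.ceil_mono h1; simp only at this; omega,
        by have := Int.ceil_mono h2; simp only at this; omega⟩
    have : (W ⌊z⌋ ∩ W (⌈z⌉ - 1)).Nonempty := by
      rcases ceil_sub_one_eq z with h | h
      · rw [h, inter_self]; exact e1
      · rw [← h] at e1 ⊢
        rw [inter_comm]
        exact hcons _ e2 e1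
    obtain ⟨w, hw⟩ := this
    exact ⟨(z, w), mem_slotSet_iff.2 hw, rfl⟩

/-- If a set is pushed inside itself, at all times, into a contractible subset, it is
contractible. -/
theorem contractibleSpace_of_push {X : Type*} [TopologicalSpace X] {S S' : Set X} (hS : S' ⊆ S)
    [ContractibleSpace S'] (H : unitInterval × X → X) (hH : Continuous H)
    (h0 : ∀ p ∈ S, H (0, p) = p) (ht : ∀ t, ∀ p ∈ S, H (t, p) ∈ S)
    (h1 : ∀ p ∈ S, H (1, p) ∈ S') : ContractibleSpace S := by
  rw [contractible_iff_id_nullhomotopic]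
  let ι : C(S', S) := ⟨inclusion hS, continuous_inclusion hS⟩
  let r : C(S, S') := ⟨fun p => ⟨H (1, p), h1 p p.2⟩, by fun_prop⟩
  have key : (ContinuousMap.id S).Homotopic (ι.comp r) :=
    ⟨⟨⟨fun q => ⟨H (q.1, q.2), ht _ _ q.2.2⟩, by fun_prop⟩,
      fun p => Subtype.ext (h0 p p.2), fun p => rfl⟩⟩
  obtain ⟨y, hy⟩ := (((id_nullhomotopic S').comp_left r).comp_right ι)
  exact ⟨y, key.trans hy⟩

/-! ### Emptying a slot -/

/-- The horizontal motion used to empty the strip over slot `s`: the identity up to `s - 1` and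
from `s + 3 / 2` on, sending all of `[s, s + 3 / 2]` to `s + 3 / 2`. -/
noncomputable def slotPush (s : ℤ) (x : ℝ) : ℝ :=
  max x (min (s - 1 + 5 / 2 * (x - (s - 1))) (s + 3 / 2))

theorem le_slotPush (s : ℤ) (x : ℝ) : x ≤ slotPush s x := le_max_left _ _

theorem slotPush_le {s : ℤ} {x : ℝ} (h : x ≤ s + 3 / 2) : slotPush s x ≤ s + 3 / 2 :=
  max_le h (min_le_right _ _)

theorem slotPush_of_le {s : ℤ} {x : ℝ} (h : x ≤ s - 1) : slotPush s x = x :=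
  max_eq_left (min_le_of_left_le (by linarith))

theorem slotPush_of_ge {s : ℤ} {x : ℝ} (h : s + 3 / 2 ≤ x) : slotPush s x = x :=
  max_eq_left (min_le_of_right_le h)

theorem le_slotPush_of_le {s : ℤ} {x : ℝ} (h : s ≤ x) : s + 3 / 2 ≤ slotPush s x :=
  le_max_of_le_right (le_min (by linarith) le_rfl)

/-- Pushing a point to the right, at most to where the motion ends, does not leave the slot set. -/
theorem mem_slotSet_of_le_slotPush {W : ℤ → Set ℝ} {s : ℤ} (h1 : W (s - 1) ⊆ W s)
    (h2 : W s ⊆ W (s + 1)) {x x' y : ℝ} (hp : (x, y) ∈ slotSet W) (hx : x ≤ x')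
    (hx' : x' ≤ slotPush s x) : (x', y) ∈ slotSet W := by
  rcases le_or_gt x (s - 1) with hs | hs
  · rw [slotPush_of_le hs] at hx'
    rwa [← le_antisymm hx hx']
  rcases le_or_gt (s + 3 / 2 : ℝ) x with hs' | hs'
  · rw [slotPush_of_ge hs'] at hx'
    rwa [← le_antisymm hx hx']
  have hx'' := hx'.trans (slotPush_le hs'.le)
  have hm : x ≤ s → y ∈ W (s - 1) := fun h =>
    hp (s - 1) (by push_cast; linarith) (by push_cast; linarith)
  have hz : x ≤ s + 1 → y ∈ W s := fun h => by
    rcases le_total x s with h' | h'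
    · exact h1 (hm h')
    · exact hp s h' h
  intro r hr hr'
  simp only at hr hr'
  have a1 : s - 2 < r := by
    have : ((s - 2 : ℤ) : ℝ) < r := by push_cast; linarith
    exact_mod_cast this
  have a2 : r < s + 2 := by
    have : (r : ℝ) < ((s + 2 : ℤ) : ℝ) := by push_cast; linarith
    exact_mod_cast this
  have : r = s - 1 ∨ r = s ∨ r = s + 1 := by omega
  rcases this with rfl | rfl | rfl
  · push_cast at hr'
    exact hm (by linarith)
  · exact hz (by linarith)
  · rcases le_total x (s + 1) with h' | h'
    · exact h2 (hz h')
    · exact hp _ (by push_cast; exact h') (by push_cast; linarith)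

/-- If `W (s - 1) ⊆ W s ⊆ W (s + 1)`, then shrinking `W s` to `W (s - 1)` does not affect
contractibility. -/
theorem contractibleSpace_slotSet_of_update {W : ℤ → Set ℝ} {s : ℤ} (h1 : W (s - 1) ⊆ W s)
    (h2 : W s ⊆ W (s + 1)) [ContractibleSpace (slotSet (Function.update W s (W (s - 1))))] :
    ContractibleSpace (slotSet W) := by
  have hpush : Continuous (slotPush s) := by unfold slotPush; fun_prop
  refine contractibleSpace_of_push (S' := slotSet (Function.update W s (W (s - 1)))) ?_
    (fun q => ((1 - (q.1 : ℝ)) * q.2.1 + q.1 * slotPush s q.2.1, q.2.2)) (by fun_prop) ?_ ?_ ?_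
  · refine slotSet_mono fun r => ?_
    rcases eq_or_ne r s with rfl | hr
    · simpa using h1
    · simp [hr]
  · rintro ⟨x, y⟩ -
    simp
  · rintro ⟨t, ht0, ht1⟩ ⟨x, y⟩ hp
    have := le_slotPush s x
    refine mem_slotSet_of_le_slotPush h1 h2 hp ?_ ?_ <;> simp only <;> nlinarith
  · rintro ⟨x, y⟩ hp
    have hp' : (slotPush s x, y) ∈ slotSet W :=
      mem_slotSet_of_le_slotPush h1 h2 hp (le_slotPush s x) le_rfl
    intro r hr hr'
    simp only [Icc.coe_one, sub_self, zero_mul, zero_add, one_mul] at hr hr' ⊢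
    rcases eq_or_ne r s with rfl | hrs
    · have hx : x < r := by
        by_contra h
        linarith [le_slotPush_of_le (not_lt.1 h)]
      have hx' : (r : ℝ) - 1 ≤ x := by
        by_contra h
        rw [slotPush_of_le (not_le.1 h).le] at hr
        linarith
      simpa using hp (r - 1) (by push_cast; exact hx') (by push_cast; linarith)
    · simpa [hrs] using hp' r hr hr'

theorem contractibleSpace_preimage_iff {X Y : Type*} [TopologicalSpace X] [TopologicalSpace Y]
    (e : X ≃ₜ Y) (S : Set Y) : ContractibleSpace (e ⁻¹' S) ↔ ContractibleSpace S :=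
  (e.sets (s := e ⁻¹' S) (t := S) rfl).contractibleSpace_iff

/-- Reflection in a vertical line exchanges the slots `s` and `-s - 1`. -/
theorem contractibleSpace_slotSet_reflect (W : ℤ → Set ℝ) :
    ContractibleSpace (slotSet fun s => W (-s - 1)) ↔ ContractibleSpace (slotSet W) := by
  rw [← contractibleSpace_preimage_iff ((Homeomorph.neg ℝ).prodCongr (Homeomorph.refl ℝ))
    (slotSet W)]
  have : (((Homeomorph.neg ℝ).prodCongr (Homeomorph.refl ℝ)) ⁻¹' slotSet W) =
      slotSet fun s => W (-s - 1) := by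
    ext ⟨x, y⟩
    simp only [slotSet, mem_preimage, Homeomorph.prodCongr, mem_ofPred_eq]
    constructor
    · intro h s h1 h2
      exact h (-s - 1) (by push_cast; simp; linarith) (by push_cast; simp; linarith)
    · intro h s h1 h2
      simp at h1 h2
      have := h (-s - 1) (by push_cast; linarith) (by push_cast; linarith)
      simpa using this
  rw [this]

/-- The two-sided form of `contractibleSpace_slotSet_of_update`. -/
theorem contractibleSpace_slotSet_of_update' {W : ℤ → Set ℝ} {s d : ℤ} (hd : d = 1 ∨ d = -1)
    (h1 : W (s - d) ⊆ W s) (h2 : W s ⊆ W (s + d))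
    [ContractibleSpace (slotSet (Function.update W s (W (s - d))))] :
    ContractibleSpace (slotSet W) := by
  rcases hd with rfl | rfl
  · exact contractibleSpace_slotSet_of_update h1 h2
  · rename_i hc
    rw [← contractibleSpace_slotSet_reflect] at hc ⊢
    have : (fun r => Function.update W s (W (s - -1)) (-r - 1)) =
        Function.update (fun r => W (-r - 1)) (-s - 1) (W (s - -1)) := by
      ext1 r
      rcases eq_or_ne r (-s - 1) with rfl | hr
      · simp
      · rw [Function.update_of_ne hr, Function.update_of_ne (by omega)]
    rw [this] at hc
    have e1 : -(-s - 1 - 1) - 1 = s + 1 := by ring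
    have e2 : -(-s - 1) - 1 = s := by ring
    have e3 : -(-s - 1 + 1) - 1 = s - 1 := by ring
    have hc' : ContractibleSpace (slotSet (Function.update (fun r => W (-r - 1)) (-s - 1)
        ((fun r => W (-r - 1)) (-s - 1 - 1)))) := by
      have e4 : -(-s - 1 - 1) - 1 = s - -1 := by ring
      change ContractibleSpace (slotSet (Function.update (fun r => W (-r - 1)) (-s - 1)
        (W (-(-s - 1 - 1) - 1))))
      rw [e4]
      exact hc
    refine contractibleSpace_slotSet_of_update (s := -s - 1) ?_ ?_
    · simp only [e1, e2]
      simpa using h1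
    · simp only [e2, e3]
      simpa [sub_eq_add_neg] using h2

/-- Contractibility of a slot set some of whose slots need not be convex, provided that these
slots are isolated and lie between their two neighbours. -/
theorem contractibleSpace_slotSet_of_isolated (bad : Finset ℤ) :
    ∀ {W : ℤ → Set ℝ}, (∀ s, IsOpen (W s)) → (∀ s, s ∉ bad → Convex ℝ (W s)) →
    (∃ s, s ∉ bad ∧ (W s).Nonempty) → OrdConnected {s | (W s).Nonempty} →
    (∀ s, (W s).Nonempty → (W (s + 1)).Nonempty → (W s ∩ W (s + 1)).Nonempty) →
    (∀ s ∈ bad, ∃ d : ℤ, (d = 1 ∨ d = -1) ∧ s + d ∉ bad ∧ s - d ∉ bad ∧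
      W (s - d) ⊆ W s ∧ W s ⊆ W (s + d)) → ContractibleSpace (slotSet W) := by
  induction bad using Finset.induction_on with
  | empty =>
    intro W ho hc ⟨s, _, hs⟩ hord hcons _
    exact contractibleSpace_slotSet ho (fun s => hc s (by simp)) ⟨s, hs⟩ hord hcons
  | insert s bad hs ih =>
    intro W ho hc hne hord hcons hbad
    obtain ⟨d, hd, hp, hm, h1, h2⟩ := hbad s (Finset.mem_insert_self _ _)
    have hd0 : d ≠ 0 := by omega
    set V := Function.update W s (W (s - d)) with hV
    have hVs : V s = W (s - d) := by simp [hV]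
    have hVr : ∀ r, r ≠ s → V r = W r := fun r hr => by simp [hV, hr]
    have hVW : ∀ r, V r ⊆ W r := fun r => by
      rcases eq_or_ne r s with rfl | hr
      · rwa [hVs]
      · rw [hVr r hr]
    have : ContractibleSpace (slotSet V) := by
      refine ih ?_ ?_ ?_ ?_ ?_ ?_
      · intro r
        rcases eq_or_ne r s with rfl | hr
        · rw [hVs]; exact ho _
        · rw [hVr r hr]; exact ho _
      · intro r hr
        rcases eq_or_ne r s with rfl | hrs
        · rw [hVs]; exact hc _ hm
        · rw [hVr r hrs]; exact hc _ (by simp [hrs, hr])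
      · obtain ⟨r, hr, hr'⟩ := hne
        simp only [Finset.mem_insert, not_or] at hr
        exact ⟨r, hr.2, by rwa [hVr r hr.1]⟩
      · refine ⟨fun a ha c hcc b hb => ?_⟩
        have hbW : (W b).Nonempty := hord.out (ha.mono (hVW a)) (hcc.mono (hVW c)) hb
        rcases eq_or_ne b s with rfl | hbs
        · change (V b).Nonempty
          rw [hVs]
          rcases eq_or_ne a b with rfl | hab
          · change (V a).Nonempty at ha; rwa [hVs] at ha
          rcases eq_or_ne c b with rfl | hcb
          · change (V c).Nonempty at hcc; rwa [hVs] at hcc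
          have hb1 := hb.1
          have hb2 := hb.2
          exact hord.out (ha.mono (hVW a)) (hcc.mono (hVW c)) ⟨by omega, by omega⟩
        · change (V b).Nonempty
          rwa [hVr b hbs]
      · intro r hr hr'
        have hk : ∀ r, r ≠ s - d → (V r).Nonempty → (V s).Nonempty → (r = s + d) →
            (V r ∩ V s).Nonempty := by
          rintro r - - hn rfl
          rw [hVs] at hn
          rw [hVr (s + d) (by omega), hVs]
          rwa [inter_eq_right.2 (h1.trans h2)]
        have hk' : (V s).Nonempty → (V (s - d) ∩ V s).Nonempty := by
          rw [hVr (s - d) (by omega), hVs]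
          intro h; simpa using h
        rcases eq_or_ne r s with rfl | hrs
        · rcases hd with rfl | rfl
          · rw [inter_comm]; exact hk _ (by omega) hr' hr rfl
          · rw [inter_comm]; simpa using hk' hr
        rcases eq_or_ne (r + 1) s with hrs' | hrs'
        · rw [hrs'] at hr' ⊢
          rcases hd with rfl | rfl
          · have : r = s - 1 := by omega
            rw [this]; exact hk' hr'
          · exact hk _ (by omega) hr hr' (by omega)
        · rw [hVr _ hrs, hVr _ hrs'] at *
          exact hcons r hr hr'
      · intro r hr
        obtain ⟨d', hd', hp', hm', h1', h2'⟩ := hbad r (by simp [hr])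
        have hsr : r ≠ s := fun h => hs (h ▸ hr)
        simp only [Finset.mem_insert, not_or] at hp' hm'
        exact ⟨d', hd', hp'.2, hm'.2, by rwa [hVr _ hm'.1, hVr _ hsr],
          by rwa [hVr _ hp'.1, hVr _ hsr]⟩
    exact contractibleSpace_slotSet_of_update' hd h1 h2

/-! ### Complements of bounded sets -/

/-- A plane open set that surrounds a missing point `p` is not contractible: on a contractible
open set avoiding `p`, the function `z - p` has a continuous logarithm, which is impossible on a
circle around `p`. -/
theorem not_contractibleSpace_of_circle_subset {U : Set (ℝ × ℝ)} (hU : IsOpen U) {p : ℝ × ℝ}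
    (hp : p ∉ U) {R : ℝ} (hR : 0 < R)
    (hc : ∀ t : ℝ, (p.1 + R * Real.cos t, p.2 + R * Real.sin t) ∈ U) :
    ¬ ContractibleSpace U := by
  intro hcon
  have hs : IsSimplyConnected U := SimplyConnectedSpace.ofContractible U
  obtain ⟨f, hf, hfe⟩ := Complex.exists_continuousOn_eqOn_exp_comp hs hU
    (g := fun q : ℝ × ℝ => ((q.1 - p.1 : ℝ) : ℂ) + ((q.2 - p.2 : ℝ) : ℂ) * Complex.I)
    (by fun_prop) (by
      rintro ⟨q, hq, h⟩
      rw [Complex.ext_iff] at h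
      simp at h
      apply hp
      convert hq using 1
      ext <;> linarith [h.1, h.2])
  -- on the circle, `(Im f - t) / 2π` is continuous and integral, but drops by one in a full turn
  set γ : ℝ → ℝ × ℝ := fun t => (p.1 + R * Real.cos t, p.2 + R * Real.sin t) with hγ
  have hγc : Continuous γ := by fun_prop
  have hcont : Continuous fun t : ℝ => ((f (γ t)).im - t) / (2 * Real.pi) := by
    have : Continuous fun t => f (γ t) := by
      refine hf.comp_continuous hγc hc
    exact ((Complex.continuous_im.comp this).sub continuous_id).div_const _
  have hint : ∀ t : ℝ, ∃ n : ℤ, ((f (γ t)).im - t) / (2 * Real.pi) = n := by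
    intro t
    have h1 : Complex.exp (f (γ t)) = Complex.exp (Real.log R + t * Complex.I) := by
      have := hfe (hc t)
      simp only [Function.comp_apply] at this
      rw [this, Complex.exp_add, Complex.exp_mul_I, ← Complex.ofReal_exp, Real.exp_log hR]
      simp
      ring
    obtain ⟨n, hn⟩ := Complex.exp_eq_exp_iff_exists_int.1 h1
    refine ⟨n, ?_⟩
    have h2 := congrArg Complex.im hn
    simp at h2
    have := Real.pi_pos
    field_simp
    linarith
  have hper : γ (2 * Real.pi) = γ 0 := by simp [hγ]
  obtain ⟨n, hn⟩ := hint 0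
  have hn2 : ((f (γ (2 * Real.pi))).im - 2 * Real.pi) / (2 * Real.pi) = n - 1 := by
    rw [hper, ← hn]
    have := Real.pi_pos
    field_simp
    ring
  obtain ⟨t, ht⟩ := mem_range_of_exists_le_of_exists_ge hcont (c := (n : ℝ) - 1 / 2)
    ⟨2 * Real.pi, by rw [hn2]; linarith⟩ ⟨0, by rw [hn]; linarith⟩
  obtain ⟨k, hk⟩ := hint t
  simp only at ht
  rw [hk] at ht
  have : (2 * k : ℤ) = 2 * n - 1 := by
    have : ((2 * k : ℤ) : ℝ) = ((2 * n - 1 : ℤ) : ℝ) := by push_cast; linarith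
    exact_mod_cast this
  omega

/-! ### Layouts -/

/-- A layout records, for every slot `s` and every line `i < m`, the open interval
`(lo s i, hi s i)` through which line `i` passes over the strip `s ≤ x ≤ s + 1` (the line is absent
when this interval is empty), and which line, if any, has a vertical piece (a foot) there. -/
structure Layout (m : ℕ) where
  lo : ℤ → ℤ → ℤ
  hi : ℤ → ℤ → ℤ
  foot : ℤ → ℤ → Prop

namespace Layout
variable {m : ℕ} (L : Layout m)

/-- Line `i` is present at slot `s`. -/
def Pres (s i : ℤ) : Prop := (0 ≤ i ∧ i < m) ∧ L.lo s i < L.hi s i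

/-- Lines `i` and `j` meet at slot `s`. -/
def Near (s i j : ℤ) : Prop :=
  L.Pres s i ∧ L.Pres s j ∧ L.lo s i < L.hi s j ∧ L.lo s j < L.hi s i

/-- Three lines meet at slot `s`: the foot `v`, a lower line `l` and an upper line `u`. -/
def Trip (s v l u : ℤ) : Prop :=
  L.foot s v ∧ v ≠ l ∧ v ≠ u ∧ L.Near s v l ∧ L.Near s v u ∧ L.Near s l u ∧ L.lo s l < L.lo s u

/-- The sets of three lines that meet at some slot. -/
def triples : Set (Finset ℤ) :=
  {τ | τ.card = 3 ∧ ∃ s, ∀ i ∈ τ, ∀ j ∈ τ, i ≠ j → L.Near s i j}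

/-- The direction in which a foot is thicker: towards the middle one of the three consecutive slots
that a foot occupies, which is the one divisible by four. -/
def dir (s : ℤ) : ℤ := if s % 4 = 3 then 1 else -1

/-- The combinatorial conditions under which a layout yields a family of plane sets as wanted. In
all of them, the slots `s ± 1` are the neighbours of `s`; if `s` carries a triple, then `s + dir s`
is the neighbour at which the foot continues in full height. -/
structure Good : Prop where
  foot_unique : ∀ {s v w}, L.foot s v → L.foot s w → v = w
  foot_bounded : ∃ X : ℤ, ∀ s v, L.foot s v → |s| ≤ X
  /-- A line is present on an interval of slots, and its pieces overlap. -/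
  pres_ord : ∀ {a b c i}, L.Pres a i → L.Pres c i → a ≤ b → b ≤ c → L.Pres b i
  pres_cont : ∀ {s i}, L.Pres s i → L.Pres (s + 1) i →
    L.lo s i < L.hi (s + 1) i ∧ L.lo (s + 1) i < L.hi s i
  /-- Two lines meet on an interval of slots, and their intersections overlap. -/
  near_ord : ∀ {a b c i j}, i ≠ j → L.Near a i j → L.Near c i j → a ≤ b → b ≤ c → L.Near b i j
  near_cont : ∀ {s i j}, i ≠ j → L.Near s i j → L.Near (s + 1) i j →
    L.lo s i < L.hi (s + 1) j ∧ L.lo (s + 1) i < L.hi s j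
  /-- Any two lines meet somewhere outside the core. -/
  near_pair : ∀ {i j : ℤ}, 0 ≤ i → i < m → 0 ≤ j → j < m → i ≠ j →
    ∃ s, L.Near s i j ∧ ∀ v, ¬ L.Trip s v i j ∧ ¬ L.Trip s v j i
  /-- Three lines meet in one slot at most, and one of them has a foot there. -/
  near_three : ∀ {s i j k}, i ≠ j → i ≠ k → j ≠ k → L.Near s i j → L.Near s i k → L.Near s j k →
    L.foot s i ∨ L.foot s j ∨ L.foot s k
  three_slot : ∀ {s s' i j k}, i ≠ j → i ≠ k → j ≠ k → L.Near s i j → L.Near s i k →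
    L.Near s j k → L.Near s' i j → L.Near s' i k → L.Near s' j k → s = s'
  /-- The foot contains the two other lines, which overlap without being nested. -/
  foot_three : ∀ {s v l u}, L.foot s v → v ≠ l → v ≠ u → l ≠ u → L.Near s v l → L.Near s v u →
    L.Near s l u → L.lo s v < L.lo s l ∧ L.hi s l ≤ L.hi s v ∧
      ((L.lo s l < L.lo s u ∧ L.hi s l < L.hi s u) ∨ (L.lo s u < L.lo s l ∧ L.hi s u < L.hi s l))
  /-- At a foot, the lines meeting it meet each other in disjoint pairs only. -/
  partner : ∀ {s v l u u'}, L.foot s v → v ≠ l → v ≠ u → v ≠ u' → l ≠ u → l ≠ u' →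
    L.Near s v l → L.Near s v u → L.Near s v u' → L.Near s l u → L.Near s l u' → u = u'
  trip_odd : ∀ {s v l u}, L.Trip s v l u → s % 2 = 1
  /-- The foot widens in the direction `dir s`. -/
  squeeze_in : ∀ {s v l u}, L.Trip s v l u →
    L.lo (s + dir s) v ≤ L.lo s v ∧ L.hi s v ≤ L.hi (s + dir s) v
  /-- On the other side it narrows and misses one of the two parts into which the core divides it. -/
  squeeze_out : ∀ {s v l u}, L.Trip s v l u → L.Pres (s - dir s) v →
    L.lo s v ≤ L.lo (s - dir s) v ∧ L.hi (s - dir s) v ≤ L.hi s v ∧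
      (L.hi (s - dir s) v ≤ L.lo s u ∨ L.hi s l ≤ L.lo (s - dir s) v)
  /-- On that side it does not meet the two lines of the triple any more. -/
  not_near : ∀ {s v l u}, L.Trip s v l u →
    ¬ L.Near (s - dir s) v l ∧ ¬ L.Near (s - dir s) v u
  /-- The part of the lower line below the core continues to both sides, as does the part of the
  upper line above the core. -/
  clear_lower : ∀ {s v l u t}, L.Trip s v l u → (t = s + 1 ∨ t = s - 1) → L.Pres t l →
    L.lo t l < L.lo s u ∧ L.lo s l < L.hi t l
  clear_upper : ∀ {s v l u t}, L.Trip s v l u → (t = s + 1 ∨ t = s - 1) → L.Pres t u →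
    L.lo t u < L.hi s u ∧ L.hi s l < L.hi t u
  /-- The two lines do not meet on both sides of the triple. -/
  trip_end : ∀ {s v l u}, L.Trip s v l u → ¬ L.Near (s - 1) l u ∨ ¬ L.Near (s + 1) l u

variable {L}

theorem Near.symm {s i j : ℤ} (h : L.Near s i j) : L.Near s j i := ⟨h.2.1, h.1, h.2.2.2, h.2.2.1⟩

theorem dir_eq (s : ℤ) : dir s = 1 ∨ dir s = -1 := by
  unfold dir; split_ifs <;> simp

variable (L)

/-- The open interval through which line `i` passes at slot `s`. -/
def band (s i : ℤ) : Set ℝ := Ioo (L.lo s i : ℝ) (L.hi s i)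

/-- The closed intervals whose interiors are common to three lines at slot `s`. -/
def core (s : ℤ) : Set ℝ :=
  ⋃ t : Fin m × Fin m × Fin m, ⋃ (_ : L.Trip s t.1 t.2.1 t.2.2),
    Icc (L.lo s t.2.2 : ℝ) (L.hi s t.2.1)

variable {L}

theorem mem_core {s : ℤ} {y : ℝ} :
    y ∈ L.core s ↔ ∃ v l u, L.Trip s v l u ∧ (L.lo s u : ℝ) ≤ y ∧ y ≤ L.hi s l := by
  simp only [core, mem_iUnion, mem_Icc, exists_prop]
  constructor
  · rintro ⟨t, h, h'⟩
    exact ⟨_, _, _, h, h'⟩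
  · rintro ⟨v, l, u, h, h'⟩
    obtain ⟨-, -, -, ⟨⟨⟨v0, vm⟩, -⟩, ⟨⟨l0, lm⟩, -⟩, -⟩, ⟨-, ⟨⟨u0, um⟩, -⟩, -⟩, -⟩ := id h
    lift v to ℕ using v0
    lift l to ℕ using l0
    lift u to ℕ using u0
    exact ⟨(⟨v, by omega⟩, ⟨l, by omega⟩, ⟨u, by omega⟩), h, h'⟩

theorem isClosed_core (s : ℤ) : IsClosed (L.core s) :=
  isClosed_iUnion_of_finite fun _ => isClosed_iUnion_of_finite fun _ => isClosed_Icc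

theorem isOpen_band (s i : ℤ) : IsOpen (L.band s i) := isOpen_Ioo

theorem band_nonempty {s i : ℤ} : (L.band s i).Nonempty ↔ L.lo s i < L.hi s i := by
  simp [band, nonempty_Ioo]

theorem pres_of_mem {s i : ℤ} (hi : 0 ≤ i ∧ i < m) {y : ℝ} (h : y ∈ L.band s i) : L.Pres s i :=
  ⟨hi, band_nonempty.1 ⟨y, h⟩⟩

theorem near_of_mem {s i j : ℤ} (hi : 0 ≤ i ∧ i < m) (hj : 0 ≤ j ∧ j < m) {y : ℝ}
    (h : y ∈ L.band s i) (h' : y ∈ L.band s j) : L.Near s i j :=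
  ⟨pres_of_mem hi h, pres_of_mem hj h', by exact_mod_cast h.1.trans h'.2,
    by exact_mod_cast h'.1.trans h.2⟩

/-- Two integer intervals with the stated inequalities have a common point. -/
theorem exists_mem_band_inter {s t i j : ℤ} (h1 : L.lo s i < L.hi s i) (h2 : L.lo t j < L.hi t j)
    (h3 : L.lo s i < L.hi t j) (h4 : L.lo t j < L.hi s i) :
    (L.band s i ∩ L.band t j).Nonempty := by
  rw [band, band, Ioo_inter_Ioo, nonempty_Ioo]
  simp only [sup_lt_iff, lt_inf_iff, Int.cast_lt]
  exact ⟨⟨h1, h4⟩, h3, h2⟩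

namespace Good
variable (hL : L.Good)
include hL

theorem core_eq_empty {s : ℤ} (h : s % 2 ≠ 1) : L.core s = ∅ := by
  ext y
  simp only [mem_core, mem_empty_iff_false, iff_false]
  rintro ⟨v, l, u, ht, -⟩
  exact h (hL.trip_odd ht)

end Good
end Layout

namespace Layout
variable {m : ℕ} {L : Layout m}

/-! ### Lines and the core at a single slot -/

/-- Line `i` belongs to a triple at slot `s` whose foot is `v ≠ i`. -/
def Side (L : Layout m) (s v i : ℤ) : Prop := ∃ w, L.Trip s v i w ∨ L.Trip s v w i

theorem Trip.ne {s v l u : ℤ} (h : L.Trip s v l u) : l ≠ u := by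
  rintro rfl
  exact lt_irrefl _ h.2.2.2.2.2.2

theorem dir_mod {s : ℤ} (h : s % 2 = 1) : (s + dir s) % 2 ≠ 1 ∧ (s - dir s) % 2 ≠ 1 := by
  rcases dir_eq s with h' | h' <;> rw [h'] <;> omega

theorem eq_dir {s t : ℤ} (ht : t = s + 1 ∨ t = s - 1) : t = s + dir s ∨ t = s - dir s := by
  rcases dir_eq s with h | h <;> rw [h] <;> omega

namespace Good
variable (hL : L.Good)
include hL

theorem trip_facts {s v l u : ℤ} (h : L.Trip s v l u) :
    L.lo s v < L.lo s l ∧ L.lo s l < L.lo s u ∧ L.lo s u < L.hi s l ∧ L.hi s l < L.hi s u ∧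
      L.hi s u ≤ L.hi s v := by
  obtain ⟨hf, h1, h2, n1, n2, n3, hlt⟩ := id h
  obtain ⟨a1, a2, a3⟩ := hL.foot_three hf h1 h2 h.ne n1 n2 n3
  obtain ⟨b1, b2, b3⟩ := hL.foot_three hf h2 h1 h.ne.symm n2 n1 n3.symm
  have := n3.2.2.2
  omega

/-- Three lines meeting at a slot form a triple in some order. -/
theorem exists_trip_of_near {s i j k : ℤ} (hij : i ≠ j) (hik : i ≠ k) (hjk : j ≠ k)
    (h1 : L.Near s i j) (h2 : L.Near s i k) (h3 : L.Near s j k) :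
    ∃ v l u, L.Trip s v l u := by
  have key : ∀ {v l u}, v ≠ l → v ≠ u → l ≠ u → L.Near s v l → L.Near s v u → L.Near s l u →
      L.foot s v → ∃ v l u, L.Trip s v l u := by
    intro v l u hvl hvu hlu n1 n2 n3 hf
    rcases (hL.foot_three hf hvl hvu hlu n1 n2 n3).2.2 with h | h
    · exact ⟨v, l, u, hf, hvl, hvu, n1, n2, n3, h.1⟩
    · exact ⟨v, u, l, hf, hvu, hvl, n2, n1, n3.symm, h.1⟩
  rcases hL.near_three hij hik hjk h1 h2 h3 with h | h | h
  · exact key hij hik hjk h1 h2 h3 h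
  · exact key hij.symm hjk hik h1.symm h3 h2 h
  · exact key hik.symm hjk.symm hij h2.symm h3.symm h1 h

/-- A foot contains the lines that form a triple with it. -/
theorem band_side_subset {s v i : ℤ} (h : L.Side s v i) : L.band s i ⊆ L.band s v := by
  obtain ⟨w, h | h⟩ := h <;> have := hL.trip_facts h <;>
    exact Ioo_subset_Ioo (by exact_mod_cast by omega) (by exact_mod_cast by omega)

/-- No fourth line meets the core at a triple. -/
theorem mem_trip {s v l u i : ℤ} (hi : 0 ≤ i ∧ i < m) {y : ℝ} (h : L.Trip s v l u)
    (h1 : (L.lo s u : ℝ) ≤ y) (h2 : y ≤ L.hi s l) (h3 : y ∈ L.band s i) :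
    i = v ∨ i = l ∨ i = u := by
  by_contra! hne
  have hf := hL.trip_facts h
  have c1 : L.lo s i < L.hi s l := by exact_mod_cast h3.1.trans_le h2
  have c2 : L.lo s u < L.hi s i := by exact_mod_cast h1.trans_lt h3.2
  have hp := pres_of_mem hi h3
  obtain ⟨hfo, hl, hu, n1, n2, n3, -⟩ := h
  have m1 : L.Near s i l := ⟨hp, n1.2.1, by omega, by omega⟩
  have m2 : L.Near s i u := ⟨hp, n2.2.1, by omega, by omega⟩
  rcases hL.near_three hne.2.1 hne.2.2 (fun h => by rw [h] at hf; omega) m1 m2 n3 with h | h | h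
  · exact hne.1 (hL.foot_unique h hfo)
  · exact hl (hL.foot_unique hfo h)
  · exact hu (hL.foot_unique hfo h)

/-- Removing the core from a line that has no foot at the slot only cuts off ends. -/
theorem convex_rest {s i : ℤ} (hi : 0 ≤ i ∧ i < m) (hf : ¬ L.foot s i) :
    Convex ℝ (L.band s i \ L.core s) := by
  rw [convex_iff_ordConnected]
  refine ⟨fun a ha c hc b hb => ⟨⟨ha.1.1.trans_le hb.1, hb.2.trans_lt hc.1.2⟩, fun hbc => ?_⟩⟩
  obtain ⟨v, l, u, ht, h1, h2⟩ := mem_core.1 hbc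
  rcases hL.mem_trip hi ht h1 h2 ⟨ha.1.1.trans_le hb.1, hb.2.trans_lt hc.1.2⟩ with rfl | rfl | rfl
  · exact hf ht.1
  · exact hc.2 (mem_core.2 ⟨_, _, _, ht, h1.trans hb.2, hc.1.2.le⟩)
  · exact ha.2 (mem_core.2 ⟨_, _, _, ht, ha.1.1.le, hb.1.trans h2⟩)

/-- Below the interval of its triple the lower line is free of the core. -/
theorem lower_rest {s v l u : ℤ} (h : L.Trip s v l u) {y : ℝ} (h1 : (L.lo s l : ℝ) < y)
    (h2 : y < L.lo s u) : y ∈ L.band s l \ L.core s := by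
  have hf := hL.trip_facts h
  have hb : y ∈ L.band s l := ⟨h1, h2.trans (by exact_mod_cast hf.2.2.1)⟩
  refine ⟨hb, fun hc => ?_⟩
  obtain ⟨v', l', u', h', a1, a2⟩ := mem_core.1 hc
  obtain rfl := hL.foot_unique h.1 h'.1
  have hf' := hL.trip_facts h'
  rcases hL.mem_trip h.2.2.2.1.2.1.1 h' a1 a2 hb with rfl | rfl | rfl
  · exact h.2.1 rfl
  · obtain rfl := hL.partner h.1 h.2.1 h.2.2.1 h'.2.2.1 h.ne h'.ne h.2.2.2.1
      h.2.2.2.2.1 h'.2.2.2.2.1 h.2.2.2.2.2.1 h'.2.2.2.2.2.1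
    linarith
  · obtain rfl := hL.partner h.1 h.2.1 h.2.2.1 h'.2.1 h.ne h'.ne.symm h.2.2.2.1
      h.2.2.2.2.1 h'.2.2.2.1 h.2.2.2.2.2.1 h'.2.2.2.2.2.1.symm
    omega

theorem upper_rest {s v l u : ℤ} (h : L.Trip s v l u) {y : ℝ} (h1 : (L.hi s l : ℝ) < y)
    (h2 : y < L.hi s u) : y ∈ L.band s u \ L.core s := by
  have hf := hL.trip_facts h
  have hb : y ∈ L.band s u := ⟨lt_trans (by exact_mod_cast hf.2.2.1) h1, h2⟩
  refine ⟨hb, fun hc => ?_⟩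
  obtain ⟨v', l', u', h', a1, a2⟩ := mem_core.1 hc
  obtain rfl := hL.foot_unique h.1 h'.1
  have hf' := hL.trip_facts h'
  rcases hL.mem_trip h.2.2.2.2.1.2.1.1 h' a1 a2 hb with rfl | rfl | rfl
  · exact h.2.2.1 rfl
  · obtain rfl := hL.partner h.1 h.2.2.1 h.2.1 h'.2.2.1 h.ne.symm h'.ne h.2.2.2.2.1
      h.2.2.2.1 h'.2.2.2.2.1 h.2.2.2.2.2.1.symm h'.2.2.2.2.2.1
    omega
  · obtain rfl := hL.partner h.1 h.2.2.1 h.2.1 h'.2.1 h.ne.symm h'.ne.symm h.2.2.2.2.1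
      h.2.2.2.1 h'.2.2.2.1 h.2.2.2.2.2.1.symm h'.2.2.2.2.2.1.symm
    linarith

theorem side_rest_inter {s v i t : ℤ} (h : L.Side s v i) (ht : t = s + 1 ∨ t = s - 1)
    (hp : L.Pres t i) : ((L.band s i \ L.core s) ∩ L.band t i).Nonempty := by
  obtain ⟨w, h | h⟩ := h
  · obtain ⟨a1, a2⟩ := hL.clear_lower h ht hp
    have hf := hL.trip_facts h
    have : (Ioo (L.lo s i : ℝ) (L.lo s w) ∩ L.band t i).Nonempty := by
      rw [band, Ioo_inter_Ioo, nonempty_Ioo]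
      simp only [sup_lt_iff, lt_inf_iff, Int.cast_lt]
      exact ⟨⟨hf.2.1, a1⟩, a2, hp.2⟩
    exact this.mono (inter_subset_inter_left _ fun y hy => hL.lower_rest h hy.1 hy.2)
  · obtain ⟨a1, a2⟩ := hL.clear_upper h ht hp
    have hf := hL.trip_facts h
    have : (Ioo (L.hi s w : ℝ) (L.hi s i) ∩ L.band t i).Nonempty := by
      rw [band, Ioo_inter_Ioo, nonempty_Ioo]
      simp only [sup_lt_iff, lt_inf_iff, Int.cast_lt]
      exact ⟨⟨hf.2.2.2.1, a1⟩, a2, hp.2⟩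
    exact this.mono (inter_subset_inter_left _ fun y hy => hL.upper_rest h hy.1 hy.2)

theorem side_rest_nonempty {s v i : ℤ} (h : L.Side s v i) :
    (L.band s i \ L.core s).Nonempty := by
  obtain ⟨w, h | h⟩ := h
  · have hf := hL.trip_facts h
    have : (L.lo s i : ℝ) < L.lo s w := by exact_mod_cast hf.2.1
    obtain ⟨y, h1, h2⟩ := exists_between this
    exact ⟨y, hL.lower_rest h h1 h2⟩
  · have hf := hL.trip_facts h
    have : (L.hi s w : ℝ) < L.hi s i := by exact_mod_cast hf.2.2.2.1
    obtain ⟨y, h1, h2⟩ := exists_between this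
    exact ⟨y, hL.upper_rest h h1 h2⟩

/-- A line either misses the core at a slot, or is the foot of a triple, or another line of one. -/
theorem line_cases {s i : ℤ} (hi : 0 ≤ i ∧ i < m) :
    L.band s i \ L.core s = L.band s i ∨ (∃ l u, L.Trip s i l u) ∨ ∃ v, L.Side s v i := by
  by_cases h : Disjoint (L.band s i) (L.core s)
  · exact Or.inl h.sdiff_eq_left
  · right
    obtain ⟨y, hy, hc⟩ := not_disjoint_iff.1 h
    obtain ⟨v, l, u, ht, h1, h2⟩ := mem_core.1 hc
    rcases hL.mem_trip hi ht h1 h2 hy with rfl | rfl | rfl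
    · exact Or.inl ⟨_, _, ht⟩
    · exact Or.inr ⟨_, _, Or.inl ht⟩
    · exact Or.inr ⟨_, _, Or.inr ht⟩

theorem pair_cases {s i j : ℤ} (hi : 0 ≤ i ∧ i < m) (hj : 0 ≤ j ∧ j < m) (hij : i ≠ j)
    (hb : ∀ v, ¬ L.Trip s v i j ∧ ¬ L.Trip s v j i) :
    (L.band s i ∩ L.band s j) \ L.core s = L.band s i ∩ L.band s j ∨
      L.Side s i j ∨ L.Side s j i := by
  by_cases h : Disjoint (L.band s i ∩ L.band s j) (L.core s)
  · exact Or.inl h.sdiff_eq_left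
  · right
    obtain ⟨y, hy, hc⟩ := not_disjoint_iff.1 h
    obtain ⟨v, l, u, ht, h1, h2⟩ := mem_core.1 hc
    have a := hL.mem_trip hi ht h1 h2 hy.1
    have b := hL.mem_trip hj ht h1 h2 hy.2
    rcases a with rfl | rfl | rfl <;> rcases b with rfl | rfl | rfl <;>
      first
      | exact absurd rfl hij
      | exact absurd ht (hb _).1
      | exact absurd ht (hb _).2
      | exact Or.inl ⟨_, Or.inl ht⟩
      | exact Or.inl ⟨_, Or.inr ht⟩
      | exact Or.inr ⟨_, Or.inl ht⟩
      | exact Or.inr ⟨_, Or.inr ht⟩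

/-- Two lines meet outside the core exactly if they meet and are not the lower and the upper line
of a triple. -/
theorem pair_rest_nonempty_iff {s i j : ℤ} (hi : 0 ≤ i ∧ i < m) (hj : 0 ≤ j ∧ j < m) (hij : i ≠ j) :
    ((L.band s i ∩ L.band s j) \ L.core s).Nonempty ↔
      L.Near s i j ∧ ∀ v, ¬ L.Trip s v i j ∧ ¬ L.Trip s v j i := by
  constructor
  · rintro ⟨y, ⟨h1, h2⟩, hc⟩
    refine ⟨near_of_mem hi hj h1 h2, fun v => ⟨fun h => hc ?_, fun h => hc ?_⟩⟩
    · exact mem_core.2 ⟨_, _, _, h, h2.1.le, h1.2.le⟩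
    · exact mem_core.2 ⟨_, _, _, h, h1.1.le, h2.2.le⟩
  · rintro ⟨hn, hb⟩
    rcases hL.pair_cases hi hj hij hb with h | h | h
    · rw [h]
      exact exists_mem_band_inter hn.1.2 hn.2.1.2 hn.2.2.1 hn.2.2.2
    · rw [inter_eq_right.2 (hL.band_side_subset h)]
      exact hL.side_rest_nonempty h
    · rw [inter_eq_left.2 (hL.band_side_subset h)]
      exact hL.side_rest_nonempty h

/-- The hypothesis of `contractibleSpace_slotSet_of_isolated` at a slot where the line is the foot
of a triple. -/
theorem foot_push {s i l u : ℤ} (hi : 0 ≤ i ∧ i < m) (h : L.Trip s i l u) :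
    L.band (s - dir s) i \ L.core (s - dir s) ⊆ L.band s i \ L.core s ∧
      L.band s i \ L.core s ⊆ L.band (s + dir s) i \ L.core (s + dir s) := by
  have hm := dir_mod (hL.trip_odd h)
  rw [hL.core_eq_empty hm.1, hL.core_eq_empty hm.2, sdiff_empty, sdiff_empty]
  constructor
  · intro y hy
    have hp := pres_of_mem hi hy
    obtain ⟨a1, a2, -⟩ := hL.squeeze_out h hp
    refine ⟨Ioo_subset_Ioo (by exact_mod_cast a1) (by exact_mod_cast a2) hy, fun hc => ?_⟩
    obtain ⟨v', l', u', h', b1, b2⟩ := mem_core.1 hc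
    obtain rfl := hL.foot_unique h.1 h'.1
    rcases (hL.squeeze_out h' hp).2.2 with c | c
    · have := hy.2.trans_le (by exact_mod_cast c : _ ≤ (L.lo s u' : ℝ))
      linarith
    · have := (by exact_mod_cast c : (L.hi s l' : ℝ) ≤ _).trans_lt hy.1
      linarith
  · obtain ⟨a1, a2⟩ := hL.squeeze_in h
    exact sdiff_subset.trans (Ioo_subset_Ioo (by exact_mod_cast a1) (by exact_mod_cast a2))

theorem foot_rest_nonempty {s i l u : ℤ} (h : L.Trip s i l u) :
    (L.band s i \ L.core s).Nonempty :=
  (hL.side_rest_nonempty ⟨u, Or.inl h⟩).mono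
    (sdiff_subset_sdiff_left (hL.band_side_subset ⟨u, Or.inl h⟩))

theorem rest_nonempty_iff {s i : ℤ} (hi : 0 ≤ i ∧ i < m) :
    (L.band s i \ L.core s).Nonempty ↔ L.Pres s i := by
  constructor
  · exact fun ⟨y, hy, _⟩ => pres_of_mem hi hy
  · intro hp
    rcases hL.line_cases hi (s := s) with h | ⟨l, u, h⟩ | ⟨v, h⟩
    · rw [h]; exact band_nonempty.2 hp.2
    · exact hL.foot_rest_nonempty h
    · exact hL.side_rest_nonempty h

theorem pres_cont' {s t i : ℤ} (ht : t = s + 1 ∨ t = s - 1) (h1 : L.Pres s i) (h2 : L.Pres t i) :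
    L.lo s i < L.hi t i ∧ L.lo t i < L.hi s i := by
  rcases ht with rfl | rfl
  · exact hL.pres_cont h1 h2
  · have := hL.pres_cont h2 (by rwa [sub_add_cancel])
    rw [sub_add_cancel] at this
    exact this.symm

theorem near_cont' {s t i j : ℤ} (hij : i ≠ j) (ht : t = s + 1 ∨ t = s - 1) (h1 : L.Near s i j)
    (h2 : L.Near t i j) : L.lo s i < L.hi t j ∧ L.lo t i < L.hi s j := by
  rcases ht with rfl | rfl
  · exact hL.near_cont hij h1 h2
  · have := hL.near_cont hij h2 (by rwa [sub_add_cancel])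
    rw [sub_add_cancel] at this
    exact this.symm

theorem rest_cont_of_even {s t i : ℤ} (hi : 0 ≤ i ∧ i < m) (ht : t = s + 1 ∨ t = s - 1)
    (h2 : t % 2 ≠ 1) (hs : L.Pres s i) (hp : L.Pres t i) :
    ((L.band s i \ L.core s) ∩ (L.band t i \ L.core t)).Nonempty := by
  rcases hL.line_cases hi (s := s) with h | ⟨l, u, h⟩ | ⟨v, h⟩
  · rw [hL.core_eq_empty h2, sdiff_empty, h]
    have := hL.pres_cont' ht hs hp
    exact exists_mem_band_inter hs.2 hp.2 this.1 this.2
  · obtain ⟨a1, a2⟩ := hL.foot_push hi h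
    rcases eq_dir ht with rfl | rfl
    · rw [inter_eq_left.2 a2]
      exact hL.foot_rest_nonempty h
    · rw [inter_eq_right.2 a1]
      exact (hL.rest_nonempty_iff hi).2 hp
  · rw [hL.core_eq_empty h2, sdiff_empty]
    exact hL.side_rest_inter h ht hp

theorem rest_cont {s i : ℤ} (hi : 0 ≤ i ∧ i < m) (hs : L.Pres s i) (hp : L.Pres (s + 1) i) :
    ((L.band s i \ L.core s) ∩ (L.band (s + 1) i \ L.core (s + 1))).Nonempty := by
  by_cases h : s % 2 = 1
  · exact hL.rest_cont_of_even hi (Or.inl rfl) (by omega) hs hp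
  · rw [inter_comm]
    exact hL.rest_cont_of_even hi (Or.inr (by omega)) h hp hs

theorem pair_band_cont {s t i j : ℤ} (hij : i ≠ j) (ht : t = s + 1 ∨ t = s - 1)
    (hs : L.Near s i j) (hp : L.Near t i j) :
    ((L.band s i ∩ L.band s j) ∩ (L.band t i ∩ L.band t j)).Nonempty := by
  obtain ⟨a1, a2⟩ := hL.near_cont' hij ht hs hp
  obtain ⟨b1, b2⟩ := hL.near_cont' hij.symm ht hs.symm hp.symm
  obtain ⟨c1, c2⟩ := hL.pres_cont' ht hs.1 hp.1
  obtain ⟨d1, d2⟩ := hL.pres_cont' ht hs.2.1 hp.2.1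
  obtain ⟨⟨-, e1⟩, ⟨-, e2⟩, e3, e4⟩ := hs
  obtain ⟨⟨-, f1⟩, ⟨-, f2⟩, f3, f4⟩ := hp
  simp only [band, Ioo_inter_Ioo, nonempty_Ioo, sup_lt_iff, lt_inf_iff, Int.cast_lt]
  tauto

theorem pair_rest_cont_of_even {s t i j : ℤ} (hi : 0 ≤ i ∧ i < m) (hj : 0 ≤ j ∧ j < m)
    (hij : i ≠ j) (ht : t = s + 1 ∨ t = s - 1) (h2 : t % 2 ≠ 1)
    (hs : L.Near s i j) (hp : L.Near t i j) (hb : ∀ v, ¬ L.Trip s v i j ∧ ¬ L.Trip s v j i) :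
    (((L.band s i ∩ L.band s j) \ L.core s) ∩ ((L.band t i ∩ L.band t j) \ L.core t)).Nonempty := by
  rw [hL.core_eq_empty h2, sdiff_empty]
  have key : ∀ {i j : ℤ}, 0 ≤ i ∧ i < m → L.Near t i j → L.Side s i j →
      (((L.band s i ∩ L.band s j) \ L.core s) ∩ (L.band t i ∩ L.band t j)).Nonempty := by
    intro i j hi hp h
    rw [inter_eq_right.2 (hL.band_side_subset h)]
    rcases eq_dir ht with rfl | rfl
    · have h3 : L.band s j ⊆ L.band (s + dir s) i := by
        refine (hL.band_side_subset h).trans ?_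
        obtain ⟨w, h | h⟩ := h <;> obtain ⟨a1, a2⟩ := hL.squeeze_in h <;>
          exact Ioo_subset_Ioo (by exact_mod_cast a1) (by exact_mod_cast a2)
      obtain ⟨y, hy, hy'⟩ := hL.side_rest_inter h ht hp.2.1
      exact ⟨y, hy, h3 hy.1, hy'⟩
    · obtain ⟨w, h | h⟩ := h
      · exact absurd hp (hL.not_near h).1
      · exact absurd hp (hL.not_near h).2
  rcases hL.pair_cases hi hj hij hb with h | h | h
  · rw [h]
    exact hL.pair_band_cont hij ht hs hp
  · exact key hi hp h
  · have := key hj hp.symm h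
    rwa [inter_comm (L.band s j), inter_comm (L.band t j)] at this

/-! ### Contractible intersections in a good layout -/

/-- A line minus the core is contractible: the slots with a foot of the line, which the core may
disconnect, are isolated. -/
theorem contractible_line_rest {i : ℤ} (hi : 0 ≤ i ∧ i < m) (hex : ∃ s, L.Pres s i) :
    ContractibleSpace (slotSet fun s => L.band s i \ L.core s) := by
  obtain ⟨X, hX⟩ := hL.foot_bounded
  classical
  let bad : Finset ℤ := (Finset.Icc (-X) X).filter fun s => ∃ l u, L.Trip s i l u
  have hmem : ∀ s, s ∈ bad ↔ ∃ l u, L.Trip s i l u := by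
    intro s
    simp only [bad, Finset.mem_filter, Finset.mem_Icc, and_iff_right_iff_imp]
    rintro ⟨l, u, h⟩
    exact abs_le.1 (hX _ _ h.1)
  have hodd : ∀ s, s % 2 ≠ 1 → s ∉ bad := by
    intro s hs hb
    obtain ⟨l, u, h⟩ := (hmem s).1 hb
    exact hs (hL.trip_odd h)
  refine contractibleSpace_slotSet_of_isolated bad ?_ ?_ ?_ ?_ ?_ ?_
  · exact fun s => (isOpen_band s i).sdiff (isClosed_core s)
  · intro s hs
    rw [hmem] at hs
    rcases hL.line_cases hi (s := s) with h | h | ⟨v, h⟩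
    · rw [h]; exact convex_Ioo _ _
    · exact absurd h hs
    · refine hL.convex_rest hi fun hf => ?_
      obtain ⟨w, h | h⟩ := h
      · exact h.2.1 (hL.foot_unique h.1 hf)
      · exact h.2.2.1 (hL.foot_unique h.1 hf)
  · obtain ⟨s, hs⟩ := hex
    by_cases hb : s ∈ bad
    · obtain ⟨l, u, h⟩ := (hmem s).1 hb
      exact ⟨s + dir s, hodd _ (dir_mod (hL.trip_odd h)).1,
        (hL.foot_rest_nonempty h).mono (hL.foot_push hi h).2⟩
    · exact ⟨s, hb, (hL.rest_nonempty_iff hi).2 hs⟩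
  · simp only [hL.rest_nonempty_iff hi]
    exact ⟨fun a ha c hc b hb => hL.pres_ord ha hc hb.1 hb.2⟩
  · intro s
    simp only [hL.rest_nonempty_iff hi]
    exact hL.rest_cont hi
  · intro s hs
    obtain ⟨l, u, h⟩ := (hmem s).1 hs
    exact ⟨dir s, dir_eq s, hodd _ (dir_mod (hL.trip_odd h)).1,
      hodd _ (dir_mod (hL.trip_odd h)).2, hL.foot_push hi h⟩

theorem contractible_line {i : ℤ} (hi : 0 ≤ i ∧ i < m) (hex : ∃ s, L.Pres s i) :
    ContractibleSpace (slotSet fun s => L.band s i) := by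
  have hne : ∀ s, (L.band s i).Nonempty ↔ L.Pres s i := fun s =>
    ⟨fun ⟨y, hy⟩ => pres_of_mem hi hy, fun h => band_nonempty.2 h.2⟩
  refine contractibleSpace_slotSet (fun s => isOpen_band s i) (fun s => convex_Ioo _ _) ?_ ?_ ?_
  · simpa only [hne] using hex
  · simp only [hne]
    exact ⟨fun a ha c hc b hb => hL.pres_ord ha hc hb.1 hb.2⟩
  · intro s
    simp only [hne]
    intro h1 h2
    have := hL.pres_cont h1 h2
    exact exists_mem_band_inter h1.2 h2.2 this.1 this.2

theorem contractible_pair {i j : ℤ} (hi : 0 ≤ i ∧ i < m) (hj : 0 ≤ j ∧ j < m) (hij : i ≠ j) :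
    ContractibleSpace (slotSet fun s => L.band s i ∩ L.band s j) := by
  have hne : ∀ s, (L.band s i ∩ L.band s j).Nonempty ↔ L.Near s i j := fun s =>
    ⟨fun ⟨y, hy⟩ => near_of_mem hi hj hy.1 hy.2,
      fun h => exists_mem_band_inter h.1.2 h.2.1.2 h.2.2.1 h.2.2.2⟩
  refine contractibleSpace_slotSet (fun s => (isOpen_band s i).inter (isOpen_band s j))
    (fun s => (convex_Ioo _ _).inter (convex_Ioo _ _)) ?_ ?_ ?_
  · simp only [hne]
    obtain ⟨s, hs, -⟩ := hL.near_pair hi.1 hi.2 hj.1 hj.2 hij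
    exact ⟨s, hs⟩
  · simp only [hne]
    exact ⟨fun a ha c hc b hb => hL.near_ord hij ha hc hb.1 hb.2⟩
  · intro s
    simp only [hne]
    exact fun h1 h2 => hL.pair_band_cont hij (Or.inl rfl) h1 h2

theorem contractible_pair_rest {i j : ℤ} (hi : 0 ≤ i ∧ i < m) (hj : 0 ≤ j ∧ j < m) (hij : i ≠ j) :
    ContractibleSpace (slotSet fun s => (L.band s i ∩ L.band s j) \ L.core s) := by
  have hne : ∀ s, ((L.band s i ∩ L.band s j) \ L.core s).Nonempty ↔ L.Near s i j ∧
      ∀ v, ¬ L.Trip s v i j ∧ ¬ L.Trip s v j i := fun s => hL.pair_rest_nonempty_iff hi hj hij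
  refine contractibleSpace_slotSet
    (fun s => ((isOpen_band s i).inter (isOpen_band s j)).sdiff (isClosed_core s)) ?_ ?_ ?_ ?_
  · intro s
    by_cases hf : L.foot s i
    · have : (L.band s i ∩ L.band s j) \ L.core s = L.band s i ∩ (L.band s j \ L.core s) :=
        inter_sdiff_assoc _ _ _
      rw [this]
      exact (convex_Ioo _ _).inter (hL.convex_rest hj fun h => hij (hL.foot_unique hf h))
    · rw [inter_comm, inter_sdiff_assoc]
      exact (convex_Ioo _ _).inter (hL.convex_rest hi hf)
  · simp only [hne]
    exact hL.near_pair hi.1 hi.2 hj.1 hj.2 hij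
  · simp only [hne]
    refine ⟨?_⟩
    rintro a ⟨ha, ha'⟩ c ⟨hc, hc'⟩ b ⟨hab, hbc⟩
    refine ⟨hL.near_ord hij ha hc hab hbc, ?_⟩
    rcases eq_or_ne a b with rfl | hab'
    · exact ha'
    rcases eq_or_ne b c with rfl | hbc'
    · exact hc'
    have h1 : L.Near (b - 1) i j := hL.near_ord hij ha hc (by omega) (by omega)
    have h2 : L.Near (b + 1) i j := hL.near_ord hij ha hc (by omega) (by omega)
    refine fun v => ⟨fun h => ?_, fun h => ?_⟩
    · rcases hL.trip_end h with h | h <;> contradiction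
    · rcases hL.trip_end h with h | h
      · exact h h1.symm
      · exact h h2.symm
  · intro s
    simp only [hne]
    rintro ⟨h1, h1'⟩ ⟨h2, h2'⟩
    by_cases h : s % 2 = 1
    · exact hL.pair_rest_cont_of_even hi hj hij (Or.inl rfl) (by omega) h1 h2 h1'
    · rw [inter_comm]
      exact hL.pair_rest_cont_of_even hi hj hij (Or.inr (by omega)) h h2 h1 h2'

theorem contractible_triple {i j k : ℤ} (hi : 0 ≤ i ∧ i < m) (hj : 0 ≤ j ∧ j < m)
    (hk : 0 ≤ k ∧ k < m) (hij : i ≠ j) (hik : i ≠ k) (hjk : j ≠ k)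
    (h : ∃ s, (L.band s i ∩ L.band s j ∩ L.band s k).Nonempty) :
    ContractibleSpace (slotSet fun s => L.band s i ∩ L.band s j ∩ L.band s k) := by
  have huniq : ∀ s s', (L.band s i ∩ L.band s j ∩ L.band s k).Nonempty →
      (L.band s' i ∩ L.band s' j ∩ L.band s' k).Nonempty → s = s' := by
    rintro s s' ⟨y, ⟨h1, h2⟩, h3⟩ ⟨y', ⟨h1', h2'⟩, h3'⟩
    exact hL.three_slot hij hik hjk (near_of_mem hi hj h1 h2) (near_of_mem hi hk h1 h3)
      (near_of_mem hj hk h2 h3) (near_of_mem hi hj h1' h2') (near_of_mem hi hk h1' h3')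
      (near_of_mem hj hk h2' h3')
  refine contractibleSpace_slotSet
    (fun s => ((isOpen_band s i).inter (isOpen_band s j)).inter (isOpen_band s k))
    (fun s => ((convex_Ioo _ _).inter (convex_Ioo _ _)).inter (convex_Ioo _ _)) h ?_ ?_
  · refine ⟨fun a ha c hc b hb => ?_⟩
    obtain rfl := huniq _ _ ha hc
    obtain rfl := le_antisymm hb.1 hb.2
    exact ha
  · intro s h1 h2
    have := huniq _ _ h1 h2
    omega

end Good
end Layout

namespace Layout
variable {m : ℕ} {L : Layout m}
namespace Good
variable (hL : L.Good)
include hL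

/-! ### The complement of the core -/

/-- The core is bounded: there are finitely many feet and lines. -/
theorem core_bounded : ∃ X : ℝ, 0 < X ∧ ∀ p : ℝ × ℝ, p ∉ slotSet (fun s => (L.core s)ᶜ) →
    |p.1| ≤ X ∧ |p.2| ≤ X := by
  obtain ⟨X, hX⟩ := hL.foot_bounded
  let S : Finset (ℤ × ℤ × ℤ) := Finset.Icc (-X) X ×ˢ Finset.Ico 0 (m : ℤ) ×ˢ Finset.Ico 0 (m : ℤ)
  let M : ℤ := ∑ t ∈ S, (|L.lo t.1 t.2.1| + |L.hi t.1 t.2.2|)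
  have hM0 : 0 ≤ M := Finset.sum_nonneg fun t _ => by positivity
  refine ⟨|(X : ℝ)| + M + 1, ?_, ?_⟩
  · have : (0 : ℝ) ≤ M := by exact_mod_cast hM0
    positivity
  intro p hp
  simp only [slotSet, mem_compl_iff, mem_ofPred_eq, not_forall, not_not] at hp
  obtain ⟨s, h1, h2, hc⟩ := hp
  obtain ⟨v, l, u, ht, h3, h4⟩ := mem_core.1 hc
  have hs := abs_le.1 (hX _ _ ht.1)
  have hl := ht.2.2.2.2.2.1.1.1
  have hu := ht.2.2.2.2.2.1.2.1.1
  have hmem : (s, u, l) ∈ S := by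
    simp only [S, Finset.mem_product, Finset.mem_Icc, Finset.mem_Ico]
    exact ⟨hs, hu, hl⟩
  have hle : |L.lo s u| + |L.hi s l| ≤ M :=
    Finset.single_le_sum (f := fun t : ℤ × ℤ × ℤ => |L.lo t.1 t.2.1| + |L.hi t.1 t.2.2|)
      (fun t _ => by positivity) hmem
  have g1 : -(M : ℤ) ≤ L.lo s u := by
    have := neg_abs_le (L.lo s u)
    have := abs_nonneg (L.hi s l)
    omega
  have g2 : L.hi s l ≤ (M : ℤ) := by
    have := le_abs_self (L.hi s l)
    have := abs_nonneg (L.lo s u)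
    omega
  have g1' : -(M : ℝ) ≤ L.lo s u := by exact_mod_cast g1
  have g2' : (L.hi s l : ℝ) ≤ M := by exact_mod_cast g2
  have g3 : -(X : ℝ) ≤ s := by exact_mod_cast hs.1
  have g4 : (s : ℝ) ≤ X := by exact_mod_cast hs.2
  have g5 := le_abs_self (X : ℝ)
  have g6 : (0 : ℝ) ≤ M := by exact_mod_cast hM0
  have g7 := abs_nonneg (X : ℝ)
  constructor <;> rw [abs_le] <;> constructor <;> linarith

theorem not_contractible_core_compl (hT : L.triples.Nonempty) :
    ¬ ContractibleSpace (slotSet fun s => (L.core s)ᶜ) := by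
  obtain ⟨X, hX0, hX⟩ := hL.core_bounded
  obtain ⟨τ, hτ, s, hs⟩ := hT
  obtain ⟨i, j, k, hij, hik, hjk, rfl⟩ := Finset.card_eq_three.1 hτ
  obtain ⟨v, l, u, ht⟩ := hL.exists_trip_of_near hij hik hjk (hs i (by simp) j (by simp) hij)
    (hs i (by simp) k (by simp) hik) (hs j (by simp) k (by simp) hjk)
  have hp : ((s : ℝ), (L.lo s u : ℝ)) ∉ slotSet fun s => (L.core s)ᶜ := by
    intro h
    refine h s le_rfl (by simp) (mem_core.2 ⟨v, l, u, ht, le_rfl, ?_⟩)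
    have := (hL.trip_facts ht).2.2.1.le
    simpa using this
  refine not_contractibleSpace_of_circle_subset
    (isOpen_slotSet fun s => (isClosed_core s).isOpen_compl) hp (R := 4 * X) (by positivity) ?_
  intro t
  by_contra hc
  have h1 := hX _ hp
  have h2 := hX _ hc
  simp only [abs_le] at h1 h2
  have e1 : |4 * X * Real.cos t| ≤ 2 * X := abs_le.2 ⟨by linarith, by linarith⟩
  have e2 : |4 * X * Real.sin t| ≤ 2 * X := abs_le.2 ⟨by linarith, by linarith⟩
  have e1' := sq_le_sq' (abs_le.1 e1).1 (abs_le.1 e1).2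
  have e2' := sq_le_sq' (abs_le.1 e2).1 (abs_le.1 e2).2
  have := Real.sin_sq_add_cos_sq t
  nlinarith

/-- Every point of the complement of the core can be joined to a high point: slots with nonempty
core are isolated, so one first moves horizontally into a neighbouring slot if necessary, and then
vertically. -/
theorem isPathConnected_core_compl : IsPathConnected (slotSet fun s => (L.core s)ᶜ) := by
  obtain ⟨X, hX0, hX⟩ := hL.core_bounded
  set U := slotSet fun s => (L.core s)ᶜ with hU
  have hhigh : ∀ x y : ℝ, X < y → (x, y) ∈ U := by
    intro x y hy
    by_contra h
    have := (hX _ h).2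
    have := le_abs_self y
    simp only at *
    linarith
  have hhor : ∀ x x' y, (∀ z ∈ uIcc x x', (z, y) ∈ U) → JoinedIn U (x, y) (x', y) := by
    intro x x' y h
    refine JoinedIn.of_segment_subset ?_
    rw [← Prod.image_mk_segment_left]
    rintro _ ⟨z, hz, rfl⟩
    exact h z (by rwa [segment_eq_uIcc] at hz)
  have hver : ∀ x y y', (∀ z ∈ uIcc y y', (x, z) ∈ U) → JoinedIn U (x, y) (x, y') := by
    intro x y y' h
    refine JoinedIn.of_segment_subset ?_
    rw [← Prod.image_mk_segment_right]
    rintro _ ⟨z, hz, rfl⟩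
    exact h z (by rwa [segment_eq_uIcc] at hz)
  refine ⟨(0, X + 1), hhigh _ _ (by linarith), ?_⟩
  rintro ⟨x, y⟩ hp
  have hjoin : ∀ x, JoinedIn U (x, X + 1) (0, X + 1) := fun x =>
    hhor _ _ _ fun z _ => hhigh _ _ (by linarith)
  have hclear : ∀ r : ℤ, r % 2 ≠ 1 → ∀ x y : ℝ, r < x → x < r + 1 → (x, y) ∈ U := by
    intro r hr x y h1 h2
    have a1 : ⌊x⌋ = r := Int.floor_eq_iff.2 ⟨h1.le, h2⟩
    have a2 : ⌈x⌉ - 1 = r := by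
      rw [sub_eq_iff_eq_add, Int.ceil_eq_iff]
      push_cast
      constructor <;> linarith
    rw [hU, mem_slotSet_iff]
    simp only [a1, a2, hL.core_eq_empty hr]
    simp
  have hmove : ∃ r : ℤ, r % 2 ≠ 1 ∧ JoinedIn U (x, y) (r + 1 / 2, y) := by
    have hf1 := Int.floor_le x
    have hf2 := Int.lt_floor_add_one x
    by_cases hs : ⌊x⌋ % 2 = 1
    · refine ⟨⌊x⌋ + 1, by omega, hhor _ _ _ fun z hz => ?_⟩
      rw [uIcc_of_le (by push_cast; linarith)] at hz
      obtain ⟨hz1, hz2⟩ := hz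
      push_cast at hz2
      rcases le_or_gt z (⌊x⌋ + 1) with h | h
      · rcases eq_or_lt_of_le hz1 with rfl | h'
        · exact hp
        intro r hr hr'
        simp only at hr hr' ⊢
        have a1 : ⌊x⌋ ≤ r := by
          have : (⌊x⌋ : ℝ) < ((r + 1 : ℤ) : ℝ) := by push_cast; linarith
          have : ⌊x⌋ < r + 1 := by exact_mod_cast this
          omega
        have a2 : r ≤ ⌊x⌋ + 1 := by
          have : (r : ℝ) ≤ ((⌊x⌋ + 1 : ℤ) : ℝ) := by push_cast; linarith
          exact_mod_cast this
        have : r = ⌊x⌋ ∨ r = ⌊x⌋ + 1 := by omega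
        rcases this with rfl | rfl
        · exact hp _ hf1 hf2.le
        · rw [hL.core_eq_empty (by omega)]
          simp
      · exact hclear (⌊x⌋ + 1) (by omega) _ _ (by push_cast; linarith) (by push_cast; linarith)
    · refine ⟨⌊x⌋, hs, hhor _ _ _ fun z hz => ?_⟩
      rcases eq_or_ne z x with rfl | hzx
      · exact hp
      rcases le_total x (⌊x⌋ + 1 / 2) with h | h
      · rw [uIcc_of_le h] at hz
        have := lt_of_le_of_ne hz.1 hzx.symm
        exact hclear _ hs _ _ (by linarith) (by linarith [hz.2])
      · rw [uIcc_of_ge h] at hz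
        have := lt_of_le_of_ne hz.2 hzx
        exact hclear _ hs _ _ (by linarith [hz.1]) (by linarith)
  obtain ⟨r, hr, hj⟩ := hmove
  refine (hj.trans ((hver _ _ (X + 1) fun z _ => ?_).trans (hjoin _))).symm
  exact hclear r hr _ _ (by linarith) (by linarith)
end Good
end Layout

/-! ### The family of plane sets of a good layout -/

/-- The plane as a product of two lines. -/
noncomputable def planeHomeomorph : Plane ≃ₜ ℝ × ℝ :=
  (EuclideanSpace.equiv (Fin 2) ℝ).toHomeomorph.trans Homeomorph.finTwoArrow

namespace Layout
variable {m : ℕ} (L : Layout m)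

/-- The slots of the `m + 1` sets attached to a layout: the lines, followed by the complement of
the core. -/
def sheet (i : Fin (m + 1)) (s : ℤ) : Set ℝ :=
  if (i : ℕ) < m then L.band s (i : ℕ) else (L.core s)ᶜ

/-- The family of `m + 1` plane sets attached to a layout. -/
def family (i : Fin (m + 1)) : Set Plane := planeHomeomorph ⁻¹' slotSet (L.sheet i)

variable {L}

@[simp] theorem sheet_castSucc (i : Fin m) (s : ℤ) :
    L.sheet i.castSucc s = L.band s (i : ℕ) := by
  simp [sheet]

@[simp] theorem sheet_last (s : ℤ) : L.sheet (Fin.last m) s = (L.core s)ᶜ := by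
  simp [sheet]

theorem interOf_family (σ : Finset (Fin (m + 1))) :
    interOf L.family σ = planeHomeomorph ⁻¹' slotSet fun s => ⋂ i ∈ σ, L.sheet i s := by
  ext p
  simp only [interOf, family, mem_iInter, mem_preimage, slotSet, mem_ofPred_eq]
  tauto

theorem contractible_interOf_iff (σ : Finset (Fin (m + 1))) :
    ContractibleSpace (interOf L.family σ) ↔
      ContractibleSpace (slotSet fun s => ⋂ i ∈ σ, L.sheet i s) := by
  rw [interOf_family]
  exact contractibleSpace_preimage_iff _ _

theorem contractible_family_iff (i : Fin (m + 1)) :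
    ContractibleSpace (L.family i) ↔ ContractibleSpace (slotSet (L.sheet i)) :=
  contractibleSpace_preimage_iff _ _

theorem interOf_family_eq_empty {σ : Finset (Fin (m + 1))} (h : ∀ s, ⋂ i ∈ σ, L.sheet i s = ∅) :
    interOf L.family σ = ∅ := by
  rw [interOf_family, slotSet_eq_empty h, preimage_empty]

theorem interOf_family_nonempty {σ : Finset (Fin (m + 1))} {s : ℤ}
    (h : (⋂ i ∈ σ, L.sheet i s).Nonempty) : (interOf L.family σ).Nonempty := by
  rw [interOf_family]
  obtain ⟨p, hp⟩ := slotSet_nonempty (W := fun s => ⋂ i ∈ σ, L.sheet i s) h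
  exact ⟨planeHomeomorph.symm p, by simpa using hp⟩

theorem range_fin (i : Fin m) : (0 : ℤ) ≤ ((i : ℕ) : ℤ) ∧ ((i : ℕ) : ℤ) < m :=
  ⟨by positivity, by exact_mod_cast i.2⟩

theorem cast_ne {i j : Fin m} (h : i.castSucc ≠ j.castSucc) :
    ((i : ℕ) : ℤ) ≠ ((j : ℕ) : ℤ) := by
  intro h'
  apply h
  ext
  simpa using h'

theorem exists_castSucc {i : Fin (m + 1)} (h : i ≠ Fin.last m) : ∃ j : Fin m, i = j.castSucc :=
  (Fin.eq_castSucc_or_eq_last i).resolve_right h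

theorem isPathConnected_of_contractible {X : Type*} [TopologicalSpace X] {S : Set X}
    (h : ContractibleSpace S) : IsPathConnected S :=
  isPathConnected_iff_pathConnectedSpace.2 inferInstance

namespace Good
variable (hL : L.Good)
include hL

theorem exists_pres (hm : 2 ≤ m) {i : ℤ} (hi : 0 ≤ i ∧ i < m) : ∃ s, L.Pres s i := by
  rcases eq_or_ne i 0 with rfl | h
  · obtain ⟨s, hs, -⟩ := hL.near_pair (i := 0) (j := 1) le_rfl (by omega) (by omega) (by omega)
      (by omega)
    exact ⟨s, hs.1⟩
  · obtain ⟨s, hs, -⟩ := hL.near_pair (i := i) (j := 0) hi.1 hi.2 (by omega) (by omega) h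
    exact ⟨s, hs.1⟩

/-- A point common to three lines lies in no fourth set: the core contains it, and no fourth line
does. -/
theorem notMem_sheet_of_three {a b c : Fin (m + 1)} (hab : a ≠ b) (hac : a ≠ c) (hbc : b ≠ c)
    (ha : a ≠ Fin.last m) (hb : b ≠ Fin.last m) (hc : c ≠ Fin.last m) {d : Fin (m + 1)}
    (hda : d ≠ a) (hdb : d ≠ b) (hdc : d ≠ c) (s : ℤ) {y : ℝ} (h1 : y ∈ L.sheet a s)
    (h2 : y ∈ L.sheet b s) (h3 : y ∈ L.sheet c s) : y ∉ L.sheet d s := by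
  intro h4
  obtain ⟨a, rfl⟩ := exists_castSucc ha
  obtain ⟨b, rfl⟩ := exists_castSucc hb
  obtain ⟨c, rfl⟩ := exists_castSucc hc
  rw [sheet_castSucc] at h1 h2 h3
  have key : ∀ v l u : Fin m, v.castSucc ≠ l.castSucc → v.castSucc ≠ u.castSucc →
      l.castSucc ≠ u.castSucc → d ≠ v.castSucc → d ≠ l.castSucc → d ≠ u.castSucc →
      y ∈ L.band s (v : ℕ) → y ∈ L.band s (l : ℕ) → y ∈ L.band s (u : ℕ) →
      ¬ L.foot s (v : ℕ) := by
    have key' : ∀ v l u : Fin m, v.castSucc ≠ l.castSucc → v.castSucc ≠ u.castSucc →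
      l.castSucc ≠ u.castSucc → d ≠ v.castSucc → d ≠ l.castSucc → d ≠ u.castSucc →
      y ∈ L.band s (v : ℕ) → y ∈ L.band s (l : ℕ) → y ∈ L.band s (u : ℕ) →
      ¬ L.Trip s (v : ℕ) (l : ℕ) (u : ℕ) := by
      intro v l u hvl hvu hlu h5 h6 h7 m1 m2 m3 ht
      rcases Fin.eq_castSucc_or_eq_last d with ⟨d, rfl⟩ | rfl
      · rw [sheet_castSucc] at h4
        rcases hL.mem_trip (range_fin d) ht m3.1.le m2.2.le h4 with h | h | h
        · exact cast_ne h5 h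
        · exact cast_ne h6 h
        · exact cast_ne h7 h
      · rw [sheet_last] at h4
        exact h4 (mem_core.2 ⟨_, _, _, ht, m3.1.le, m2.2.le⟩)
    intro v l u hvl hvu hlu h5 h6 h7 m1 m2 m3 hf
    have n1 := near_of_mem (range_fin v) (range_fin l) m1 m2
    have n2 := near_of_mem (range_fin v) (range_fin u) m1 m3
    have n3 := near_of_mem (range_fin l) (range_fin u) m2 m3
    rcases (hL.foot_three hf (cast_ne hvl) (cast_ne hvu) (cast_ne hlu) n1 n2 n3).2.2 with h | h
    · exact key' v l u hvl hvu hlu h5 h6 h7 m1 m2 m3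
        ⟨hf, cast_ne hvl, cast_ne hvu, n1, n2, n3, h.1⟩
    · exact key' v u l hvu hvl hlu.symm h5 h7 h6 m1 m3 m2
        ⟨hf, cast_ne hvu, cast_ne hvl, n2, n1, n3.symm, h.1⟩
  rcases hL.near_three (cast_ne hab) (cast_ne hac) (cast_ne hbc)
    (near_of_mem (range_fin a) (range_fin b) h1 h2)
    (near_of_mem (range_fin a) (range_fin c) h1 h3)
    (near_of_mem (range_fin b) (range_fin c) h2 h3) with h | h | h
  · exact key a b c hab hac hbc hda hdb hdc h1 h2 h3 h
  · exact key b a c hab.symm hbc hac hdb hda hdc h2 h1 h3 h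
  · exact key c a b hac.symm hbc.symm hab hdc hda hdb h3 h1 h2 h

/-- No four of the sets have a common point. -/
theorem interOf_four {σ : Finset (Fin (m + 1))} (h : 4 ≤ σ.card) : interOf L.family σ = ∅ := by
  refine interOf_family_eq_empty fun s => ?_
  have h3 : 3 ≤ (σ.erase (Fin.last m)).card := by
    have := Finset.pred_card_le_card_erase (s := σ) (a := Fin.last m)
    omega
  obtain ⟨τ, hτ, hc⟩ := Finset.exists_subset_card_eq h3
  obtain ⟨a, b, c, hab, hac, hbc, rfl⟩ := Finset.card_eq_three.1 hc
  obtain ⟨d, hd, hd'⟩ := Finset.exists_mem_notMem_of_card_lt_card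
    (s := {a, b, c}) (t := σ) (by omega)
  simp only [Finset.insert_subset_iff, Finset.mem_erase, Finset.singleton_subset_iff] at hτ
  simp only [Finset.mem_insert, Finset.mem_singleton, not_or] at hd'
  ext y
  simp only [mem_iInter, mem_empty_iff_false, iff_false]
  intro hy
  exact hL.notMem_sheet_of_three hab hac hbc hτ.1.1 hτ.2.1.1 hτ.2.2.1 hd'.1 hd'.2.1 hd'.2.2 s
    (hy _ hτ.1.2) (hy _ hτ.2.1.2) (hy _ hτ.2.2.2) (hy _ hd)

theorem contractible_sheet (hm : 2 ≤ m) {i : Fin (m + 1)} (hi : i ≠ Fin.last m) :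
    ContractibleSpace (L.family i) := by
  obtain ⟨i, rfl⟩ := exists_castSucc hi
  rw [contractible_family_iff]
  have : L.sheet i.castSucc = fun s => L.band s (i : ℕ) := by ext1 s; simp
  rw [this]
  exact hL.contractible_line (range_fin i) (hL.exists_pres hm (range_fin i))

theorem not_contractible_last (ht : L.triples.Nonempty) : ¬ ContractibleSpace (L.family (Fin.last m)) := by
  rw [contractible_family_iff]
  have : L.sheet (Fin.last m) = fun s => (L.core s)ᶜ := by ext1 s; simp
  rw [this]
  exact hL.not_contractible_core_compl ht

theorem isPathConnected_last : IsPathConnected (L.family (Fin.last m)) := by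
  have : L.sheet (Fin.last m) = fun s => (L.core s)ᶜ := by ext1 s; simp
  rw [family, this, ← planeHomeomorph.isPathConnected_image,
    image_preimage_eq _ planeHomeomorph.surjective]
  exact hL.isPathConnected_core_compl

theorem contractible_interOf_pair (hm : 2 ≤ m) {σ : Finset (Fin (m + 1))} (h : σ.card = 2) :
    ContractibleSpace (interOf L.family σ) := by
  rw [contractible_interOf_iff]
  by_cases hlast : Fin.last m ∈ σ
  · obtain ⟨a, ha⟩ := Finset.card_eq_one.1 (by rw [Finset.card_erase_of_mem hlast, h] :
      (σ.erase (Fin.last m)).card = 1)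
    have ha' : a ≠ Fin.last m :=
      (Finset.mem_erase.1 (by rw [ha]; simp : a ∈ σ.erase (Fin.last m))).1
    obtain ⟨i, rfl⟩ := exists_castSucc ha'
    rw [← Finset.insert_erase hlast, ha]
    have : (fun s => ⋂ j ∈ ({Fin.last m, i.castSucc} : Finset (Fin (m + 1))), L.sheet j s) =
        fun s => L.band s (i : ℕ) \ L.core s := by
      ext1 s
      simp [sdiff_eq, inter_comm]
    rw [this]
    exact hL.contractible_line_rest (range_fin i) (hL.exists_pres hm (range_fin i))
  · obtain ⟨a, b, hab, rfl⟩ := Finset.card_eq_two.1 h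
    simp only [Finset.mem_insert, Finset.mem_singleton, not_or] at hlast
    obtain ⟨i, rfl⟩ := exists_castSucc (Ne.symm hlast.1)
    obtain ⟨j, rfl⟩ := exists_castSucc (Ne.symm hlast.2)
    have : (fun s => ⋂ k ∈ ({i.castSucc, j.castSucc} : Finset (Fin (m + 1))), L.sheet k s) =
        fun s => L.band s (i : ℕ) ∩ L.band s (j : ℕ) := by
      ext1 s
      simp
    rw [this]
    exact hL.contractible_pair (range_fin i) (range_fin j) (cast_ne hab)

theorem contractible_interOf_three_last {σ : Finset (Fin (m + 1))} (h : σ.card = 3)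
    (hlast : Fin.last m ∈ σ) : ContractibleSpace (interOf L.family σ) := by
  rw [contractible_interOf_iff]
  obtain ⟨a, b, hab, he⟩ := Finset.card_eq_two.1 (by rw [Finset.card_erase_of_mem hlast, h] :
    (σ.erase (Fin.last m)).card = 2)
  have ha : a ≠ Fin.last m :=
    (Finset.mem_erase.1 (by rw [he]; simp : a ∈ σ.erase (Fin.last m))).1
  have hb : b ≠ Fin.last m :=
    (Finset.mem_erase.1 (by rw [he]; simp : b ∈ σ.erase (Fin.last m))).1
  obtain ⟨i, rfl⟩ := exists_castSucc ha
  obtain ⟨j, rfl⟩ := exists_castSucc hb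
  rw [← Finset.insert_erase hlast, he]
  have : (fun s => ⋂ k ∈ ({Fin.last m, i.castSucc, j.castSucc} : Finset (Fin (m + 1))),
      L.sheet k s) = fun s => (L.band s (i : ℕ) ∩ L.band s (j : ℕ)) \ L.core s := by
    ext1 s
    simp [sdiff_eq, inter_comm]
  rw [this]
  exact hL.contractible_pair_rest (range_fin i) (range_fin j) (cast_ne hab)

theorem empty_or_contractible_three {σ : Finset (Fin (m + 1))} (h : σ.card = 3) :
    interOf L.family σ = ∅ ∨ ContractibleSpace (interOf L.family σ) := by
  by_cases hlast : Fin.last m ∈ σ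
  · exact Or.inr (hL.contractible_interOf_three_last h hlast)
  obtain ⟨a, b, c, hab, hac, hbc, rfl⟩ := Finset.card_eq_three.1 h
  simp only [Finset.mem_insert, Finset.mem_singleton, not_or] at hlast
  obtain ⟨i, rfl⟩ := exists_castSucc (Ne.symm hlast.1)
  obtain ⟨j, rfl⟩ := exists_castSucc (Ne.symm hlast.2.1)
  obtain ⟨k, rfl⟩ := exists_castSucc (Ne.symm hlast.2.2)
  have e : ∀ s, ⋂ l ∈ ({i.castSucc, j.castSucc, k.castSucc} : Finset (Fin (m + 1))),
      L.sheet l s = L.band s (i : ℕ) ∩ L.band s (j : ℕ) ∩ L.band s (k : ℕ) := by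
    intro s
    simp [inter_assoc]
  rw [contractible_interOf_iff]
  by_cases hne : ∃ s, (L.band s (i : ℕ) ∩ L.band s (j : ℕ) ∩ L.band s (k : ℕ)).Nonempty
  · right
    rw [funext e]
    exact hL.contractible_triple (range_fin i) (range_fin j) (range_fin k) (cast_ne hab)
      (cast_ne hac) (cast_ne hbc) hne
  · left
    refine interOf_family_eq_empty fun s => ?_
    rw [e, ← not_nonempty_iff_eq_empty]
    exact fun h => hne ⟨s, h⟩

theorem family_injective (hm : 3 ≤ m) (ht : L.triples.Nonempty) : Function.Injective L.family := by
  have key : ∀ {a b : Fin (m + 1)}, a ≠ Fin.last m → b ≠ Fin.last m → L.family a = L.family b →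
      a = b := by
    intro a b ha hb hab
    by_contra hne
    obtain ⟨c, hc⟩ : ∃ c : Fin (m + 1), c ∉ ({Fin.last m, a, b} : Finset (Fin (m + 1))) := by
      obtain ⟨c, -, hc⟩ := Finset.exists_mem_notMem_of_card_lt_card
        (s := ({Fin.last m, a, b} : Finset (Fin (m + 1)))) (t := Finset.univ) (by
          have : ({Fin.last m, a, b} : Finset (Fin (m + 1))).card ≤ 3 := Finset.card_le_three
          rw [Finset.card_univ, Fintype.card_fin]
          omega)
      exact ⟨c, hc⟩
    simp only [Finset.mem_insert, Finset.mem_singleton, not_or] at hc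
    have h3 : ({a, c, Fin.last m} : Finset (Fin (m + 1))).card = 3 := by
      rw [Finset.card_eq_three]
      exact ⟨a, c, Fin.last m, Ne.symm hc.2.1, ha, hc.1, rfl⟩
    have := hL.contractible_interOf_three_last h3 (by simp)
    obtain ⟨p, hp⟩ : (interOf L.family {a, c, Fin.last m}).Nonempty :=
      nonempty_coe_sort.1 inferInstance
    have hp' : p ∈ interOf L.family {a, b, c, Fin.last m} := by
      simp only [interOf, Finset.mem_insert, Finset.mem_singleton, mem_iInter] at hp ⊢
      rintro x (rfl | rfl | h)
      · exact hp _ (Or.inl rfl)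
      · rw [← hab]; exact hp _ (Or.inl rfl)
      · exact hp _ (Or.inr h)
    rw [hL.interOf_four] at hp'
    · exact hp'
    · rw [Finset.card_insert_of_notMem (by simp [hne, Ne.symm hc.2.1, ha]),
        Finset.card_insert_of_notMem (by simp [Ne.symm hc.2.2, hb]), Finset.card_pair hc.1]
  intro a b hab
  by_cases ha : a = Fin.last m <;> by_cases hb : b = Fin.last m
  · rw [ha, hb]
  · have := hL.contractible_sheet (by omega) hb
    rw [← hab, ha] at this
    exact absurd this (hL.not_contractible_last ht)
  · have := hL.contractible_sheet (by omega) ha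
    rw [hab, hb] at this
    exact absurd this (hL.not_contractible_last ht)
  · exact key ha hb hab

/-- All conditions but the value of `f₂`. Three lines and a triple are needed for the sets to be
distinct and for the last one not to be contractible. -/
theorem isSpecialFamily (hm : 3 ≤ m) (ht : L.triples.Nonempty) : IsSpecialFamily L.family where
  injective := hL.family_injective hm ht
  isOpen i := by
    refine (isOpen_slotSet fun s => ?_).preimage planeHomeomorph.continuous
    unfold sheet
    split_ifs
    · exact isOpen_band _ _
    · exact (isClosed_core s).isOpen_compl
  empty_or_pathConnected σ := by
    have : σ.card = 0 ∨ σ.card = 1 ∨ σ.card = 2 ∨ σ.card = 3 ∨ 4 ≤ σ.card := by omega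
    rcases this with h | h | h | h | h
    · right
      rw [Finset.card_eq_zero] at h
      simpa [h, interOf] using isPathConnected_univ
    · right
      obtain ⟨i, rfl⟩ := Finset.card_eq_one.1 h
      simp only [interOf, Finset.mem_singleton, iInter_iInter_eq_left]
      rcases eq_or_ne i (Fin.last m) with rfl | hi
      · exact hL.isPathConnected_last
      · exact isPathConnected_of_contractible (hL.contractible_sheet (by omega) hi)
    · exact Or.inr (isPathConnected_of_contractible (hL.contractible_interOf_pair (by omega) h))
    · exact (hL.empty_or_contractible_three h).imp_right isPathConnected_of_contractible
    · exact Or.inl (hL.interOf_four h)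
  f_three := by
    rw [fNum, ncard_eq_zero (toFinite _)]
    ext σ
    simp only [mem_ofPred_eq, mem_empty_iff_false, iff_false, not_and]
    intro hn hc
    rw [nerve, mem_ofPred_eq, hL.interOf_four (by omega)] at hn
    exact not_nonempty_empty hn
  all_but_one_contractible := by
    refine ⟨Fin.last m, hL.not_contractible_last ht, fun i hi => ?_⟩
    by_contra h
    exact hi (hL.contractible_sheet (by omega) h)
  pair_contractible _ h := hL.contractible_interOf_pair (by omega) h
  triple_contractible _ h := hL.empty_or_contractible_three h

/-- Every pair of lines meets outside the core, so besides the triples of lines the number `f₂`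
counts all the pairs of lines. -/
theorem fNum_two : fNum 2 L.family = m.choose 2 + L.triples.ncard := by
  classical
  have hsplit : {σ : Finset (Fin (m + 1)) | σ ∈ nerve L.family ∧ σ.card = 2 + 1} =
      {σ | σ ∈ nerve L.family ∧ σ.card = 2 + 1 ∧ Fin.last m ∈ σ} ∪
      {σ | σ ∈ nerve L.family ∧ σ.card = 2 + 1 ∧ Fin.last m ∉ σ} := by
    ext σ
    simp only [mem_ofPred_eq, mem_union]
    tauto
  rw [fNum, hsplit, ncard_union_eq ?_ (toFinite _) (toFinite _)]
  · congr 1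
    -- the sets containing the last index are given by the pairs of lines
    · have : {σ | σ ∈ nerve L.family ∧ σ.card = 2 + 1 ∧ Fin.last m ∈ σ} =
          (fun τ : Finset (Fin m) => insert (Fin.last m) (τ.map Fin.castSuccEmb)) ''
            (Finset.powersetCard 2 Finset.univ : Finset (Finset (Fin m))) := by
        ext σ
        simp only [mem_ofPred_eq, mem_image, Finset.mem_coe, Finset.mem_powersetCard,
          Finset.subset_univ, true_and]
        constructor
        · rintro ⟨-, hc, hlast⟩
          refine ⟨Finset.univ.filter fun i => i.castSucc ∈ σ, ?_, ?_⟩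
          · have : ((Finset.univ.filter fun i : Fin m => i.castSucc ∈ σ).map
                Fin.castSuccEmb) = σ.erase (Fin.last m) := by
              ext i
              simp only [Finset.mem_map, Finset.mem_filter, Finset.mem_univ, true_and,
                Fin.coe_castSuccEmb, Finset.mem_erase]
              constructor
              · rintro ⟨j, hj, rfl⟩
                exact ⟨Fin.castSucc_ne_last j, hj⟩
              · rintro ⟨h1, h2⟩
                obtain ⟨j, rfl⟩ := exists_castSucc h1
                exact ⟨j, h2, rfl⟩
            rw [← Finset.card_map Fin.castSuccEmb, this, Finset.card_erase_of_mem hlast, hc]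
          · ext i
            simp only [Finset.mem_insert, Finset.mem_map, Finset.mem_filter, Finset.mem_univ,
              true_and, Fin.coe_castSuccEmb]
            constructor
            · rintro (rfl | ⟨j, hj, rfl⟩)
              · exact hlast
              · exact hj
            · intro hi
              rcases Fin.eq_castSucc_or_eq_last i with ⟨j, rfl⟩ | rfl
              · exact Or.inr ⟨j, hi, rfl⟩
              · exact Or.inl rfl
        · rintro ⟨τ, hτ, rfl⟩
          have hc : (insert (Fin.last m) (τ.map Fin.castSuccEmb)).card = 3 := by
            rw [Finset.card_insert_of_notMem, Finset.card_map, hτ]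
            simp [Fin.castSucc_ne_last]
          refine ⟨?_, hc, Finset.mem_insert_self _ _⟩
          have := hL.contractible_interOf_three_last hc (Finset.mem_insert_self _ _)
          exact nonempty_coe_sort.1 inferInstance
      rw [this, ncard_image_of_injective, ncard_coe_finset, Finset.card_powersetCard,
        Finset.card_univ, Fintype.card_fin]
      intro τ τ' h
      have h' := congrArg (fun σ => σ.erase (Fin.last m)) h
      simp only at h'
      rw [Finset.erase_insert (by simp [Fin.castSucc_ne_last]),
        Finset.erase_insert (by simp [Fin.castSucc_ne_last])] at h'
      exact Finset.map_injective _ h'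
    · let g : Fin (m + 1) → ℤ := fun i => ((i : ℕ) : ℤ)
      have hg : Function.Injective g := fun i j h => by
        ext
        simpa [g] using h
      rw [← ncard_image_of_injective _ (Finset.image_injective hg)]
      congr 1
      ext τ
      simp only [mem_image, mem_ofPred_eq, triples]
      constructor
      · rintro ⟨σ, ⟨hn, hc, hlast⟩, rfl⟩
        refine ⟨by rw [Finset.card_image_of_injective _ hg, hc], ?_⟩
        have : ∃ s, (⋂ i ∈ σ, L.sheet i s).Nonempty := by
          by_contra! h
          have : interOf L.family σ = ∅ := interOf_family_eq_empty h
          rw [nerve, mem_ofPred_eq, this] at hn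
          exact not_nonempty_empty hn
        obtain ⟨s, y, hy⟩ := this
        refine ⟨s, ?_⟩
        simp only [mem_iInter] at hy
        have hb : ∀ i ∈ σ, ∃ j : Fin m, g i = ((j : ℕ) : ℤ) ∧ y ∈ L.band s (j : ℕ) := by
          intro i hi
          obtain ⟨j, rfl⟩ := exists_castSucc (fun h => hlast (h ▸ hi) : i ≠ Fin.last m)
          exact ⟨j, by simp [g], by simpa using hy _ hi⟩
        intro i hi j hj hij
        obtain ⟨i, hi', rfl⟩ := Finset.mem_image.1 hi
        obtain ⟨j, hj', rfl⟩ := Finset.mem_image.1 hj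
        obtain ⟨a, ha, ha'⟩ := hb i hi'
        obtain ⟨b, hb, hb'⟩ := hb j hj'
        rw [ha, hb]
        exact near_of_mem (range_fin a) (range_fin b) ha' hb'
      · rintro ⟨hc, s, hs⟩
        have hrange : ∀ i ∈ τ, 0 ≤ i ∧ i < m := by
          intro i hi
          obtain ⟨j, hj, hij⟩ := Finset.exists_mem_ne (by omega : 1 < τ.card) i
          exact (hs i hi j hj hij.symm).1.1
        have hτ : (Finset.univ.filter fun i => g i ∈ τ).image g = τ := by
          ext i
          simp only [Finset.mem_image, Finset.mem_filter, Finset.mem_univ, true_and]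
          constructor
          · rintro ⟨j, hj, rfl⟩
            exact hj
          · intro hi
            obtain ⟨h0, h1⟩ := hrange i hi
            lift i to ℕ using h0
            exact ⟨⟨i, by omega⟩, hi, rfl⟩
        refine ⟨Finset.univ.filter fun i => g i ∈ τ, ⟨?_, ?_, ?_⟩, hτ⟩
        · obtain ⟨a, b, c, hab, hac, hbc, rfl⟩ := Finset.card_eq_three.1 hc
          have h1 := hs a (by simp) b (by simp) hab
          have h2 := hs a (by simp) c (by simp) hac
          have h3 := hs b (by simp) c (by simp) hbc
          have : (L.band s a ∩ L.band s b ∩ L.band s c).Nonempty := by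
            obtain ⟨⟨-, d1⟩, ⟨-, d2⟩, d3, d4⟩ := h1
            obtain ⟨-, ⟨-, e2⟩, e3, e4⟩ := h2
            obtain ⟨-, -, f3, f4⟩ := h3
            simp only [band, Ioo_inter_Ioo, nonempty_Ioo, sup_lt_iff, lt_inf_iff, Int.cast_lt]
            tauto
          obtain ⟨y, ⟨h1, h2⟩, h3⟩ := this
          refine interOf_family_nonempty (s := s) ⟨y, ?_⟩
          simp only [Finset.mem_filter, Finset.mem_univ, true_and, mem_iInter]
          intro i hi
          have him := (hrange _ hi).2
          simp only [g, Nat.cast_lt] at him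
          simp only [sheet, him, if_true]
          simp only [g, Finset.mem_insert, Finset.mem_singleton] at hi
          rcases hi with h | h | h <;> rw [h] <;> assumption
        · rw [← Finset.card_image_of_injective _ hg, hτ, hc]
        · simp only [Finset.mem_filter, Finset.mem_univ, true_and]
          intro hl
          have := (hrange _ hl).2
          simp [g] at this
  · rw [disjoint_left]
    rintro σ ⟨-, -, h⟩ ⟨-, -, h'⟩
    exact h' h

end Good
end Layout

namespace Layout
variable {m : ℕ} {L : Layout m}

theorem mem_triples {s i j k : ℤ} (hij : i ≠ j) (hik : i ≠ k) (hjk : j ≠ k) (h1 : L.Near s i j)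
    (h2 : L.Near s i k) (h3 : L.Near s j k) : ({i, j, k} : Finset ℤ) ∈ L.triples := by
  refine ⟨Finset.card_eq_three.2 ⟨i, j, k, hij, hik, hjk, rfl⟩, s, ?_⟩
  simp only [Finset.mem_insert, Finset.mem_singleton]
  have h1' := h1.symm
  have h2' := h2.symm
  have h3' := h3.symm
  rintro a (rfl | rfl | rfl) b (rfl | rfl | rfl) hab <;> first | exact absurd rfl hab | assumption

theorem triples_finite (L : Layout m) : L.triples.Finite := by
  refine ((Finset.Ico (0 : ℤ) m).powerset.finite_toSet).subset ?_
  rintro τ ⟨hc, s, hs⟩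
  simp only [Finset.coe_powerset, mem_preimage, mem_powerset_iff, Finset.coe_subset]
  intro i hi
  obtain ⟨j, hj, hij⟩ := Finset.exists_mem_ne (by omega : 1 < τ.card) i
  exact Finset.mem_Ico.2 (hs i hi j hj hij.symm).1.1

end Layout

end PlaneSets

/-! ### Tubes -/

/-- Lower end of the interval occupied at distance `x` (in slots) from the apex of a line whose
height grows by one every four slots, in staircase form. -/
def tubeLo (x : ℤ) : ℤ := 2 * ((x + 2) / 8) - 2 + max 0 (min ((x + 2) % 8 - 4) 2)

/-- Upper end of the interval occupied at distance `x` (in slots) from the apex of a line whose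
height grows by one every four slots, in staircase form. -/
def tubeHi (x : ℤ) : ℤ := 2 * ((x + 2) / 8) + 2 + max 0 ((x + 2) % 8 - 6)

/-- Tubes with apices at slots `-16 i` and `-16 j` meet within distance three of the slot midway. -/
theorem tube_near {s i j : ℤ} (hij : i < j) : (tubeLo |s + 16 * i| < tubeHi |s + 16 * j| ∧
    tubeLo |s + 16 * j| < tubeHi |s + 16 * i|) ↔ -3 ≤ s + 8 * (i + j) ∧ s + 8 * (i + j) ≤ 3 := by
  unfold tubeLo tubeHi
  rcases abs_cases (s + 16 * i) with ⟨h, h'⟩ | ⟨h, h'⟩ <;> rw [h] <;>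
  rcases abs_cases (s + 16 * j) with ⟨h2, h2'⟩ | ⟨h2, h2'⟩ <;> rw [h2] <;> omega

theorem tube_lt (x : ℤ) : tubeLo |x| < tubeHi |x| ∧ -2 ≤ tubeLo |x| := by
  unfold tubeLo tubeHi
  have := abs_nonneg x
  omega

/-! ### The deltoid layout -/

namespace Deltoid

/-- The slots of the foot of a line with only a right branch. -/
def FootL (K s k : ℤ) : Prop :=
  2 * K + 1 < 3 * k ∧ 8 * k - 16 * K - 5 ≤ s ∧ s ≤ 8 * k - 16 * K - 3

/-- The slots of the foot of a line with only a left branch. -/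
def FootR (K s k : ℤ) : Prop :=
  3 * k < K ∧ 8 * k - 8 * K - 5 ≤ s ∧ s ≤ 8 * k - 8 * K - 3

/-- The slots missed by a line with only one branch. -/
def Absent (K s k : ℤ) : Prop :=
  (2 * K + 1 < 3 * k ∧ s < 8 * k - 16 * K - 5) ∨ (3 * k < K ∧ 8 * k - 8 * K - 3 < s)

instance (K s k : ℤ) : Decidable (FootL K s k) := by unfold FootL; infer_instance
instance (K s k : ℤ) : Decidable (FootR K s k) := by unfold FootR; infer_instance
instance (K s k : ℤ) : Decidable (Absent K s k) := by unfold Absent; infer_instance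

/-- Lower ends in the deltoid layout. Feet reach down to `-3`, below all tubes. -/
def lo (K s k : ℤ) : ℤ :=
  if Absent K s k then 0 else if FootL K s k ∨ FootR K s k then -3 else tubeLo |s + 16 * k|

/-- Upper ends in the deltoid layout. At the slot facing away from the branch of the line, a foot is
lower by two, as required by the directions of its triples. -/
def hi (K s k : ℤ) : ℤ :=
  if Absent K s k then 0 else
  if FootL K s k then (if s = 8 * k - 16 * K - 5 then 6 * k - 4 * K else 6 * k - 4 * K + 2) else
  if FootR K s k then (if s = 8 * k - 8 * K - 3 then 2 * K + 2 - 6 * k else 2 * K + 4 - 6 * k) else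
  tubeHi |s + 16 * k|

/-- The first slot at which the lines `i < j` meet. -/
def nearLo (K i j : ℤ) : ℤ :=
  if 2 * K < i + 2 * j then 8 * j - 16 * K - 5 else
  if 2 * K + 1 < 3 * j ∧ i + 2 * j = 2 * K then - 8 * (i + j) - 4 else
  if 2 * i + j ≤ K then 8 * i - 8 * K - 5 else - 8 * (i + j) - 3

/-- The last slot at which the lines `i < j` meet. -/
def nearHi (K i j : ℤ) : ℤ :=
  if 2 * K < i + 2 * j then 8 * j - 16 * K - 3 else
  if 2 * i + j ≤ K then 8 * i - 8 * K - 3 else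
  if 3 * i < K ∧ 2 * i + j = K + 1 then - 8 * (i + j) + 4 else - 8 * (i + j) + 3

theorem values_tube {K s k : ℤ} (h1 : ¬ Absent K s k) (h2 : ¬ FootL K s k) (h3 : ¬ FootR K s k) :
    lo K s k = tubeLo |s + 16 * k| ∧ hi K s k = tubeHi |s + 16 * k| := by
  simp [lo, hi, h1, h2, h3]

theorem values_footL {K s k : ℤ} (hK : 0 ≤ K) (h : FootL K s k) : lo K s k = -3 ∧
    ((s = 8 * k - 16 * K - 5 ∧ hi K s k = 6 * k - 4 * K) ∨
      (s ≠ 8 * k - 16 * K - 5 ∧ hi K s k = 6 * k - 4 * K + 2)) := by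
  have : ¬ Absent K s k := by unfold FootL at h; unfold Absent; omega
  simp only [lo, hi, this, h, if_false, if_true, true_or]
  split_ifs <;> simp_all

theorem values_footR {K s k : ℤ} (hK : 0 ≤ K) (h : FootR K s k) : lo K s k = -3 ∧
    ((s = 8 * k - 8 * K - 3 ∧ hi K s k = 2 * K + 2 - 6 * k) ∨
      (s ≠ 8 * k - 8 * K - 3 ∧ hi K s k = 2 * K + 4 - 6 * k)) := by
  have h1 : ¬ Absent K s k := by unfold FootR at h; unfold Absent; omega
  have h2 : ¬ FootL K s k := by unfold FootR at h; unfold FootL; omega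
  simp only [lo, hi, h1, h2, h, if_false, if_true, or_true]
  split_ifs <;> simp_all

theorem lo_lt_hi_iff {K s k : ℤ} (hK : 0 ≤ K) : lo K s k < hi K s k ↔ ¬ Absent K s k := by
  by_cases h1 : Absent K s k
  · simp [lo, hi, h1]
  by_cases h2 : FootL K s k
  · have := values_footL hK h2
    unfold FootL at h2
    simp only [h1, not_false_eq_true, iff_true]
    omega
  by_cases h3 : FootR K s k
  · have := values_footR hK h3
    unfold FootR at h3
    simp only [h1, not_false_eq_true, iff_true]
    omega
  have := values_tube h1 h2 h3
  rw [this.1, this.2]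
  simp [h1, tube_lt]

set_option maxHeartbeats 1000000 in
/-- At the slots between `nearLo` and `nearHi` the lines `i < j` meet: at the foot of one of them, or
around the crossing of their tubes, or both if these are adjacent. -/
theorem near_iff {K s i j : ℤ} (h0 : 0 ≤ i) (hij : i < j) (hj : j < K) :
    (lo K s i < hi K s i ∧ lo K s j < hi K s j ∧ lo K s i < hi K s j ∧ lo K s j < hi K s i)
      ↔ nearLo K i j ≤ s ∧ s ≤ nearHi K i j := by
  have := tube_near (s := s) hij
  have fL1 : FootL K s i → Absent K s j := by unfold FootL Absent; omega
  have fR1 : FootR K s j → Absent K s i := by unfold FootR Absent; omega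
  have fL2 : FootL K s j → ¬ FootR K s i ∧ ¬ FootL K s i := by
    unfold FootL FootR; omega
  have fR2 : FootR K s i → ¬ FootL K s j ∧ ¬ FootR K s j := by
    unfold FootL FootR; omega
  have hK : 0 ≤ K := by omega
  rw [lo_lt_hi_iff hK, lo_lt_hi_iff hK]
  by_cases hA : Absent K s i ∨ Absent K s j
  · have : ¬ (nearLo K i j ≤ s ∧ s ≤ nearHi K i j) := by
      unfold Absent at hA
      unfold nearLo nearHi
      omega
    tauto
  push Not at hA
  simp only [hA.1, hA.2, not_false_eq_true, true_and]
  by_cases h1 : FootL K s j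
  · have := fL2 h1
    rw [(values_tube hA.1 this.2 this.1).1, (values_tube hA.1 this.2 this.1).2]
    have v := values_footL hK h1
    unfold FootL at h1
    unfold nearLo nearHi
    unfold tubeLo tubeHi at *
    rcases abs_cases (s + 16 * i) with ⟨h, h'⟩ | ⟨h, h'⟩ <;> rw [h] at * <;> clear h <;> omega
  by_cases h2 : FootR K s i
  · have := fR2 h2
    rw [(values_tube hA.2 this.1 this.2).1, (values_tube hA.2 this.1 this.2).2]
    have v := values_footR hK h2
    unfold FootR at h2
    unfold nearLo nearHi
    unfold tubeLo tubeHi at *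
    rcases abs_cases (s + 16 * j) with ⟨h, h'⟩ | ⟨h, h'⟩ <;> rw [h] at * <;> clear h <;> omega
  have h3 : ¬ FootL K s i := fun h => hA.2 (fL1 h)
  have h4 : ¬ FootR K s j := fun h => hA.1 (fR1 h)
  rw [(values_tube hA.1 h3 h2).1, (values_tube hA.1 h3 h2).2, (values_tube hA.2 h1 h4).1,
    (values_tube hA.2 h1 h4).2, this]
  unfold FootL Absent FootR nearLo nearHi at *
  omega

/-- The layout of `m` lines shaped like tangents of a deltoid. -/
def layout (m : ℕ) : Layout m where
  lo := lo m
  hi := hi m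
  foot s v := (0 ≤ v ∧ v < m) ∧ (FootL m s v ∨ FootR m s v)

variable {m : ℕ}

theorem pres_iff {s i : ℤ} : (layout m).Pres s i ↔ (0 ≤ i ∧ i < m) ∧ ¬ Absent m s i := by
  unfold Layout.Pres
  rw [← lo_lt_hi_iff (by positivity)]
  rfl

theorem near_iff_of_lt {s i j : ℤ} (hij : i < j) : (layout m).Near s i j ↔
    0 ≤ i ∧ j < m ∧ nearLo m i j ≤ s ∧ s ≤ nearHi m i j := by
  constructor
  · rintro ⟨h1, h2, h3⟩
    exact ⟨h1.1.1, h2.1.2, (near_iff h1.1.1 hij h2.1.2).1 ⟨h1.2, h2.2, h3⟩⟩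
  · rintro ⟨h1, h2, h3⟩
    obtain ⟨a, b, c⟩ := (near_iff h1 hij h2).2 h3
    exact ⟨⟨⟨h1, by omega⟩, a⟩, ⟨⟨by omega, h2⟩, b⟩, c⟩

/-- Three lines `i < j < k` meet over the foot of `k` if `i + j + k` is `2m` or `2m + 1`, over the
foot of `i` if `i + j + k` is `m` or `m + 1`, and nowhere otherwise. -/
theorem three_near_iff {s i j k : ℤ} (hij : i < j) (hjk : j < k) :
    ((layout m).Near s i j ∧ (layout m).Near s i k ∧ (layout m).Near s j k) ↔
      0 ≤ i ∧ k < m ∧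
      ((i + j + k = 2 * m ∧ s = 8 * k - 16 * m - 3) ∨
        (i + j + k = 2 * m + 1 ∧ s = 8 * k - 16 * m - 5) ∨
        (i + j + k = m ∧ s = 8 * i - 8 * m - 3) ∨
        (i + j + k = m + 1 ∧ s = 8 * i - 8 * m - 5)) := by
  rw [near_iff_of_lt hij, near_iff_of_lt hjk, near_iff_of_lt (hij.trans hjk)]
  unfold nearLo nearHi
  omega

/-! ### The triples of the deltoid layout -/

/-- The lines meeting a foot and each other, with the slot where they do. -/
theorem foot_form {s v l u : ℤ} (hf : (layout m).foot s v) (hvl : v ≠ l) (hvu : v ≠ u)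
    (hlu : l ≠ u) (h1 : (layout m).Near s v l) (h2 : (layout m).Near s v u)
    (h3 : (layout m).Near s l u) :
    (0 ≤ l ∧ l < m ∧ 0 ≤ u ∧ u < m ∧ 0 ≤ v ∧ v < m) ∧
    ((2 * m + 1 < 3 * v ∧ l < v ∧ u < v ∧
        ((l + u + v = 2 * m ∧ s = 8 * v - 16 * m - 3) ∨
          (l + u + v = 2 * m + 1 ∧ s = 8 * v - 16 * m - 5))) ∨
      (3 * v < m ∧ v < l ∧ v < u ∧
        ((l + u + v = m ∧ s = 8 * v - 8 * m - 3) ∨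
          (l + u + v = m + 1 ∧ s = 8 * v - 8 * m - 5)))) := by
  obtain ⟨hv, hf⟩ := hf
  unfold FootL FootR at hf
  rcases hvl.lt_or_gt with a | a <;> rcases hvu.lt_or_gt with b | b <;>
    rcases hlu.lt_or_gt with c | c
  · have := (three_near_iff a c).1 ⟨h1, h2, h3⟩; omega
  · have := (three_near_iff b c).1 ⟨h2, h1, h3.symm⟩; omega
  · omega
  · have := (three_near_iff b a).1 ⟨h2.symm, h3.symm, h1⟩; omega
  · have := (three_near_iff a b).1 ⟨h1.symm, h3, h2⟩; omega
  · omega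
  · have := (three_near_iff c b).1 ⟨h3, h1.symm, h2.symm⟩; omega
  · have := (three_near_iff c a).1 ⟨h3.symm, h2.symm, h1.symm⟩; omega

/-- Two lines crossing at slot distance three over the foot of a third one: the values. -/
theorem values_of_form {s l u v : ℤ} (hlu : l ≠ u)
    (hr : 0 ≤ l ∧ l < m ∧ 0 ≤ u ∧ u < m ∧ 0 ≤ v ∧ v < m)
    (h : ((2 * m + 1 < 3 * v ∧ l < v ∧ u < v ∧
        ((l + u + v = 2 * m ∧ s = 8 * v - 16 * m - 3) ∨
          (l + u + v = 2 * m + 1 ∧ s = 8 * v - 16 * m - 5))) ∨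
      (3 * v < m ∧ v < l ∧ v < u ∧
        ((l + u + v = m ∧ s = 8 * v - 8 * m - 3) ∨
          (l + u + v = m + 1 ∧ s = 8 * v - 8 * m - 5))))) :
    ∃ δ : ℤ, 1 ≤ δ ∧ (δ = l - u ∨ δ = u - l) ∧ lo m s v = -3 ∧ 2 * δ + 2 ≤ hi m s v ∧
      ((|s + 16 * l| = 8 * δ - 3 ∧ |s + 16 * u| = 8 * δ + 3 ∧ lo m s l = 2 * δ - 2 ∧
        hi m s l = 2 * δ + 1 ∧ lo m s u = 2 * δ - 1 ∧ hi m s u = 2 * δ + 2) ∨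
      (|s + 16 * u| = 8 * δ - 3 ∧ |s + 16 * l| = 8 * δ + 3 ∧ lo m s u = 2 * δ - 2 ∧
        hi m s u = 2 * δ + 1 ∧ lo m s l = 2 * δ - 1 ∧ hi m s l = 2 * δ + 2)) := by
  have hl : lo m s l = tubeLo |s + 16 * l| ∧ hi m s l = tubeHi |s + 16 * l| := by
    refine values_tube ?_ ?_ ?_
    · unfold Absent; omega
    · unfold FootL; omega
    · unfold FootR; omega
  have hu : lo m s u = tubeLo |s + 16 * u| ∧ hi m s u = tubeHi |s + 16 * u| := by
    refine values_tube ?_ ?_ ?_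
    · unfold Absent; omega
    · unfold FootL; omega
    · unfold FootR; omega
  have hv : lo m s v = -3 ∧ 2 * |l - u| + 2 ≤ hi m s v := by
    rcases h with h | h
    · have hf : FootL m s v := by unfold FootL; omega
      have := values_footL (by positivity) hf
      refine ⟨this.1, ?_⟩
      rcases abs_cases (l - u) with ⟨e, -⟩ | ⟨e, -⟩ <;> rw [e] <;> omega
    · have hf : FootR m s v := by unfold FootR; omega
      have := values_footR (by positivity) hf
      refine ⟨this.1, ?_⟩
      rcases abs_cases (l - u) with ⟨e, -⟩ | ⟨e, -⟩ <;> rw [e] <;> omega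
  have hs : s + 8 * (l + u) = 3 ∨ s + 8 * (l + u) = -3 := by omega
  clear h
  refine ⟨|l - u|, ?_, ?_, hv.1, hv.2, ?_⟩
  · have := abs_pos.2 (sub_ne_zero.2 hlu)
    omega
  · rcases abs_cases (l - u) with ⟨e, -⟩ | ⟨e, -⟩ <;> rw [e] <;> omega
  · rw [hl.1, hl.2, hu.1, hu.2]
    clear hl hu hv
    have key : ∀ x y δ : ℤ, 1 ≤ δ → x = 8 * δ - 3 → y = 8 * δ + 3 →
        x = 8 * δ - 3 ∧ y = 8 * δ + 3 ∧ tubeLo x = 2 * δ - 2 ∧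
        tubeHi x = 2 * δ + 1 ∧ tubeLo y = 2 * δ - 1 ∧ tubeHi y = 2 * δ + 2 := by
      intro x y δ h hx hy
      unfold tubeLo tubeHi
      omega
    have h1 : 1 ≤ |l - u| := by
      have := abs_pos.2 (sub_ne_zero.2 hlu)
      omega
    have : (|s + 16 * l| = 8 * |l - u| - 3 ∧ |s + 16 * u| = 8 * |l - u| + 3) ∨
        (|s + 16 * u| = 8 * |l - u| - 3 ∧ |s + 16 * l| = 8 * |l - u| + 3) := by
      rcases abs_cases (l - u) with ⟨e, f⟩ | ⟨e, f⟩ <;>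
      rcases abs_cases (s + 16 * l) with ⟨e1, f1⟩ | ⟨e1, f1⟩ <;>
      rcases abs_cases (s + 16 * u) with ⟨e2, f2⟩ | ⟨e2, f2⟩ <;> rw [e, e1, e2] <;> omega
    rcases this with h | h
    · exact Or.inl (key _ _ _ h1 h.1 h.2)
    · exact Or.inr (key _ _ _ h1 h.1 h.2)

theorem foot_three {s v l u : ℤ} (hf : (layout m).foot s v) (hvl : v ≠ l) (hvu : v ≠ u)
    (hlu : l ≠ u) (h1 : (layout m).Near s v l) (h2 : (layout m).Near s v u)
    (h3 : (layout m).Near s l u) : lo m s v < lo m s l ∧ hi m s l ≤ hi m s v ∧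
      ((lo m s l < lo m s u ∧ hi m s l < hi m s u) ∨
        (lo m s u < lo m s l ∧ hi m s u < hi m s l)) := by
  obtain ⟨hr, h⟩ := foot_form hf hvl hvu hlu h1 h2 h3
  obtain ⟨δ, hδ, -, h⟩ := values_of_form hlu hr h
  omega

/-- The shape of a triple, with the values of the lower and the upper line. -/
theorem trip_form {s v l u : ℤ} (h : (layout m).Trip s v l u) :
    (0 ≤ l ∧ l < m ∧ 0 ≤ u ∧ u < m ∧ 0 ≤ v ∧ v < m) ∧
    ((2 * m + 1 < 3 * v ∧ l < v ∧ u < v ∧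
        ((l + u + v = 2 * m ∧ s = 8 * v - 16 * m - 3) ∨
          (l + u + v = 2 * m + 1 ∧ s = 8 * v - 16 * m - 5))) ∨
      (3 * v < m ∧ v < l ∧ v < u ∧
        ((l + u + v = m ∧ s = 8 * v - 8 * m - 3) ∨
          (l + u + v = m + 1 ∧ s = 8 * v - 8 * m - 5)))) ∧
    ∃ δ : ℤ, 1 ≤ δ ∧ (δ = l - u ∨ δ = u - l) ∧ lo m s v = -3 ∧
      |s + 16 * l| = 8 * δ - 3 ∧ |s + 16 * u| = 8 * δ + 3 ∧ lo m s l = 2 * δ - 2 ∧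
        hi m s l = 2 * δ + 1 ∧ lo m s u = 2 * δ - 1 ∧ hi m s u = 2 * δ + 2 := by
  have hlu := h.ne
  obtain ⟨hf, hvl, hvu, h1, h2, h3, hlt⟩ := h
  obtain ⟨hr, h⟩ := foot_form hf hvl hvu hlu h1 h2 h3
  obtain ⟨δ, hδ, hd, hv, -, h'⟩ := values_of_form hlu hr h
  refine ⟨hr, h, δ, hδ, hd, hv, ?_⟩
  change lo m s l < lo m s u at hlt
  omega

theorem trip_odd {s v l u : ℤ} (h : (layout m).Trip s v l u) : s % 2 = 1 := by
  have := (trip_form h).2.1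
  omega

theorem dir_of_mod {s : ℤ} : (s % 4 = 3 ∧ Layout.dir s = 1) ∨ (s % 4 ≠ 3 ∧ Layout.dir s = -1) := by
  unfold Layout.dir
  split_ifs <;> simp [*]

theorem squeeze_in {s v l u : ℤ} (h : (layout m).Trip s v l u) :
    lo m (s + Layout.dir s) v ≤ lo m s v ∧ hi m s v ≤ hi m (s + Layout.dir s) v := by
  obtain ⟨hr, h, -⟩ := trip_form h
  rcases h with h | h
  · have hd : s + Layout.dir s = 8 * v - 16 * m - 4 := by
      rcases dir_of_mod (s := s) with h' | h' <;> omega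
    have v1 := values_footL (K := m) (s := s) (k := v) (by positivity) (by unfold FootL; omega)
    have v2 := values_footL (K := m) (s := s + Layout.dir s) (k := v) (by positivity)
      (by unfold FootL; omega)
    omega
  · have hd : s + Layout.dir s = 8 * v - 8 * m - 4 := by
      rcases dir_of_mod (s := s) with h' | h' <;> omega
    have v1 := values_footR (K := m) (s := s) (k := v) (by positivity) (by unfold FootR; omega)
    have v2 := values_footR (K := m) (s := s + Layout.dir s) (k := v) (by positivity)
      (by unfold FootR; omega)
    omega

theorem squeeze_out {s v l u : ℤ} (h : (layout m).Trip s v l u)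
    (hp : (layout m).Pres (s - Layout.dir s) v) :
    lo m s v ≤ lo m (s - Layout.dir s) v ∧ hi m (s - Layout.dir s) v ≤ hi m s v ∧
      (hi m (s - Layout.dir s) v ≤ lo m s u ∨ hi m s l ≤ lo m (s - Layout.dir s) v) := by
  obtain ⟨hr, h, δ, hδ, hd, hv⟩ := trip_form h
  rw [pres_iff] at hp
  have hp := hp.2
  rcases h with h | h
  · have hd : (s = 8 * v - 16 * m - 3 ∧ s - Layout.dir s = 8 * v - 16 * m - 2) ∨
        (s = 8 * v - 16 * m - 5 ∧ s - Layout.dir s = 8 * v - 16 * m - 6) := by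
      rcases dir_of_mod (s := s) with h' | h' <;> omega
    have v1 := values_footL (K := m) (s := s) (k := v) (by positivity) (by unfold FootL; omega)
    rcases hd with ⟨e, hd⟩ | ⟨e, hd⟩
    · rw [hd] at hp ⊢
      have v2 := values_tube hp (by unfold FootL; omega) (by unfold FootR; omega)
      rw [abs_of_pos (by omega)] at v2
      unfold tubeLo tubeHi at v2
      omega
    · unfold Absent at hp
      omega
  · have hd : (s = 8 * v - 8 * m - 5 ∧ s - Layout.dir s = 8 * v - 8 * m - 6) ∨
        (s = 8 * v - 8 * m - 3 ∧ s - Layout.dir s = 8 * v - 8 * m - 2) := by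
      rcases dir_of_mod (s := s) with h' | h' <;> omega
    have v1 := values_footR (K := m) (s := s) (k := v) (by positivity) (by unfold FootR; omega)
    rcases hd with ⟨e, hd⟩ | ⟨e, hd⟩
    · rw [hd] at hp ⊢
      have v2 := values_tube hp (by unfold FootL; omega) (by unfold FootR; omega)
      rw [abs_of_neg (by omega)] at v2
      unfold tubeLo tubeHi at v2
      omega
    · unfold Absent at hp
      omega

/-- Next to a triple, its two lines other than the foot are given by the tube. -/
theorem values_next {s v l u t w : ℤ} (h : (layout m).Trip s v l u) (ht : t = s + 1 ∨ t = s - 1)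
    (hw : w = l ∨ w = u) (hp : (layout m).Pres t w) :
    lo m t w = tubeLo |t + 16 * w| ∧ hi m t w = tubeHi |t + 16 * w| := by
  obtain ⟨hr, h, -⟩ := trip_form h
  rw [pres_iff] at hp
  refine values_tube hp.2 ?_ ?_
  · unfold FootL; omega
  · unfold FootR; omega

theorem clear_lower {s v l u t : ℤ} (h : (layout m).Trip s v l u) (ht : t = s + 1 ∨ t = s - 1)
    (hp : (layout m).Pres t l) : lo m t l < lo m s u ∧ lo m s l < hi m t l := by
  obtain ⟨v1, v2⟩ := values_next h ht (Or.inl rfl) hp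
  obtain ⟨hr, -, δ, hδ, hd, hv⟩ := trip_form h
  rw [v1, v2]
  have : |t + 16 * l| = 8 * δ - 2 ∨ |t + 16 * l| = 8 * δ - 4 := by
    rcases abs_cases (s + 16 * l) with ⟨e1, f1⟩ | ⟨e1, f1⟩ <;>
      rcases abs_cases (t + 16 * l) with ⟨e2, f2⟩ | ⟨e2, f2⟩ <;> rw [e1] at hv <;> rw [e2] <;> omega
  unfold tubeLo tubeHi
  omega

theorem clear_upper {s v l u t : ℤ} (h : (layout m).Trip s v l u) (ht : t = s + 1 ∨ t = s - 1)
    (hp : (layout m).Pres t u) : lo m t u < hi m s u ∧ hi m s l < hi m t u := by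
  obtain ⟨v1, v2⟩ := values_next h ht (Or.inr rfl) hp
  obtain ⟨hr, -, δ, hδ, hd, hv⟩ := trip_form h
  rw [v1, v2]
  have : |t + 16 * u| = 8 * δ + 2 ∨ |t + 16 * u| = 8 * δ + 4 := by
    rcases abs_cases (s + 16 * u) with ⟨e1, f1⟩ | ⟨e1, f1⟩ <;>
      rcases abs_cases (t + 16 * u) with ⟨e2, f2⟩ | ⟨e2, f2⟩ <;> rw [e1] at hv <;> rw [e2] <;> omega
  unfold tubeLo tubeHi
  omega

theorem not_near {s v l u w : ℤ} (h : (layout m).Trip s v l u) (hw : w = l ∨ w = u) :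
    ¬ (layout m).Near (s - Layout.dir s) v w := by
  intro hn
  have hlu := h.ne
  obtain ⟨hr, h, -⟩ := trip_form h
  have hd := dir_of_mod (s := s)
  rcases lt_trichotomy v w with hvw | hvw | hvw
  · rw [near_iff_of_lt hvw] at hn
    unfold nearLo nearHi at hn
    omega
  · omega
  · replace hn := hn.symm
    rw [near_iff_of_lt hvw] at hn
    unfold nearLo nearHi at hn
    omega

theorem trip_end {s v l u : ℤ} (h : (layout m).Trip s v l u) :
    ¬ (layout m).Near (s - 1) l u ∨ ¬ (layout m).Near (s + 1) l u := by
  by_contra! hn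
  obtain ⟨h1, h2⟩ := hn
  have hlu := h.ne
  obtain ⟨hr, h, -⟩ := trip_form h
  rcases hlu.lt_or_gt with hvw | hvw
  · rw [near_iff_of_lt hvw] at h1 h2
    unfold nearLo nearHi at h1 h2
    omega
  · replace h1 := h1.symm
    replace h2 := h2.symm
    rw [near_iff_of_lt hvw] at h1 h2
    unfold nearLo nearHi at h1 h2
    omega

/-! ### The deltoid layout is good -/

theorem values_cases {s i : ℤ} (hs : ¬ Absent m s i) : (FootL m s i ∧ lo m s i = -3 ∧ 0 < hi m s i ∧
      ((s = 8 * i - 16 * m - 5 ∧ hi m s i = 6 * i - 4 * m) ∨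
      (s ≠ 8 * i - 16 * m - 5 ∧ hi m s i = 6 * i - 4 * m + 2))) ∨
      (FootR m s i ∧ lo m s i = -3 ∧ 0 < hi m s i ∧
      ((s = 8 * i - 8 * m - 3 ∧ hi m s i = 2 * m + 2 - 6 * i) ∨
      (s ≠ 8 * i - 8 * m - 3 ∧ hi m s i = 2 * m + 4 - 6 * i))) ∨
      (¬ FootL m s i ∧ ¬ FootR m s i ∧ lo m s i = tubeLo |s + 16 * i| ∧
        hi m s i = tubeHi |s + 16 * i|) := by
  by_cases hL : FootL m s i
  · have := values_footL (by positivity) hL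
    have h' := hL
    unfold FootL at h'
    exact Or.inl ⟨hL, this.1, by omega, this.2⟩
  by_cases hR : FootR m s i
  · have := values_footR (by positivity) hR
    have h' := hR
    unfold FootR at h'
    exact Or.inr (Or.inl ⟨hR, this.1, by omega, this.2⟩)
  exact Or.inr (Or.inr ⟨hL, hR, values_tube hs hL hR⟩)

theorem tube_cont (s a : ℤ) : tubeLo |s + a| < tubeHi |s + 1 + a| ∧
    tubeLo |s + 1 + a| < tubeHi |s + a| := by
  unfold tubeLo tubeHi
  rcases abs_cases (s + a) with ⟨e1, f1⟩ | ⟨e1, f1⟩ <;>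
    rcases abs_cases (s + 1 + a) with ⟨e2, f2⟩ | ⟨e2, f2⟩ <;> rw [e1, e2] <;> omega

theorem pres_cont {s i : ℤ} (h1 : (layout m).Pres s i) (h2 : (layout m).Pres (s + 1) i) :
    lo m s i < hi m (s + 1) i ∧ lo m (s + 1) i < hi m s i := by
  rw [pres_iff] at h1 h2
  have hc := tube_cont s (16 * i)
  have t1 := tube_lt (s + 16 * i)
  have t2 := tube_lt (s + 1 + 16 * i)
  rcases values_cases h1.2 with a | a | a <;> rcases values_cases h2.2 with b | b | b
  · omega
  · omega
  · rw [b.2.2.1, b.2.2.2]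
    unfold FootL at a b
    rw [abs_of_pos (by omega)] at *
    unfold tubeLo at *
    omega
  · omega
  · omega
  · unfold FootR Absent at *; omega
  · unfold FootL Absent at *; omega
  · rw [a.2.2.1, a.2.2.2]
    unfold FootR at a b
    rw [abs_of_neg (a := s + 16 * i) (by omega)] at *
    unfold tubeLo at *
    omega
  · rw [a.2.2.1, a.2.2.2, b.2.2.1, b.2.2.2]; exact hc

/-- Two tubes that meet at consecutive slots have a common cell at both. -/
theorem tube_tube_cont {s i j : ℤ} (hij : i < j) (h1 : -3 ≤ s + 8 * (i + j))
    (h2 : s + 1 + 8 * (i + j) ≤ 3) :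
    (tubeLo |s + 16 * i| < tubeHi |s + 1 + 16 * j| ∧
      tubeLo |s + 1 + 16 * i| < tubeHi |s + 16 * j|) ∧
      tubeLo |s + 16 * j| < tubeHi |s + 1 + 16 * i| ∧
      tubeLo |s + 1 + 16 * j| < tubeHi |s + 16 * i| := by
  rw [abs_of_neg (a := s + 16 * i) (by omega), abs_of_neg (a := s + 1 + 16 * i) (by omega),
    abs_of_pos (a := s + 16 * j) (by omega), abs_of_pos (a := s + 1 + 16 * j) (by omega)]
  unfold tubeLo tubeHi
  omega

/-- A tube that meets a foot at two consecutive slots, the first one being the thin one. -/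
theorem footL_cont {s i h h' : ℤ} (j : ℤ) (hs : 8 * j - 16 * m - 5 ≤ s) (hs' : s < 8 * j - 16 * m - 3)
    (e : (s = 8 * j - 16 * m - 5 ∧ h = 6 * j - 4 * m) ∨
      (s ≠ 8 * j - 16 * m - 5 ∧ h = 6 * j - 4 * m + 2)) (e' : h' = 6 * j - 4 * m + 2)
    (h1 : tubeLo |s + 16 * i| < h) (h2 : tubeLo |s + 1 + 16 * i| < h') :
    tubeLo |s + 16 * i| < h' ∧ tubeLo |s + 1 + 16 * i| < h := by
  unfold tubeLo at *
  rcases abs_cases (s + 16 * i) with ⟨e1, f1⟩ | ⟨e1, f1⟩ <;>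
    rcases abs_cases (s + 1 + 16 * i) with ⟨e2, f2⟩ | ⟨e2, f2⟩ <;> rw [e1] at h1 ⊢ <;>
    rw [e2] at h2 ⊢ <;> omega

theorem footR_cont {s j h h' : ℤ} (i : ℤ) (hs : 8 * i - 8 * m - 5 ≤ s) (hs' : s < 8 * i - 8 * m - 3)
    (e : h = 2 * m + 4 - 6 * i) (e' : (s + 1 = 8 * i - 8 * m - 3 ∧ h' = 2 * m + 2 - 6 * i) ∨
      (s + 1 ≠ 8 * i - 8 * m - 3 ∧ h' = 2 * m + 4 - 6 * i))
    (h1 : tubeLo |s + 16 * j| < h) (h2 : tubeLo |s + 1 + 16 * j| < h') :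
    tubeLo |s + 16 * j| < h' ∧ tubeLo |s + 1 + 16 * j| < h := by
  unfold tubeLo at *
  rcases abs_cases (s + 16 * j) with ⟨e1, f1⟩ | ⟨e1, f1⟩ <;>
    rcases abs_cases (s + 1 + 16 * j) with ⟨e2, f2⟩ | ⟨e2, f2⟩ <;> rw [e1] at h1 ⊢ <;>
    rw [e2] at h2 ⊢ <;> omega

theorem near_cont {s i j : ℤ} (hij : i < j) (h1 : (layout m).Near s i j)
    (h2 : (layout m).Near (s + 1) i j) :
    (lo m s i < hi m (s + 1) j ∧ lo m (s + 1) i < hi m s j) ∧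
      lo m s j < hi m (s + 1) i ∧ lo m (s + 1) j < hi m s i := by
  have hn1 := (near_iff_of_lt hij).1 h1
  have hn2 := (near_iff_of_lt hij).1 h2
  obtain ⟨ha1, hb1, hc1, hd1⟩ := h1
  obtain ⟨ha2, hb2, hc2, hd2⟩ := h2
  change lo m s i < hi m s j at hc1
  change lo m s j < hi m s i at hd1
  change lo m (s + 1) i < hi m (s + 1) j at hc2
  change lo m (s + 1) j < hi m (s + 1) i at hd2
  rw [pres_iff] at ha1 hb1 ha2 hb2
  have ti1 := tube_lt (s + 16 * i)
  have ti2 := tube_lt (s + 1 + 16 * i)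
  have tj1 := tube_lt (s + 16 * j)
  have tj2 := tube_lt (s + 1 + 16 * j)
  have nL : ∀ s, ¬ Absent m s j → ¬ FootL m s i := by
    unfold Absent FootL; omega
  have nR : ∀ s, ¬ Absent m s i → ¬ FootR m s j := by
    unfold Absent FootR; omega
  have nB : ∀ s, FootL m s j → ¬ FootR m s i := by
    unfold FootR FootL; omega
  have nLR : FootL m s j → ¬ FootR m (s + 1) i := by
    unfold FootR FootL; omega
  have nRL : FootR m s i → ¬ FootL m (s + 1) j := by
    unfold FootR FootL; omega
  rcases values_cases ha1.2 with ai | ai | ai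
  · exact absurd ai.1 (nL _ hb1.2)
  · rcases values_cases hb1.2 with aj | aj | aj
    · exact absurd ai.1 (nB _ aj.1)
    · exact absurd aj.1 (nR _ ha1.2)
    rcases values_cases ha2.2 with bi | bi | bi
    · exact absurd bi.1 (nL _ hb2.2)
    · rcases values_cases hb2.2 with bj | bj | bj
      · exact absurd bi.1 (nB _ bj.1)
      · exact absurd bj.1 (nR _ ha2.2)
      rw [aj.2.2.1] at hd1 ⊢
      rw [bj.2.2.1] at hd2 ⊢
      rw [aj.2.2.2, bj.2.2.2]
      have ai' := ai.1
      have bi' := bi.1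
      unfold FootR at ai' bi'
      have := footR_cont i ai'.2.1 (by omega) (by omega) bi.2.2.2 hd1 hd2
      omega
    · unfold FootR at ai bi
      unfold Absent at ha2
      omega
  · rcases values_cases hb1.2 with aj | aj | aj
    · rcases values_cases ha2.2 with bi | bi | bi
      · exact absurd bi.1 (nL _ hb2.2)
      · exact absurd bi.1 (nLR aj.1)
      have aj' := aj.1
      unfold FootL at aj'
      rcases values_cases hb2.2 with bj | bj | bj
      · have bj' := bj.1
        unfold FootL at bj'
        rw [ai.2.2.1] at hc1 ⊢
        rw [bi.2.2.1] at hc2 ⊢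
        rw [ai.2.2.2, bi.2.2.2]
        have := footL_cont j aj'.2.1 (by omega) aj.2.2.2 (by omega) hc1 hc2
        omega
      · exact absurd bj.1 (nR _ ha2.2)
      · have hs : s = 8 * j - 16 * m - 3 ∧ i + 2 * j = 2 * m := by
          have bj' := bj.1
          unfold FootL at bj'
          unfold nearLo nearHi at hn1 hn2
          omega
        have hj : hi m s j = 6 * j - 4 * m + 2 := by omega
        rw [ai.2.2.1, ai.2.2.2, bi.2.2.1, bi.2.2.2, bj.2.2.1, bj.2.2.2, hj, aj.2.1]
        rw [abs_of_neg (a := s + 16 * i) (by omega), abs_of_neg (a := s + 1 + 16 * i) (by omega),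
          abs_of_pos (a := s + 1 + 16 * j) (by omega)]
        unfold tubeLo tubeHi
        omega
    · exact absurd aj.1 (nR _ ha1.2)
    rcases values_cases hb2.2 with bj | bj | bj
    · have aj' := aj.1
      have bj' := bj.1
      unfold Absent at hb1
      unfold FootL at aj' bj'
      omega
    · exact absurd bj.1 (nR _ ha2.2)
    rcases values_cases ha2.2 with bi | bi | bi
    · exact absurd bi.1 (nL _ hb2.2)
    · have hs : s = 8 * i - 8 * m - 6 ∧ 2 * i + j = m + 1 := by
        have ai' := ai.2.1
        have bi' := bi.1
        unfold FootR at ai' bi'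
        unfold nearLo nearHi at hn1 hn2
        omega
      have hi' : hi m (s + 1) i = 2 * m + 4 - 6 * i := by omega
      have bi' := bi.1
      unfold FootR at bi'
      rw [ai.2.2.1, ai.2.2.2, bj.2.2.1, bj.2.2.2, aj.2.2.1, aj.2.2.2, hi', bi.2.1]
      rw [abs_of_neg (a := s + 16 * i) (by omega), abs_of_pos (a := s + 16 * j) (by omega),
        abs_of_pos (a := s + 1 + 16 * j) (by omega)]
      unfold tubeLo tubeHi
      omega
    · rw [ai.2.2.1, aj.2.2.2] at hc1
      rw [aj.2.2.1, ai.2.2.2] at hd1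
      rw [bi.2.2.1, bj.2.2.2] at hc2
      rw [bj.2.2.1, bi.2.2.2] at hd2
      have g1 := ((tube_near hij).1 ⟨hc1, hd1⟩).1
      have g2 := ((tube_near hij).1 ⟨hc2, hd2⟩).2
      rw [ai.2.2.1, ai.2.2.2, aj.2.2.1, aj.2.2.2, bi.2.2.1, bi.2.2.2, bj.2.2.1, bj.2.2.2]
      exact tube_tube_cont hij g1 g2

/-- The deltoid layout satisfies all the conditions. -/
theorem good : (layout m).Good where
  foot_unique := by
    rintro s v w ⟨hv, h1⟩ ⟨hw, h2⟩
    unfold FootL FootR at h1 h2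
    omega
  foot_bounded := by
    refine ⟨16 * m + 5, ?_⟩
    rintro s v ⟨hv, h⟩
    unfold FootL FootR at h
    rw [abs_le]
    omega
  pres_ord := by
    intro a b c i h1 h2 hab hbc
    rw [pres_iff] at *
    unfold Absent at *
    omega
  pres_cont := pres_cont
  near_ord := by
    intro a b c i j hij h1 h2 hab hbc
    rcases hij.lt_or_gt with h | h
    · rw [near_iff_of_lt h] at *
      omega
    · have h1 := h1.symm
      have h2 := h2.symm
      apply Layout.Near.symm
      rw [near_iff_of_lt h] at *
      omega
  near_cont := by
    intro s i j hij h1 h2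
    rcases hij.lt_or_gt with h | h
    · exact (near_cont h h1 h2).1
    · exact (near_cont h h1.symm h2.symm).2
  near_pair := by
    have key : ∀ i j : ℤ, 0 ≤ i → i < j → j < m → ∃ s, (layout m).Near s i j ∧ s % 2 ≠ 1 := by
      intro i j h0 hij hj
      refine ⟨if 2 * m < i + 2 * j then 8 * j - 16 * m - 4 else
        if 2 * i + j ≤ m then 8 * i - 8 * m - 4 else - 8 * (i + j), ?_, by split_ifs <;> omega⟩
      rw [near_iff_of_lt hij]
      unfold nearLo nearHi
      split_ifs <;> omega
    intro i j hi hi' hj hj' hij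
    rcases hij.lt_or_gt with h | h
    · obtain ⟨s, hs, hs'⟩ := key i j hi h hj'
      exact ⟨s, hs, fun v => ⟨fun h => hs' (trip_odd h), fun h => hs' (trip_odd h)⟩⟩
    · obtain ⟨s, hs, hs'⟩ := key j i hj h hi'
      exact ⟨s, hs.symm, fun v => ⟨fun h => hs' (trip_odd h), fun h => hs' (trip_odd h)⟩⟩
  near_three := by
    have key : ∀ {s i j k : ℤ}, i < j → j < k → (layout m).Near s i j → (layout m).Near s i k →
        (layout m).Near s j k → (layout m).foot s i ∨ (layout m).foot s k := by
      intro s i j k hij hjk h1 h2 h3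
      have := (three_near_iff hij hjk).1 ⟨h1, h2, h3⟩
      simp only [layout, FootL, FootR]
      omega
    intro s i j k hij hik hjk h1 h2 h3
    rcases hij.lt_or_gt with a | a <;> rcases hik.lt_or_gt with b | b <;>
      rcases hjk.lt_or_gt with c | c
    · have := key a c h1 h2 h3; tauto
    · have := key b c h2 h1 h3.symm; tauto
    · omega
    · have := key b a h2.symm h3.symm h1; tauto
    · have := key a b h1.symm h3 h2; tauto
    · omega
    · have := key c b h3 h1.symm h2.symm; tauto
    · have := key c a h3.symm h2.symm h1.symm; tauto
  three_slot := by
    have key : ∀ {s s' i j k : ℤ}, i < j → j < k → (layout m).Near s i j → (layout m).Near s i k →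
        (layout m).Near s j k → (layout m).Near s' i j → (layout m).Near s' i k →
        (layout m).Near s' j k → s = s' := by
      intro s s' i j k hij hjk h1 h2 h3 h4 h5 h6
      have := (three_near_iff hij hjk).1 ⟨h1, h2, h3⟩
      have := (three_near_iff hij hjk).1 ⟨h4, h5, h6⟩
      omega
    intro s s' i j k hij hik hjk h1 h2 h3 h4 h5 h6
    rcases hij.lt_or_gt with a | a <;> rcases hik.lt_or_gt with b | b <;>
      rcases hjk.lt_or_gt with c | c
    · exact key a c h1 h2 h3 h4 h5 h6
    · exact key b c h2 h1 h3.symm h5 h4 h6.symm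
    · omega
    · exact key b a h2.symm h3.symm h1 h5.symm h6.symm h4
    · exact key a b h1.symm h3 h2 h4.symm h6 h5
    · omega
    · exact key c b h3 h1.symm h2.symm h6 h4.symm h5.symm
    · exact key c a h3.symm h2.symm h1.symm h6.symm h5.symm h4.symm
  foot_three := foot_three
  partner := by
    intro s v l u u' hf h1 h2 h3 h4 h5 n1 n2 n3 n4 n5
    have e1 := (foot_form hf h1 h2 h4 n1 n2 n4).2
    have e2 := (foot_form hf h1 h3 h5 n1 n3 n5).2
    omega
  trip_odd := trip_odd
  squeeze_in := squeeze_in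
  squeeze_out := squeeze_out
  not_near h := ⟨not_near h (Or.inl rfl), not_near h (Or.inr rfl)⟩
  clear_lower := clear_lower
  clear_upper := clear_upper
  trip_end := trip_end

/-! ### Counting the triples of the deltoid layout -/

theorem exists_three_near {i j k : ℤ} (hi : 0 ≤ i ∧ i < m) (hj : 0 ≤ j ∧ j < m)
    (hk : 0 ≤ k ∧ k < m) (hij : i ≠ j) (hik : i ≠ k) (hjk : j ≠ k)
    (h : i + j + k = m ∨ i + j + k = m + 1 ∨ i + j + k = 2 * m ∨ i + j + k = 2 * m + 1) :
    ∃ s, (layout m).Near s i j ∧ (layout m).Near s i k ∧ (layout m).Near s j k := by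
  have key : ∀ {i j k : ℤ}, i < j → j < k → 0 ≤ i → k < m →
      (i + j + k = m ∨ i + j + k = m + 1 ∨ i + j + k = 2 * m ∨ i + j + k = 2 * m + 1) →
      ∃ s, (layout m).Near s i j ∧ (layout m).Near s i k ∧ (layout m).Near s j k := by
    intro i j k hij hjk h0 hk h
    simp only [three_near_iff hij hjk]
    rcases h with h | h | h | h
    · exact ⟨8 * i - 8 * m - 3, by omega⟩
    · exact ⟨8 * i - 8 * m - 5, by omega⟩
    · exact ⟨8 * k - 16 * m - 3, by omega⟩
    · exact ⟨8 * k - 16 * m - 5, by omega⟩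
  rcases hij.lt_or_gt with a | a <;> rcases hik.lt_or_gt with b | b <;>
    rcases hjk.lt_or_gt with c | c
  · exact key a c hi.1 hk.2 h
  · obtain ⟨s, h1, h2, h3⟩ := key b c hi.1 hj.2 (by omega)
    exact ⟨s, h2, h1, h3.symm⟩
  · omega
  · obtain ⟨s, h1, h2, h3⟩ := key b a hk.1 hj.2 (by omega)
    exact ⟨s, h3, h1.symm, h2.symm⟩
  · obtain ⟨s, h1, h2, h3⟩ := key a b hj.1 hk.2 (by omega)
    exact ⟨s, h1.symm, h3, h2⟩
  · omega
  · obtain ⟨s, h1, h2, h3⟩ := key c b hj.1 hi.2 (by omega)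
    exact ⟨s, h2.symm, h3.symm, h1⟩
  · obtain ⟨s, h1, h2, h3⟩ := key c a hk.1 hi.2 (by omega)
    exact ⟨s, h3.symm, h2.symm, h1.symm⟩

/-- Given two lines, the third line making the sum of the three indices congruent to `0`, or to
`1`, completes them to a triple, up to few coincidences; every triple is obtained six times. -/
theorem le_ncard_triples (hm : 2 ≤ m) : m * m ≤ 3 * (layout m).triples.ncard + 3 * m := by
  have hm0 : (0 : ℤ) < m := by omega
  let I : Finset ℤ := Finset.Ico 0 (m : ℤ)
  have hI : I.card = m := by simp [I]
  let C : Finset ℤ := {0, 1}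
  have hC : C.card = 2 := by simp [C]
  let third : ℤ × ℤ × ℤ → ℤ := fun t => (t.1 - t.2.1 - t.2.2) % m
  have hthird : ∀ t, 0 ≤ third t ∧ third t < m := fun t =>
    ⟨Int.emod_nonneg _ hm0.ne', Int.emod_lt_of_pos _ hm0⟩
  let S : Finset (ℤ × ℤ × ℤ) := (C ×ˢ I ×ˢ I).filter fun t =>
    t.2.1 ≠ t.2.2 ∧ t.2.1 ≠ third t ∧ t.2.2 ≠ third t
  let f : ℤ × ℤ × ℤ → Finset ℤ := fun t => {t.2.1, t.2.2, third t}
  -- pairs with a coincidence among the three lines are few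
  have hS : 2 * m * m ≤ S.card + 6 * m := by
    let E1 : Finset (ℤ × ℤ × ℤ) := (C ×ˢ I).image fun t => (t.1, t.2, t.2)
    let E2 : Finset (ℤ × ℤ × ℤ) := (C ×ˢ I).image fun t => (t.1, t.2, (t.1 - 2 * t.2) % m)
    let E3 : Finset (ℤ × ℤ × ℤ) := (C ×ˢ I).image fun t => (t.1, (t.1 - 2 * t.2) % m, t.2)
    have c0 : (C ×ˢ I).card = 2 * m := by rw [Finset.card_product, hC, hI]
    have c1 : E1.card ≤ 2 * m := Finset.card_image_le.trans_eq c0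
    have c2 : E2.card ≤ 2 * m := Finset.card_image_le.trans_eq c0
    have c3 : E3.card ≤ 2 * m := Finset.card_image_le.trans_eq c0
    have hsub : C ×ˢ I ×ˢ I ⊆ S ∪ (E1 ∪ (E2 ∪ E3)) := by
      rintro ⟨c, i, j⟩ ht
      have ht' := ht
      simp only [Finset.mem_product, I, Finset.mem_Ico] at ht'
      obtain ⟨hc, hi, hj⟩ := ht'
      by_cases h1 : i = j
      · refine Finset.mem_union_right _ (Finset.mem_union_left _ (Finset.mem_image.2 ⟨(c, i), ?_⟩))
        simp only [Finset.mem_product, I, Finset.mem_Ico, h1, and_true]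
        exact ⟨hc, hj⟩
      have hmod : ∀ i j : ℤ, 0 ≤ j ∧ j < m → i = (c - i - j) % m → (c - 2 * i) % m = j := by
        intro i j hj h
        have h3 := Int.emod_add_mul_ediv (c - i - j) m
        rw [← h] at h3
        have h4 : c - 2 * i = j + m * ((c - i - j) / m) := by linarith
        rw [h4, Int.add_mul_emod_self_left, Int.emod_eq_of_lt hj.1 hj.2]
      by_cases h2 : i = third (c, i, j)
      · refine Finset.mem_union_right _ (Finset.mem_union_right _ (Finset.mem_union_left _
          (Finset.mem_image.2 ⟨(c, i), ?_⟩)))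
        simp only [Finset.mem_product, I, Finset.mem_Ico]
        refine ⟨⟨hc, hi⟩, ?_⟩
        rw [hmod i j hj h2]
      by_cases h3 : j = third (c, i, j)
      · refine Finset.mem_union_right _ (Finset.mem_union_right _ (Finset.mem_union_right _
          (Finset.mem_image.2 ⟨(c, j), ?_⟩)))
        simp only [Finset.mem_product, I, Finset.mem_Ico]
        refine ⟨⟨hc, hj⟩, ?_⟩
        rw [hmod j i hi (by rw [sub_right_comm]; exact h3)]
      · exact Finset.mem_union_left _ (Finset.mem_filter.2 ⟨ht, h1, h2, h3⟩)
    have := Finset.card_le_card hsub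
    have u1 := Finset.card_union_le S (E1 ∪ (E2 ∪ E3))
    have u2 := Finset.card_union_le E1 (E2 ∪ E3)
    have u3 := Finset.card_union_le E2 E3
    have c4 : (C ×ˢ I ×ˢ I).card = 2 * m * m := by
      rw [Finset.card_product, Finset.card_product, hC, hI]; ring
    omega
  -- every set of three lines comes from at most six pairs
  have hfib : S.card ≤ 6 * (S.image f).card := by
    refine Finset.card_le_mul_card_image S 6 fun τ hτ => ?_
    obtain ⟨t, ht, rfl⟩ := Finset.mem_image.1 hτ
    have hcard : (f t).card = 3 := by
      obtain ⟨-, h1, h2, h3⟩ := Finset.mem_filter.1 ht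
      exact Finset.card_eq_three.2 ⟨_, _, _, h1, h2, h3, rfl⟩
    have : (f t).offDiag.card = 6 := by rw [Finset.offDiag_card, hcard]
    rw [← this]
    refine Finset.card_le_card_of_injOn (fun t => t.2) ?_ ?_
    · intro t' ht'
      simp only [Finset.coe_filter, Set.mem_ofPred_eq] at ht'
      obtain ⟨h1, h2⟩ := ht'
      rw [← h2]
      simp only [Finset.mem_coe, Finset.mem_offDiag]
      exact ⟨by simp [f], by simp [f], (Finset.mem_filter.1 h1).2.1⟩
    · rintro ⟨c, i, j⟩ h1 ⟨c', i', j'⟩ h2 h3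
      simp only [Finset.coe_filter, Set.mem_ofPred_eq] at h1 h2
      simp only [Prod.mk.injEq] at h3
      obtain ⟨rfl, rfl⟩ := h3
      have e : f (c, i, j) = f (c', i, j) := h1.2.trans h2.2.symm
      obtain ⟨m1, -, n1, n2⟩ := Finset.mem_filter.1 h1.1
      obtain ⟨m2, -⟩ := Finset.mem_filter.1 h2.1
      have : third (c, i, j) ∈ f (c', i, j) := by rw [← e]; simp [f]
      simp only [f, Finset.mem_insert, Finset.mem_singleton] at this
      have h4 : third (c, i, j) = third (c', i, j) := by
        rcases this with h | h | h
        · exact absurd h.symm n1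
        · exact absurd h.symm n2
        · exact h
      have h6 : (m : ℤ) ∣ c - c' := by
        have := Int.emod_eq_emod_iff_emod_sub_eq_zero.1 h4
        have := Int.dvd_of_emod_eq_zero this
        convert this using 1
        simp only; ring
      simp only [Finset.mem_product, C, Finset.mem_insert, Finset.mem_singleton] at m1 m2
      have h7 : c - c' = 0 := by
        refine Int.eq_zero_of_abs_lt_dvd h6 ?_
        rw [abs_lt]
        omega
      rw [sub_eq_zero.1 h7]
  have himg : (S.image f).card ≤ (layout m).triples.ncard := by
    rw [← Set.ncard_coe_finset]
    refine Set.ncard_le_ncard ?_ (layout m).triples_finite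
    intro τ hτ
    obtain ⟨⟨c, i, j⟩, ht, rfl⟩ := Finset.mem_image.1 (Finset.mem_coe.1 hτ)
    obtain ⟨m1, h1, h2, h3⟩ := Finset.mem_filter.1 ht
    simp only [Finset.mem_product, I, C, Finset.mem_Ico, Finset.mem_insert,
      Finset.mem_singleton] at m1
    obtain ⟨k, hk⟩ : ∃ k, third (c, i, j) = k := ⟨_, rfl⟩
    have hk' := hthird (c, i, j)
    have hf : f (c, i, j) = {i, j, k} := by simp only [f, hk]
    rw [hf]
    rw [hk] at h2 h3 hk'
    obtain ⟨q, hq⟩ : ∃ q : ℤ, i + j + k = c + m * q := by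
      have := Int.emod_add_mul_ediv (c - i - j) m
      change third (c, i, j) + _ = _ at this
      exact ⟨-((c - i - j) / m), by rw [mul_neg]; omega⟩
    simp only at h1 h2 h3
    have hq0 : 0 < q := by
      by_contra h
      have : m * q ≤ 0 := mul_nonpos_of_nonneg_of_nonpos hm0.le (by omega)
      omega
    have hq3 : q < 3 := by
      by_contra h
      have : (m : ℤ) * 3 ≤ m * q := mul_le_mul_of_nonneg_left (by omega) hm0.le
      omega
    obtain ⟨s, n1, n2, n3⟩ := exists_three_near m1.2.1 m1.2.2 hk' h1 h2 h3 (by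
      have : q = 1 ∨ q = 2 := by omega
      rcases this with rfl | rfl <;> omega)
    exact Layout.mem_triples h1 h2 h3 n1 n2 n3
  have h6 : 2 * (m * m) = 2 * m * m := by ring
  omega

end Deltoid

/-! ### The doubling step -/

namespace Doubling
open Layout

/-- The slots of the two feet of line `v` among the lines `0, …, n`. -/
def FootAt (n s v : ℤ) : Prop :=
  (-4 * v - 5 ≤ s ∧ s ≤ -4 * v - 3) ∨ (4 * (n - v) + 3 ≤ s ∧ s ≤ 4 * (n - v) + 5)

/-- The slots between the two feet of line `v` among the lines `0, …, n`. -/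
def InRange (n s v : ℤ) : Prop := -4 * v - 5 ≤ s ∧ s ≤ 4 * (n - v) + 5

instance (n s v : ℤ) : Decidable (FootAt n s v) := by unfold FootAt; infer_instance
instance (n s v : ℤ) : Decidable (InRange n s v) := by unfold InRange; infer_instance

/-- The monotone map from the slots of the doubled layout to those of the given one. A gap of one
slot between two consecutive feet is the image of five slots, which make room for the foot of a new
line. -/
def psi (s : ℤ) : ℤ :=
  if (s + 2) % 8 ≤ 4 then
    (if 1 ≤ (s + 2) / 8 then 4 * ((s + 2) / 8) + 2 else
      if (s + 2) / 8 = 0 then s else 4 * ((s + 2) / 8) - 2)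
  else (if 0 ≤ (s + 2) / 8 then s - 4 * ((s + 2) / 8) else s - 4 * ((s + 2) / 8) - 4)

/-- The signed distance of the slot `s` from the apex of the new line `2 * b + 1`. -/
def offset (n b s : ℤ) : ℤ := s - 8 * n + 8 + 16 * b

/-- The old line that the spike on top of the new line `2 * b + 1` reaches. -/
def reached (n b : ℤ) : ℤ := if 2 * b + 1 ≤ n then 2 * b + 1 else 2 * b + 1 - n

/-- The old line whose foot meets both the spike on top of the new line `2 * b + 1` and the old
line reached by this spike. -/
def crossed (n b : ℤ) : ℤ :=
  if 2 * b + 1 < n then 2 * b + 2 else if 2 * b + 1 = n then 0 else 2 * b - n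

/-- The side of the spike on which it meets the line `crossed n b`. -/
def side (n b : ℤ) : ℤ := if 2 * b + 1 ≤ n then -1 else 1

theorem psi_foot {n s a : ℤ} (h0 : 0 ≤ a) (h1 : a ≤ n) :
    FootAt n (psi s) a ↔ FootAt (2 * n) s (2 * a) := by
  unfold FootAt psi
  split_ifs <;> omega

theorem psi_range {n s a : ℤ} (h0 : 0 ≤ a) (h1 : a ≤ n) :
    InRange n (psi s) a ↔ InRange (2 * n) s (2 * a) := by
  unfold InRange psi
  split_ifs <;> omega

theorem psi_succ (s : ℤ) : psi (s + 1) = psi s ∨ psi (s + 1) = psi s + 1 := by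
  unfold psi
  split_ifs <;> omega

theorem psi_mono {s t : ℤ} (h : s ≤ t) : psi s ≤ psi t := by
  unfold psi
  split_ifs <;> omega

theorem psi_surjective (t : ℤ) : ∃ s, psi s = t := by
  obtain ⟨U, e, rfl, h1, h2⟩ : ∃ U e : ℤ, t = 4 * U + e ∧ -1 ≤ e ∧ e ≤ 2 :=
    ⟨(t + 1) / 4, (t + 1) % 4 - 1, by omega, by omega, by omega⟩
  unfold psi
  rcases lt_trichotomy U 0 with h | h | h
  · by_cases he : e = 2
    · by_cases hU : U = -1
      · exact ⟨-2, by subst he hU; decide⟩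
      · exact ⟨8 * (U + 1), by split_ifs <;> omega⟩
    · exact ⟨8 * U + 4 + e, by split_ifs <;> omega⟩
  · exact ⟨e, by split_ifs <;> omega⟩
  · by_cases he : e = 2
    · exact ⟨8 * U, by split_ifs <;> omega⟩
    · exact ⟨8 * (U - 1) + 4 + e, by split_ifs <;> omega⟩

theorem psi_odd {s : ℤ} (h : psi s % 2 = 1) : s % 2 = 1 ∧ s % 4 = psi s % 4 ∧
    psi (s + 1) = psi s + 1 ∧ psi (s - 1) = psi s - 1 := by
  unfold psi at *
  split_ifs at * <;> omega

theorem psi_inj {s t : ℤ} (h : psi s % 2 = 1) (hst : psi s = psi t) : s = t := by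
  unfold psi at *
  split_ifs at * <;> omega

theorem psi_dir {s : ℤ} (h : psi s % 2 = 1) : dir (psi s) = dir s ∧
    psi (s + dir s) = psi s + dir s ∧ psi (s - dir s) = psi s - dir s := by
  obtain ⟨-, h1, h2, h3⟩ := psi_odd h
  refine ⟨by unfold dir; rw [h1], ?_⟩
  rcases dir_eq s with h' | h' <;> rw [h']
  · exact ⟨h2, h3⟩
  · exact ⟨h3, by rw [sub_neg_eq_add]; exact h2⟩

/-- A stage of the doubling construction: a good layout of `n + 1` lines with feet at prescribed
slots, all bounded below by `0`, which is the level of the feet, together with heights `top b` for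
the spikes of the `n` lines to be added. After stretching along `psi`, the spike of the line
`2 * b + 1` meets `reached n b` all along, the foot of `crossed n b` at one end, and no other line
away from its feet. -/
structure Stage (n : ℕ) (L : Layout (n + 1)) (top : ℤ → ℤ) : Prop where
  good : L.Good
  foot_iff : ∀ {s v}, L.foot s v ↔ (0 ≤ v ∧ v ≤ n) ∧ FootAt n s v
  pres_iff : ∀ {s i}, L.Pres s i ↔ (0 ≤ i ∧ i ≤ n) ∧ InRange n s i
  /-- Feet begin at level `0`, below everything else. -/
  lo_foot : ∀ {s v : ℤ}, 0 ≤ v → v ≤ n → FootAt n s v → L.lo s v = 0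
  lo_pos : ∀ {s i}, L.Pres s i → ¬ FootAt n s i → 1 ≤ L.lo s i
  /-- The height of a line does not decrease towards the middle of a foot. The condition is only
  needed at odd slots, where triples may occur. -/
  hi_in : ∀ {s v : ℤ}, 0 ≤ v → v ≤ n → FootAt n s v → s % 2 = 1 →
    L.hi s v ≤ L.hi (s + dir s) v
  hi_out : ∀ {s v : ℤ}, 0 ≤ v → v ≤ n → FootAt n s v → s % 2 = 1 → L.Pres (s - dir s) v →
    L.hi (s - dir s) v ≤ L.hi s v
  /-- The spike ends inside the line it reaches, at the slots around its own. -/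
  top_lt_hi : ∀ {b t : ℤ}, 0 ≤ b → b < n → -4 ≤ offset n b t → offset n b t ≤ 4 →
    top b < L.hi (psi t) (reached n b)
  lo_lt_top : ∀ {b t : ℤ}, 0 ≤ b → b < n → -3 ≤ offset n b t → offset n b t ≤ 3 →
    L.lo (psi t) (reached n b) < top b
  /-- The spike meets no other line away from the foot of this line. -/
  top_le_lo : ∀ {b t x : ℤ}, 0 ≤ b → b < n → -3 ≤ offset n b t → offset n b t ≤ 3 →
    x ≠ reached n b → L.Pres (psi t) x → ¬ FootAt n (psi t) x → top b ≤ L.lo (psi t) x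
  /-- The crossed line meets the reached line at the far end of the spike only, and together with
  the spike they fulfil the conditions on triples there. -/
  not_near_out : ∀ {b t : ℤ}, 0 ≤ b → b < n → offset n b t = 2 * side n b →
    ¬ L.Near (psi t) (crossed n b) (reached n b)
  hi_le : ∀ {b t : ℤ}, 0 ≤ b → b < n → offset n b t = 3 * side n b →
    L.hi (psi t) (reached n b) ≤ L.hi (psi t) (crossed n b)
  not_near : ∀ {b t x : ℤ}, 0 ≤ b → b < n → offset n b t = 3 * side n b → x ≠ crossed n b →
    x ≠ reached n b → ¬ L.Near (psi t) (reached n b) x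

/-- The layout of `2 * n + 1` lines obtained from a layout of `n + 1` lines. The old line `a`
becomes the line `2 * a`, stretched along `psi` and lifted except at its feet; the new line
`2 * b + 1` descends on both sides of its apex, and has a spike on top, up to height `top b`. -/
def next {n : ℕ} (L : Layout (n + 1)) (top : ℤ → ℤ) : Layout (2 * n + 1) where
  lo s i :=
    if InRange (2 * n) s i then
      if FootAt (2 * n) s i then 0
      else if i % 2 = 0 then L.lo (psi s) (i / 2) + (2 * n + 5)
      else 2 * n + 4 - tubeHi |offset n (i / 2) s|
    else 0
  hi s i :=
    if InRange (2 * n) s i then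
      if i % 2 = 0 then L.hi (psi s) (i / 2) + (2 * n + 5)
      else if -3 ≤ offset n (i / 2) s ∧ offset n (i / 2) s ≤ 3 then top (i / 2) + (2 * n + 5)
      else 2 * n + 4 - tubeLo |offset n (i / 2) s|
    else 0
  foot s v := (0 ≤ v ∧ v ≤ 2 * n) ∧ FootAt (2 * n) s v

section
variable {n : ℕ} {L : Layout (n + 1)} {top : ℤ → ℤ} (h : Stage n L top)

theorem lo_even {s a : ℤ} (hr : InRange (2 * n) s (2 * a)) (hf : ¬ FootAt (2 * n) s (2 * a)) :
    (next L top).lo s (2 * a) = L.lo (psi s) a + (2 * n + 5) := by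
  simp [next, hr, hf]

theorem hi_even {s a : ℤ} (hr : InRange (2 * n) s (2 * a)) :
    (next L top).hi s (2 * a) = L.hi (psi s) a + (2 * n + 5) := by
  simp [next, hr]

theorem lo_of_foot {s i : ℤ} (hf : FootAt (2 * n) s i) : (next L top).lo s i = 0 := by
  simp [next, hf]

theorem lo_odd {s b : ℤ} (hr : InRange (2 * n) s (2 * b + 1))
    (hf : ¬ FootAt (2 * n) s (2 * b + 1)) :
    (next L top).lo s (2 * b + 1) = 2 * n + 4 - tubeHi |offset n b s| := by
  have h1 : (2 * b + 1) % 2 = 1 := by omega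
  have h2 : (2 * b + 1) / 2 = b := by omega
  simp [next, hr, hf, h2]

theorem hi_odd {s b : ℤ} (hr : InRange (2 * n) s (2 * b + 1))
    (hd : ¬ (-3 ≤ offset n b s ∧ offset n b s ≤ 3)) :
    (next L top).hi s (2 * b + 1) = 2 * n + 4 - tubeLo |offset n b s| := by
  have h1 : (2 * b + 1) % 2 = 1 := by omega
  have h2 : (2 * b + 1) / 2 = b := by omega
  simp [next, hr, h2, hd]

theorem hi_spike {s b : ℤ} (h0 : 0 ≤ b) (hb : b < n) (h1 : -3 ≤ offset n b s)
    (h2 : offset n b s ≤ 3) : (next L top).hi s (2 * b + 1) = top b + (2 * n + 5) := by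
  have hr : InRange (2 * n) s (2 * b + 1) := by unfold offset at *; unfold InRange; omega
  have h3 : (2 * b + 1) % 2 = 1 := by omega
  have h4 : (2 * b + 1) / 2 = b := by omega
  simp [next, hr, h4, h1, h2]

theorem inRange_of_foot {m s v : ℤ} (hm : 0 ≤ m) (hf : FootAt m s v) : InRange m s v := by
  unfold FootAt InRange at *
  omega

theorem tube_bounds (x : ℤ) : -2 ≤ tubeLo |x| ∧ 2 ≤ tubeHi |x| ∧ tubeLo |x| < tubeHi |x| := by
  unfold tubeLo tubeHi
  have := abs_nonneg x
  omega

theorem reached_range {b : ℤ} (h0 : 0 ≤ b) (hb : b < n) : 0 ≤ reached n b ∧ reached n b ≤ n := by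
  unfold reached
  split_ifs <;> omega

theorem crossed_range {b : ℤ} (h0 : 0 ≤ b) (hb : b < n) : 0 ≤ crossed n b ∧ crossed n b ≤ n := by
  unfold crossed
  split_ifs <;> omega

include h

theorem Stage.top_pos {b : ℤ} (h0 : 0 ≤ b) (hb : b < n) : 1 ≤ top b := by
  have hd : offset n b (8 * n - 8 - 16 * b) = 0 := by unfold offset; ring
  have h1 := h.lo_lt_top h0 hb (t := 8 * n - 8 - 16 * b) (by omega) (by omega)
  have hr := reached_range h0 hb
  have h2 : L.Pres (psi (8 * n - 8 - 16 * b)) (reached n b) := by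
    rw [h.pres_iff, psi_range hr.1 hr.2]
    refine ⟨hr, ?_⟩
    unfold InRange reached
    split_ifs <;> omega
  by_cases hf : FootAt n (psi (8 * n - 8 - 16 * b)) (reached n b)
  · have := h.lo_foot hr.1 hr.2 hf
    omega
  · have := h.lo_pos h2 hf
    omega

/-- The bounds on a lifted old line. -/
theorem Stage.even_le {s a : ℤ} (h0 : 0 ≤ a) (ha : a ≤ n) (hr : InRange (2 * n) s (2 * a)) :
    0 ≤ L.lo (psi s) a ∧ L.lo (psi s) a < L.hi (psi s) a ∧
      0 ≤ (next L top).lo s (2 * a) ∧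
      (next L top).lo s (2 * a) ≤ L.lo (psi s) a + (2 * n + 5) ∧
      (next L top).hi s (2 * a) = L.hi (psi s) a + (2 * n + 5) ∧
      ((FootAt (2 * n) s (2 * a) ∧ (next L top).lo s (2 * a) = 0 ∧ L.lo (psi s) a = 0) ∨
        (¬ FootAt (2 * n) s (2 * a) ∧ 1 ≤ L.lo (psi s) a ∧
          (next L top).lo s (2 * a) = L.lo (psi s) a + (2 * n + 5))) := by
  have hp : L.Pres (psi s) a := h.pres_iff.2 ⟨⟨h0, ha⟩, (psi_range h0 ha).2 hr⟩
  have h1 := hp.2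
  rw [hi_even hr]
  by_cases hf : FootAt (2 * n) s (2 * a)
  · have hl := h.lo_foot h0 ha ((psi_foot h0 ha).2 hf)
    have := lo_of_foot (L := L) (top := top) hf
    refine ⟨by omega, h1, by omega, by omega, rfl, Or.inl ⟨hf, this, hl⟩⟩
  · have hl := h.lo_pos hp (by rwa [psi_foot h0 ha])
    have := lo_even (L := L) (top := top) hr hf
    refine ⟨by omega, h1, by omega, by omega, rfl, Or.inr ⟨hf, hl, this⟩⟩

/-- The bounds on a new line. -/
theorem Stage.odd_le {s b : ℤ} (h0 : 0 ≤ b) (hb : b < n) (hr : InRange (2 * n) s (2 * b + 1)) :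
    0 ≤ (next L top).lo s (2 * b + 1) ∧
      (next L top).lo s (2 * b + 1) ≤ 2 * n + 4 - tubeHi |offset n b s| ∧
      2 * n + 4 - tubeLo |offset n b s| ≤ (next L top).hi s (2 * b + 1) ∧
      4 ≤ (next L top).hi s (2 * b + 1) ∧
      ((FootAt (2 * n) s (2 * b + 1) ∧ (next L top).lo s (2 * b + 1) = 0) ∨
        (¬ FootAt (2 * n) s (2 * b + 1) ∧ 1 ≤ (next L top).lo s (2 * b + 1) ∧
          (next L top).lo s (2 * b + 1) = 2 * n + 4 - tubeHi |offset n b s|)) ∧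
      ((-3 ≤ offset n b s ∧ offset n b s ≤ 3 ∧ (next L top).hi s (2 * b + 1) = top b + (2 * n + 5)) ∨
        (¬ (-3 ≤ offset n b s ∧ offset n b s ≤ 3) ∧
          (next L top).hi s (2 * b + 1) = 2 * n + 4 - tubeLo |offset n b s|)) := by
  have ht := tube_bounds (offset n b s)
  have htop := h.top_pos h0 hb
  have hlow : tubeHi |offset n b s| ≤ 2 * n + 3 ∧ tubeLo |offset n b s| ≤ 2 * n := by
    unfold InRange at hr
    have : |offset n b s| ≤ 8 * n + 1 := by
      rw [abs_le]
      unfold offset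
      omega
    have := abs_nonneg (offset n b s)
    unfold tubeHi tubeLo
    omega
  have hl : (FootAt (2 * n) s (2 * b + 1) ∧ (next L top).lo s (2 * b + 1) = 0) ∨
        (¬ FootAt (2 * n) s (2 * b + 1) ∧
          (next L top).lo s (2 * b + 1) = 2 * n + 4 - tubeHi |offset n b s|) := by
    by_cases hf : FootAt (2 * n) s (2 * b + 1)
    · exact Or.inl ⟨hf, lo_of_foot hf⟩
    · exact Or.inr ⟨hf, lo_odd hr hf⟩
  have hh : (-3 ≤ offset n b s ∧ offset n b s ≤ 3 ∧
        (next L top).hi s (2 * b + 1) = top b + (2 * n + 5)) ∨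
        (¬ (-3 ≤ offset n b s ∧ offset n b s ≤ 3) ∧
          (next L top).hi s (2 * b + 1) = 2 * n + 4 - tubeLo |offset n b s|) := by
    by_cases hd : -3 ≤ offset n b s ∧ offset n b s ≤ 3
    · exact Or.inl ⟨hd.1, hd.2, hi_spike h0 hb hd.1 hd.2⟩
    · exact Or.inr ⟨hd, hi_odd hr hd⟩
  refine ⟨by omega, by omega, by omega, by omega, ?_, hh⟩
  rcases hl with hl | hl
  · exact Or.inl hl
  · exact Or.inr ⟨hl.1, by omega, hl.2⟩

end

/-! ### The meetings of lines after a doubling step -/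

section
variable {n : ℕ} {L : Layout (n + 1)} {top : ℤ → ℤ} (h : Stage n L top)

theorem psi_odd_of_foot {m s a : ℤ} (hf : FootAt (2 * m) s (2 * a)) (hs : s % 2 = 1) :
    psi s % 2 = 1 := by
  unfold FootAt psi at *
  split_ifs <;> omega

theorem eq_of_footAt {m s v w : ℤ} (hv : 0 ≤ v ∧ v ≤ m) (hw : 0 ≤ w ∧ w ≤ m)
    (h1 : FootAt m s v) (h2 : FootAt m s w) : v = w := by
  unfold FootAt at h1 h2
  omega

theorem tube_le_of_le {x y : ℤ} (hxy : |x| + 14 ≤ |y|) : tubeHi |x| ≤ tubeLo |y| := by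
  have := abs_nonneg x
  unfold tubeHi tubeLo
  omega

theorem tube_le_of_spike {x y : ℤ} (h1 : -3 ≤ x) (h2 : x ≤ 3) (hy : y ≤ -13 ∨ 13 ≤ y) :
    tubeHi |x| ≤ tubeLo |y| := by
  unfold tubeHi tubeLo
  rcases abs_cases x with ⟨e1, f1⟩ | ⟨e1, f1⟩ <;> rw [e1] <;>
  rcases abs_cases y with ⟨e2, f2⟩ | ⟨e2, f2⟩ <;> rw [e2] <;> omega

include h

theorem Stage.pres_next {s i : ℤ} :
    (next L top).Pres s i ↔ (0 ≤ i ∧ i ≤ 2 * n) ∧ InRange (2 * n) s i := by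
  constructor
  · rintro ⟨⟨h0, h1⟩, h2⟩
    push_cast at h1
    refine ⟨⟨h0, by omega⟩, ?_⟩
    by_contra hr
    simp [next, hr] at h2
  · rintro ⟨⟨h0, h1⟩, hr⟩
    refine ⟨⟨h0, by push_cast; omega⟩, ?_⟩
    obtain ⟨a, rfl | rfl⟩ := Int.even_or_odd' i
    · have := h.even_le (by omega) (by omega) hr
      omega
    · have := h.odd_le (b := a) (by omega) (by omega) hr
      have := tube_bounds (offset n a s)
      omega

/-- Old lines meet as before. -/
theorem Stage.near_even_even {s a c : ℤ} :
    (next L top).Near s (2 * a) (2 * c) ↔ L.Near (psi s) a c := by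
  have key : ∀ {a}, (next L top).Pres s (2 * a) ↔ L.Pres (psi s) a := by
    intro a
    rw [h.pres_next, h.pres_iff]
    constructor
    · rintro ⟨h1, h2⟩
      exact ⟨by omega, (psi_range (by omega) (by omega)).2 h2⟩
    · rintro ⟨h1, h2⟩
      exact ⟨by omega, (psi_range (by omega) (by omega)).1 h2⟩
  unfold Near
  rw [key, key]
  refine and_congr_right fun h1 => and_congr_right fun h2 => ?_
  have e1 := (h.pres_next.1 (key.2 h1))
  have e2 := (h.pres_next.1 (key.2 h2))
  have := h.even_le (by omega) (by omega) e1.2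
  have := h.even_le (by omega) (by omega) e2.2
  omega

/-- New lines meet as their tubes do; their feet and spikes do not matter. -/
theorem Stage.near_odd_odd {s b c : ℤ} (hb : 0 ≤ b ∧ b < n) (hc : 0 ≤ c ∧ c < n) (hbc : b ≠ c) :
    (next L top).Near s (2 * b + 1) (2 * c + 1) ↔
      -3 ≤ s - 8 * n + 8 + 8 * (b + c) ∧ s - 8 * n + 8 + 8 * (b + c) ≤ 3 := by
  wlog hlt : b < c generalizing b c
  · rw [add_comm b c, ← this hc hb hbc.symm (by omega)]
    exact ⟨Near.symm, Near.symm⟩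
  have ht := tube_near (s := s - 8 * n + 8) hlt
  change (tubeLo |offset n b s| < tubeHi |offset n c s| ∧
    tubeLo |offset n c s| < tubeHi |offset n b s|) ↔ _ at ht
  unfold Near
  rw [h.pres_next, h.pres_next]
  constructor
  · rintro ⟨⟨-, h1⟩, ⟨-, h2⟩, h3, h4⟩
    have o1 := h.odd_le hb.1 hb.2 h1
    have o2 := h.odd_le hc.1 hc.2 h2
    rw [← ht]
    unfold InRange at h1 h2
    have hd : offset n c s = offset n b s + 16 * (c - b) := by unfold offset; ring
    rcases o1.2.2.2.2.1 with ⟨f1, g1⟩ | ⟨f1, g1, g1'⟩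
    · have : |offset n c s| + 14 ≤ |offset n b s| := by
        unfold FootAt at f1
        unfold offset at *
        rw [abs_of_neg (a := s - 8 * n + 8 + 16 * b) (by omega)]
        rcases abs_cases (s - 8 * n + 8 + 16 * c) with ⟨e, f⟩ | ⟨e, f⟩ <;> rw [e] <;> omega
      have := tube_le_of_le this
      unfold FootAt offset at *
      omega
    rcases o2.2.2.2.2.1 with ⟨f2, g2⟩ | ⟨f2, g2, g2'⟩
    · have : |offset n b s| + 14 ≤ |offset n c s| := by
        unfold FootAt at f2
        unfold offset at *
        rw [abs_of_pos (a := s - 8 * n + 8 + 16 * c) (by omega)]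
        rcases abs_cases (s - 8 * n + 8 + 16 * b) with ⟨e, f⟩ | ⟨e, f⟩ <;> rw [e] <;> omega
      have := tube_le_of_le this
      unfold FootAt offset at *
      omega
    rcases o1.2.2.2.2.2 with ⟨f1, f1', -⟩ | ⟨-, k1⟩
    · have := tube_le_of_spike (x := offset n b s) (y := offset n c s) (by omega) (by omega) (by omega)
      omega
    rcases o2.2.2.2.2.2 with ⟨f1, f1', -⟩ | ⟨-, k2⟩
    · have := tube_le_of_spike (x := offset n c s) (y := offset n b s) (by omega) (by omega) (by omega)
      omega
    omega
  · intro h1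
    have r1 : InRange (2 * n) s (2 * b + 1) := by unfold InRange; omega
    have r2 : InRange (2 * n) s (2 * c + 1) := by unfold InRange; omega
    have o1 := h.odd_le hb.1 hb.2 r1
    have o2 := h.odd_le hc.1 hc.2 r2
    have := ht.2 h1
    exact ⟨⟨by omega, r1⟩, ⟨by omega, r2⟩, by omega, by omega⟩

/-- A new line meets an old one at one of the feet of the latter, or with its spike. -/
theorem Stage.near_odd_even {s b a : ℤ} (hb : 0 ≤ b ∧ b < n) (ha : 0 ≤ a ∧ a ≤ n) :
    (next L top).Near s (2 * b + 1) (2 * a) ↔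
      (a ≤ b ∧ -8 * a - 5 ≤ s ∧ s ≤ -8 * a - 3) ∨
      (b < a ∧ 8 * n - 8 * a + 3 ≤ s ∧ s ≤ 8 * n - 8 * a + 5) ∨
      (a = reached n b ∧ -3 ≤ offset n b s ∧ offset n b s ≤ 3) := by
  unfold Near
  rw [h.pres_next, h.pres_next]
  by_cases hf : FootAt (2 * n) s (2 * a)
  · have r2 : InRange (2 * n) s (2 * a) := inRange_of_foot (by omega) hf
    have e2 := h.even_le ha.1 ha.2 r2
    have e3 := lo_of_foot (L := L) (top := top) hf
    constructor
    · rintro ⟨⟨-, h1⟩, -⟩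
      unfold FootAt InRange at *
      omega
    · intro h1
      have r1 : InRange (2 * n) s (2 * b + 1) := by
        unfold FootAt InRange at *
        unfold offset at h1
        omega
      have o1 := h.odd_le hb.1 hb.2 r1
      have := tube_bounds (offset n b s)
      exact ⟨⟨by omega, r1⟩, ⟨by omega, r2⟩, by omega, by omega⟩
  · constructor
    · rintro ⟨⟨-, h1⟩, ⟨-, h2⟩, h3, h4⟩
      have e2 := h.even_le ha.1 ha.2 h2
      have e3 := e2.2.2.2.2.2.resolve_left fun k => hf k.1
      have o1 := h.odd_le hb.1 hb.2 h1
      have := tube_bounds (offset n b s)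
      have hd : -3 ≤ offset n b s ∧ offset n b s ≤ 3 := by
        by_contra hd
        omega
      refine Or.inr (Or.inr ⟨?_, hd⟩)
      by_contra hne
      have := h.top_le_lo hb.1 hb.2 hd.1 hd.2 hne
        (h.pres_iff.2 ⟨ha, (psi_range ha.1 ha.2).2 h2⟩) (by rwa [psi_foot ha.1 ha.2])
      have := o1.2.2.2.2.2
      omega
    · intro h1
      have h1' : a = reached n b ∧ -3 ≤ offset n b s ∧ offset n b s ≤ 3 := by
        unfold FootAt at hf
        omega
      obtain ⟨rfl, h2, h3⟩ := h1'
      have r1 : InRange (2 * n) s (2 * b + 1) := by unfold InRange; unfold offset at *; omega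
      have r2 : InRange (2 * n) s (2 * reached n b) := by
        unfold InRange reached
        unfold offset at *
        split_ifs <;> omega
      have e2 := h.even_le ha.1 ha.2 r2
      have e3 := e2.2.2.2.2.2.resolve_left fun k => hf k.1
      have o1 := h.odd_le hb.1 hb.2 r1
      have := tube_bounds (offset n b s)
      have := h.lo_lt_top hb.1 hb.2 h2 h3
      exact ⟨⟨by omega, r1⟩, ⟨by omega, r2⟩, by omega, by omega⟩

end

/-! ### The triples of lines after a doubling step -/

section
variable {n : ℕ} {L : Layout (n + 1)} {top : ℤ → ℤ} (h : Stage n L top)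

theorem near_range {s i j : ℤ} (hn : (next L top).Near s i j) :
    (0 ≤ i ∧ i ≤ 2 * n) ∧ (0 ≤ j ∧ j ≤ 2 * n) := by
  have h1 := hn.1.1
  have h2 := hn.2.1.1
  push_cast at h1 h2
  omega

include h

/-- The foot of a new line meets no other line. -/
theorem Stage.not_near_of_foot_odd {s b j : ℤ} (hf : FootAt (2 * n) s (2 * b + 1))
    (hj : j ≠ 2 * b + 1) : ¬ (next L top).Near s (2 * b + 1) j := by
  intro hn
  have hr := near_range hn
  obtain ⟨a, rfl | rfl⟩ := Int.even_or_odd' j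
  · rw [h.near_odd_even (by omega) (by omega)] at hn
    unfold FootAt at hf
    unfold offset at hn
    omega
  · rw [h.near_odd_odd (by omega) (by omega) (by omega)] at hn
    unfold FootAt at hf
    omega

/-- Two new lines and an old one meet next to a crossing of the former at a foot of the latter. -/
theorem Stage.three_odd_odd_even {s b c a : ℤ} (hbc : b ≠ c)
    (h1 : (next L top).Near s (2 * b + 1) (2 * c + 1))
    (h2 : (next L top).Near s (2 * b + 1) (2 * a)) (h3 : (next L top).Near s (2 * c + 1) (2 * a)) :
    (s - 8 * n + 8 + 8 * (b + c) = 3 ∨ s - 8 * n + 8 + 8 * (b + c) = -3) ∧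
      ((a ≤ b ∧ a ≤ c ∧ -8 * a - 5 ≤ s ∧ s ≤ -8 * a - 3) ∨
      (b < a ∧ c < a ∧ 8 * n - 8 * a + 3 ≤ s ∧ s ≤ 8 * n - 8 * a + 5)) := by
  have hr1 := near_range h1
  have hr2 := near_range h2
  rw [h.near_odd_odd (by omega) (by omega) hbc] at h1
  rw [h.near_odd_even (by omega) (by omega)] at h2 h3
  unfold offset at *
  omega

/-- A new line and two old ones meet at an end of the spike. -/
theorem Stage.three_odd_even_even {s b a c : ℤ} (hac : a ≠ c)
    (h1 : (next L top).Near s (2 * b + 1) (2 * a))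
    (h2 : (next L top).Near s (2 * b + 1) (2 * c)) (h3 : (next L top).Near s (2 * a) (2 * c)) :
    offset n b s = 3 * side n b ∧ FootAt (2 * n) s (2 * crossed n b) ∧
      L.Near (psi s) (crossed n b) (reached n b) ∧
      ((a = crossed n b ∧ c = reached n b) ∨ (a = reached n b ∧ c = crossed n b)) := by
  wlog hf : FootAt (2 * n) s (2 * a) generalizing a c
  · have := this hac.symm h2 h1 h3.symm (by
      have hr1 := near_range h1
      have hr2 := near_range h2
      rw [h.near_odd_even (by omega) (by omega)] at h1 h2
      unfold FootAt at *
      omega)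
    exact ⟨this.1, this.2.1, this.2.2.1, this.2.2.2.symm.imp And.symm And.symm⟩
  have hr1 := near_range h1
  have hr2 := near_range h2
  rw [h.near_even_even] at h3
  rw [h.near_odd_even (by omega) (by omega)] at h1 h2
  have hd : c = reached n b ∧ -3 ≤ offset n b s ∧ offset n b s ≤ 3 := by
    unfold FootAt at hf
    omega
  obtain ⟨rfl, hd⟩ := hd
  have hd' : offset n b s = 3 * side n b := by
    unfold FootAt at hf
    unfold offset side reached at *
    split_ifs at * <;> omega
  have ha : a = crossed n b := by
    by_contra hne
    exact h.not_near (by omega) (by omega) hd' hne hac h3.symm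
  subst ha
  exact ⟨hd', hf, h3, Or.inl ⟨rfl, rfl⟩⟩

theorem Stage.three_odd {s b c d : ℤ} (hbc : b ≠ c) (hbd : b ≠ d) (hcd : c ≠ d)
    (h1 : (next L top).Near s (2 * b + 1) (2 * c + 1))
    (h2 : (next L top).Near s (2 * b + 1) (2 * d + 1)) : False := by
  have hr1 := near_range h1
  have hr2 := near_range h2
  rw [h.near_odd_odd (by omega) (by omega) (by omega)] at h1 h2
  omega

/-- The triples of lines that meet at a foot are those of the old lines, two new lines and a foot,
and the spike of a new line with the lines `crossed` and `reached`. -/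
theorem Stage.foot_cases {s v l u : ℤ} (hf : (next L top).foot s v) (hvl : v ≠ l) (hvu : v ≠ u)
    (hlu : l ≠ u) (h1 : (next L top).Near s v l) (h2 : (next L top).Near s v u)
    (h3 : (next L top).Near s l u) :
    ∃ a : ℤ, v = 2 * a ∧ (0 ≤ a ∧ a ≤ n) ∧ FootAt (2 * n) s (2 * a) ∧
      ((∃ c d : ℤ, l = 2 * c ∧ u = 2 * d ∧ L.Near (psi s) a c ∧ L.Near (psi s) a d ∧
          L.Near (psi s) c d) ∨
        (∃ b c : ℤ, l = 2 * b + 1 ∧ u = 2 * c + 1 ∧ b ≠ c ∧ (0 ≤ b ∧ b < n) ∧ (0 ≤ c ∧ c < n) ∧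
          ((a ≤ b ∧ a ≤ c) ∨ (b < a ∧ c < a)) ∧
          (s - 8 * n + 8 + 8 * (b + c) = 3 ∨ s - 8 * n + 8 + 8 * (b + c) = -3)) ∨
        (∃ b : ℤ, (0 ≤ b ∧ b < n) ∧ a = crossed n b ∧ offset n b s = 3 * side n b ∧
          L.Near (psi s) (crossed n b) (reached n b) ∧
          ((l = 2 * b + 1 ∧ u = 2 * reached n b) ∨ (u = 2 * b + 1 ∧ l = 2 * reached n b)))) := by
  have hr1 := near_range h1
  have hr2 := near_range h2
  obtain ⟨a, rfl | rfl⟩ := Int.even_or_odd' v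
  swap
  · exact absurd h1 (h.not_near_of_foot_odd hf.2 hvl.symm)
  refine ⟨a, rfl, by omega, hf.2, ?_⟩
  obtain ⟨b, rfl | rfl⟩ := Int.even_or_odd' l <;> obtain ⟨c, rfl | rfl⟩ := Int.even_or_odd' u
  · rw [h.near_even_even] at h1 h2 h3
    exact Or.inl ⟨b, c, rfl, rfl, h1, h2, h3⟩
  · have := h.three_odd_even_even (by omega) h2.symm h3.symm h1
    have hu := this.2.2.2
    have := eq_of_footAt (by omega) (by have := crossed_range (n := n) (b := c); omega)
      hf.2 this.2.1
    refine Or.inr (Or.inr ⟨c, by omega, by omega, by tauto, by tauto, Or.inr ⟨rfl, by omega⟩⟩)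
  · have := h.three_odd_even_even (by omega) h1.symm h3 h2
    have hu := this.2.2.2
    have := eq_of_footAt (by omega) (by have := crossed_range (n := n) (b := b); omega)
      hf.2 this.2.1
    refine Or.inr (Or.inr ⟨b, by omega, by omega, by tauto, by tauto, Or.inl ⟨rfl, by omega⟩⟩)
  · have := h.three_odd_odd_even (by omega) h3 h1.symm h2.symm
    exact Or.inr (Or.inl ⟨b, c, rfl, rfl, by omega, by omega, by omega, by omega, by omega⟩)

theorem Stage.trip_cases {s v l u : ℤ} (ht : (next L top).Trip s v l u) :
    ∃ a : ℤ, v = 2 * a ∧ (0 ≤ a ∧ a ≤ n) ∧ FootAt (2 * n) s (2 * a) ∧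
      ((∃ c d : ℤ, l = 2 * c ∧ u = 2 * d ∧ L.Trip (psi s) a c d) ∨
        (∃ b c : ℤ, l = 2 * b + 1 ∧ u = 2 * c + 1 ∧ b ≠ c ∧ (0 ≤ b ∧ b < n) ∧ (0 ≤ c ∧ c < n) ∧
          ((a ≤ b ∧ a ≤ c) ∨ (b < a ∧ c < a)) ∧
          (s - 8 * n + 8 + 8 * (b + c) = 3 ∨ s - 8 * n + 8 + 8 * (b + c) = -3) ∧
          tubeHi |offset n c s| < tubeHi |offset n b s|) ∨
        (∃ b : ℤ, (0 ≤ b ∧ b < n) ∧ a = crossed n b ∧ offset n b s = 3 * side n b ∧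
          L.Near (psi s) (crossed n b) (reached n b) ∧ l = 2 * b + 1 ∧ u = 2 * reached n b)) := by
  obtain ⟨hf, hvl, hvu, h1, h2, h3, h4⟩ := ht
  have hlu : l ≠ u := by
    rintro rfl
    omega
  obtain ⟨a, rfl, ha, hfa, hc⟩ := h.foot_cases hf hvl hvu hlu h1 h2 h3
  refine ⟨a, rfl, ha, hfa, ?_⟩
  rcases hc with ⟨c, d, rfl, rfl, k1, k2, k3⟩ | ⟨b, c, rfl, rfl, hbc, hb, hc, k1, k2⟩ |
    ⟨b, hb, rfl, k1, k2, k3⟩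
  · refine Or.inl ⟨c, d, rfl, rfl, ?_⟩
    have hr := near_range h3
    have nf : ∀ {x : ℤ}, (0 ≤ x ∧ x ≤ n) → a ≠ x → ¬ FootAt (2 * n) s (2 * x) := by
      intro x hx hax hfx
      exact hax (by have := eq_of_footAt (by omega) (by omega) hfa hfx; omega)
    have e1 := h.even_le (by omega) (by omega) ((h.pres_next).1 h3.1).2
    have e2 := h.even_le (by omega) (by omega) ((h.pres_next).1 h3.2.1).2
    have e3 := e1.2.2.2.2.2.resolve_left fun k => nf (by omega) (by omega) k.1
    have e4 := e2.2.2.2.2.2.resolve_left fun k => nf (by omega) (by omega) k.1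
    exact ⟨h.foot_iff.2 ⟨ha, (psi_foot ha.1 ha.2).2 hfa⟩, by omega, by omega, k1, k2, k3, by omega⟩
  · have nf : ∀ {x : ℤ}, (0 ≤ x ∧ x < n) → ¬ FootAt (2 * n) s (2 * x + 1) := by
      intro x hx hfx
      have := eq_of_footAt (by omega) (by omega) hfa hfx
      omega
    refine Or.inr (Or.inl ⟨b, c, rfl, rfl, hbc, hb, hc, k1, k2, ?_⟩)
    have o1 := h.odd_le hb.1 hb.2 ((h.pres_next).1 h3.1).2
    have o2 := h.odd_le hc.1 hc.2 ((h.pres_next).1 h3.2.1).2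
    have o3 := o1.2.2.2.2.1.resolve_left fun k => nf hb k.1
    have o4 := o2.2.2.2.2.1.resolve_left fun k => nf hc k.1
    omega
  · have hr := reached_range hb.1 hb.2
    rcases k3 with ⟨rfl, rfl⟩ | ⟨rfl, rfl⟩
    · exact Or.inr (Or.inr ⟨b, hb, rfl, k1, k2, rfl, rfl⟩)
    · have o1 := h.odd_le hb.1 hb.2 ((h.pres_next).1 h3.2.1).2
      have e1 := h.even_le hr.1 hr.2 ((h.pres_next).1 h3.1).2
      have e3 := e1.2.2.2.2.2.resolve_left fun k => hvl (eq_of_footAt (by omega) (by omega) hfa k.1)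
      have := tube_bounds (offset n b s)
      omega

theorem Stage.trip_odd_next {s v l u : ℤ} (ht : (next L top).Trip s v l u) : s % 2 = 1 := by
  obtain ⟨a, rfl, ha, hfa, hc⟩ := h.trip_cases ht
  rcases hc with ⟨c, d, rfl, rfl, k⟩ | ⟨b, c, rfl, rfl, hbc, hb, hc, k1, k2, k3⟩ |
    ⟨b, hb, rfl, k1, k2, k3⟩
  · exact (psi_odd (h.good.trip_odd k)).1
  · omega
  · unfold offset at k1
    unfold side at k1
    split_ifs at k1 <;> omega

end

/-! ### Pairs and triples of lines in the doubled layout -/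

section
variable {n : ℕ} {L : Layout (n + 1)} {top : ℤ → ℤ} (h : Stage n L top)

/-- The pieces of a new line at a slot and at an adjacent slot overlap. -/
theorem tube_adjacent (k b : ℤ) {s t : ℤ} (ht : t = s + 1 ∨ t = s - 1) :
    tubeLo |offset k b s| < tubeHi |offset k b t| ∧ tubeLo |offset k b t| < tubeHi |offset k b s| := by
  rcases ht with rfl | rfl
  · have := Deltoid.tube_cont (s - 8 * k + 8) (16 * b)
    rw [show s - 8 * k + 8 + 1 + 16 * b = offset k b (s + 1) by unfold offset; ring] at this
    exact this
  · have := Deltoid.tube_cont (s - 1 - 8 * k + 8) (16 * b)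
    rw [show s - 1 - 8 * k + 8 + 1 + 16 * b = offset k b s by unfold offset; ring] at this
    exact this.symm

include h

theorem Stage.pres_cont_next {s i : ℤ} (h1 : (next L top).Pres s i)
    (h2 : (next L top).Pres (s + 1) i) : (next L top).lo s i < (next L top).hi (s + 1) i ∧
      (next L top).lo (s + 1) i < (next L top).hi s i := by
  have r1 := h.pres_next.1 h1
  have r2 := h.pres_next.1 h2
  obtain ⟨a, rfl | rfl⟩ := Int.even_or_odd' i
  · have e1 := h.even_le (by omega) (by omega) r1.2
    have e2 := h.even_le (by omega) (by omega) r2.2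
    rcases psi_succ s with hp | hp
    · rw [hp] at e2
      omega
    · have p1 : L.Pres (psi s) a :=
        h.pres_iff.2 ⟨by omega, (psi_range (by omega) (by omega)).2 r1.2⟩
      have p2 : L.Pres (psi (s + 1)) a :=
        h.pres_iff.2 ⟨by omega, (psi_range (by omega) (by omega)).2 r2.2⟩
      rw [hp] at e2 p2
      have := h.good.pres_cont p1 p2
      omega
  · have o1 := h.odd_le (b := a) (by omega) (by omega) r1.2
    have o2 := h.odd_le (b := a) (by omega) (by omega) r2.2
    have := tube_adjacent n a (s := s) (Or.inl rfl)
    omega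

theorem Stage.near_ord_next {a b c i j : ℤ} (hij : i ≠ j) (h1 : (next L top).Near a i j)
    (h2 : (next L top).Near c i j) (hab : a ≤ b) (hbc : b ≤ c) : (next L top).Near b i j := by
  have hr := near_range h1
  have key : ∀ {x y : ℤ}, (0 ≤ x ∧ x < n) → (0 ≤ y ∧ y ≤ n) →
      (next L top).Near a (2 * x + 1) (2 * y) → (next L top).Near c (2 * x + 1) (2 * y) →
      (next L top).Near b (2 * x + 1) (2 * y) := by
    intro x y hx hy k1 k2
    rw [h.near_odd_even hx hy] at *
    unfold reached offset at *
    split_ifs at * <;> omega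
  obtain ⟨x, rfl | rfl⟩ := Int.even_or_odd' i <;> obtain ⟨y, rfl | rfl⟩ := Int.even_or_odd' j
  · rw [h.near_even_even] at *
    exact h.good.near_ord (by omega) h1 h2 (psi_mono hab) (psi_mono hbc)
  · exact (key (by omega) (by omega) h1.symm h2.symm).symm
  · exact key (by omega) (by omega) h1 h2
  · rw [h.near_odd_odd (by omega) (by omega) (by omega)] at *
    omega

theorem Stage.near_cont_odd {s a c : ℤ} (ha : 0 ≤ a ∧ a < n) (hc : 0 ≤ c ∧ c < n) (hac : a ≠ c)
    (h1 : (next L top).Near s (2 * a + 1) (2 * c + 1))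
    (h2 : (next L top).Near (s + 1) (2 * a + 1) (2 * c + 1)) :
    (next L top).lo s (2 * a + 1) < (next L top).hi (s + 1) (2 * c + 1) ∧
      (next L top).lo (s + 1) (2 * a + 1) < (next L top).hi s (2 * c + 1) := by
  have o1 := (h.odd_le ha.1 ha.2 (h.pres_next.1 h1.1).2).2.1
  have o2 := (h.odd_le hc.1 hc.2 (h.pres_next.1 h1.2.1).2).2.2.1
  have o3 := (h.odd_le ha.1 ha.2 (h.pres_next.1 h2.1).2).2.1
  have o4 := (h.odd_le hc.1 hc.2 (h.pres_next.1 h2.2.1).2).2.2.1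
  rw [h.near_odd_odd ha hc hac] at h1 h2
  have hs : ∀ x, s - 8 * n + 8 + 1 + 16 * x = offset n x (s + 1) := fun x => by unfold offset; ring
  have hs' : ∀ x, s - 8 * n + 8 + 16 * x = offset n x s := fun x => rfl
  rcases lt_or_gt_of_ne hac with hac | hac
  · have := Deltoid.tube_tube_cont (s := s - 8 * n + 8) hac (by omega) (by omega)
    rw [hs, hs, hs', hs'] at this
    omega
  · have := Deltoid.tube_tube_cont (s := s - 8 * n + 8) hac (by omega) (by omega)
    rw [hs, hs, hs', hs'] at this
    omega

theorem Stage.near_cont_next {s i j : ℤ} (hij : i ≠ j) (h1 : (next L top).Near s i j)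
    (h2 : (next L top).Near (s + 1) i j) : (next L top).lo s i < (next L top).hi (s + 1) j ∧
      (next L top).lo (s + 1) i < (next L top).hi s j := by
  have hr := near_range h1
  have r1 := (h.pres_next.1 h1.1).2
  have r2 := (h.pres_next.1 h1.2.1).2
  have r3 := (h.pres_next.1 h2.1).2
  have r4 := (h.pres_next.1 h2.2.1).2
  -- a line through the spike is followed through it, unless it has a foot in the next slot
  have spike : ∀ {t t' b a : ℤ}, (t' = t + 1 ∨ t = t' + 1) → (0 ≤ b ∧ b < n) → (0 ≤ a ∧ a ≤ n) →
      (next L top).Near t (2 * b + 1) (2 * a) → (next L top).Near t' (2 * b + 1) (2 * a) →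
      (next L top).lo t (2 * a) < (next L top).hi t' (2 * b + 1) := by
    intro t t' b a htt hb ha k1 k2
    have l1 := k1.2.2.2
    have o1 := h.odd_le hb.1 hb.2 (h.pres_next.1 k1.1).2
    have o2 := h.odd_le hb.1 hb.2 (h.pres_next.1 k2.1).2
    by_cases hf : FootAt (2 * n) t (2 * a)
    · have := lo_of_foot (L := L) (top := top) hf
      omega
    · rw [h.near_odd_even hb ha] at k1 k2
      have d1 : -3 ≤ offset n b t ∧ offset n b t ≤ 3 := by
        unfold FootAt at hf
        omega
      have d2 : -3 ≤ offset n b t' ∧ offset n b t' ≤ 3 := by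
        unfold FootAt at hf
        unfold offset reached at *
        split_ifs at * <;> omega
      rw [hi_spike hb.1 hb.2 d1.1 d1.2] at l1
      rw [hi_spike hb.1 hb.2 d2.1 d2.2]
      exact l1
  obtain ⟨a, rfl | rfl⟩ := Int.even_or_odd' i <;> obtain ⟨c, rfl | rfl⟩ := Int.even_or_odd' j
  · rw [h.near_even_even] at h1 h2
    have e1 := h.even_le (by omega) (by omega) r1
    have e2 := h.even_le (by omega) (by omega) r2
    have e3 := h.even_le (by omega) (by omega) r3
    have e4 := h.even_le (by omega) (by omega) r4
    rcases psi_succ s with hp | hp <;> rw [hp] at e3 e4 h2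
    · have := h1.2.2
      omega
    · have := h.good.near_cont (by omega) h1 h2
      omega
  · exact ⟨spike (Or.inl rfl) (by omega) (by omega) h1.symm h2.symm,
      spike (Or.inr rfl) (by omega) (by omega) h2.symm h1.symm⟩
  · have o1 := h.odd_le (b := a) (by omega) (by omega) r1
    have o3 := h.odd_le (b := a) (by omega) (by omega) r3
    have e2 := h.even_le (by omega) (by omega) r2
    have e4 := h.even_le (by omega) (by omega) r4
    have := tube_bounds (offset n a s)
    have := tube_bounds (offset n a (s + 1))
    omega
  · exact h.near_cont_odd (by omega) (by omega) (by omega) h1 h2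

theorem Stage.near_pair_next {i j : ℤ} (hi : 0 ≤ i ∧ i ≤ 2 * n) (hj : 0 ≤ j ∧ j ≤ 2 * n)
    (hij : i ≠ j) : ∃ s, (next L top).Near s i j ∧
      ∀ v, ¬ (next L top).Trip s v i j ∧ ¬ (next L top).Trip s v j i := by
  have key : ∀ {b a : ℤ}, (0 ≤ b ∧ b < n) → (0 ≤ a ∧ a ≤ n) →
      ∃ s, (next L top).Near s (2 * b + 1) (2 * a) ∧ s % 2 = 0 := by
    intro b a hb ha
    by_cases hab : a ≤ b
    · exact ⟨-8 * a - 4, (h.near_odd_even hb ha).2 (by omega), by omega⟩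
    · exact ⟨8 * n - 8 * a + 4, (h.near_odd_even hb ha).2 (by omega), by omega⟩
  have even : ∀ {s : ℤ}, s % 2 = 0 → (next L top).Near s i j → ∃ s, (next L top).Near s i j ∧
      ∀ v, ¬ (next L top).Trip s v i j ∧ ¬ (next L top).Trip s v j i := by
    intro s hs hn
    exact ⟨s, hn, fun v => ⟨fun ht => by have := h.trip_odd_next ht; omega,
      fun ht => by have := h.trip_odd_next ht; omega⟩⟩
  obtain ⟨a, rfl | rfl⟩ := Int.even_or_odd' i <;> obtain ⟨c, rfl | rfl⟩ := Int.even_or_odd' j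
  · obtain ⟨t, ht, hn⟩ := h.good.near_pair (i := a) (j := c) (by omega) (by push_cast; omega)
      (by omega) (by push_cast; omega) (by omega)
    obtain ⟨s, rfl⟩ := psi_surjective t
    refine ⟨s, h.near_even_even.2 ht, fun v => ⟨fun ht => ?_, fun ht => ?_⟩⟩
    all_goals
      obtain ⟨x, rfl, hx, hfx, hc⟩ := h.trip_cases ht
      rcases hc with ⟨c, d, k1, k2, k⟩ | ⟨b, c, k1, -⟩ | ⟨b, -, -, -, -, k1, -⟩
    · obtain rfl : a = c := by omega
      obtain rfl : d = _ := mul_left_cancel₀ two_ne_zero k2.symm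
      exact (hn x).1 k
    · omega
    · omega
    · obtain rfl : a = d := by omega
      obtain rfl : c = _ := mul_left_cancel₀ two_ne_zero k1.symm
      exact (hn x).2 k
    · omega
    · omega
  · obtain ⟨s, hs, hs'⟩ := key (b := c) (a := a) (by omega) (by omega)
    exact even hs' hs.symm
  · obtain ⟨s, hs, hs'⟩ := key (b := a) (a := c) (by omega) (by omega)
    exact even hs' hs
  · exact even (s := 8 * n - 8 - 8 * (a + c)) (by omega)
      ((h.near_odd_odd (by omega) (by omega) (by omega)).2 (by omega))

theorem Stage.near_three_next {s i j k : ℤ} (hij : i ≠ j) (hik : i ≠ k) (hjk : j ≠ k)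
    (h1 : (next L top).Near s i j) (h2 : (next L top).Near s i k) (h3 : (next L top).Near s j k) :
    (next L top).foot s i ∨ (next L top).foot s j ∨ (next L top).foot s k := by
  have ooe : ∀ {b c a : ℤ}, b ≠ c → (next L top).Near s (2 * b + 1) (2 * c + 1) →
      (next L top).Near s (2 * b + 1) (2 * a) → (next L top).Near s (2 * c + 1) (2 * a) →
      (next L top).foot s (2 * a) := by
    intro b c a hbc k1 k2 k3
    have := (h.three_odd_odd_even hbc k1 k2 k3).2
    refine ⟨(near_range k2).2, ?_⟩
    unfold FootAt
    omega
  have oee : ∀ {b a c : ℤ}, a ≠ c → (next L top).Near s (2 * b + 1) (2 * a) →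
      (next L top).Near s (2 * b + 1) (2 * c) → (next L top).Near s (2 * a) (2 * c) →
      (next L top).foot s (2 * a) ∨ (next L top).foot s (2 * c) := by
    intro b a c hac k1 k2 k3
    have ha := near_range k1
    have hc := near_range k2
    obtain ⟨-, k4, -, ⟨rfl, -⟩ | ⟨-, rfl⟩⟩ := h.three_odd_even_even hac k1 k2 k3
    · exact Or.inl ⟨ha.2, k4⟩
    · exact Or.inr ⟨hc.2, k4⟩
  have hr1 := near_range h1
  have hr2 := near_range h2
  obtain ⟨a, rfl | rfl⟩ := Int.even_or_odd' i <;> obtain ⟨b, rfl | rfl⟩ := Int.even_or_odd' j <;>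
    obtain ⟨c, rfl | rfl⟩ := Int.even_or_odd' k
  · rw [h.near_even_even] at h1 h2 h3
    have key : ∀ {x : ℤ}, (0 ≤ 2 * x ∧ 2 * x ≤ 2 * n) → L.foot (psi s) x →
        (next L top).foot s (2 * x) := fun hx hf =>
      ⟨hx, (psi_foot (by omega) (by omega)).1 (h.foot_iff.1 hf).2⟩
    exact (h.good.near_three (by omega) (by omega) (by omega) h1 h2 h3).imp (key hr1.1)
      (Or.imp (key hr1.2) (key hr2.2))
  · have := oee (by omega) h2.symm h3.symm h1
    tauto
  · have := oee (by omega) h1.symm h3 h2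
    tauto
  · exact Or.inl (ooe (by omega) h3 h1.symm h2.symm)
  · exact Or.inr (oee (by omega) h1 h2 h3)
  · exact Or.inr (Or.inl (ooe (by omega) h2 h1 h3.symm))
  · exact Or.inr (Or.inr (ooe (by omega) h1 h2 h3))
  · exact (h.three_odd (by omega) (by omega) (by omega) h1 h2).elim

theorem Stage.three_slot_next {s s' i j k : ℤ} (hij : i ≠ j) (hik : i ≠ k) (hjk : j ≠ k)
    (h1 : (next L top).Near s i j) (h2 : (next L top).Near s i k) (h3 : (next L top).Near s j k)
    (h1' : (next L top).Near s' i j) (h2' : (next L top).Near s' i k)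
    (h3' : (next L top).Near s' j k) : s = s' := by
  have ooe : ∀ {b c a : ℤ}, b ≠ c → (next L top).Near s (2 * b + 1) (2 * c + 1) →
      (next L top).Near s (2 * b + 1) (2 * a) → (next L top).Near s (2 * c + 1) (2 * a) →
      (next L top).Near s' (2 * b + 1) (2 * c + 1) →
      (next L top).Near s' (2 * b + 1) (2 * a) → (next L top).Near s' (2 * c + 1) (2 * a) →
      s = s' := by
    intro b c a hbc k1 k2 k3 k4 k5 k6
    have := h.three_odd_odd_even hbc k1 k2 k3
    have := h.three_odd_odd_even hbc k4 k5 k6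
    omega
  have oee : ∀ {b a c : ℤ}, a ≠ c → (next L top).Near s (2 * b + 1) (2 * a) →
      (next L top).Near s (2 * b + 1) (2 * c) → (next L top).Near s (2 * a) (2 * c) →
      (next L top).Near s' (2 * b + 1) (2 * a) →
      (next L top).Near s' (2 * b + 1) (2 * c) → (next L top).Near s' (2 * a) (2 * c) →
      s = s' := by
    intro b a c hac k1 k2 k3 k4 k5 k6
    have := (h.three_odd_even_even hac k1 k2 k3).1
    have := (h.three_odd_even_even hac k4 k5 k6).1
    unfold offset at *
    omega
  obtain ⟨a, rfl | rfl⟩ := Int.even_or_odd' i <;> obtain ⟨b, rfl | rfl⟩ := Int.even_or_odd' j <;>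
    obtain ⟨c, rfl | rfl⟩ := Int.even_or_odd' k
  · rw [h.near_even_even] at *
    refine psi_inj ?_ (h.good.three_slot (by omega) (by omega) (by omega) h1 h2 h3 h1' h2' h3')
    have odd : ∀ {v l u : ℤ}, L.foot (psi s) v → v ≠ l → v ≠ u → l ≠ u → L.Near (psi s) v l →
        L.Near (psi s) v u → L.Near (psi s) l u → psi s % 2 = 1 := by
      intro v l u hf n1 n2 n3 m1 m2 m3
      rcases (h.good.foot_three hf n1 n2 n3 m1 m2 m3).2.2 with ⟨hlt, -⟩ | ⟨hlt, -⟩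
      · exact h.good.trip_odd ⟨hf, n1, n2, m1, m2, m3, hlt⟩
      · exact h.good.trip_odd ⟨hf, n2, n1, m2, m1, m3.symm, hlt⟩
    rcases h.good.near_three (by omega) (by omega) (by omega) h1 h2 h3 with hf | hf | hf
    · exact odd hf (by omega) (by omega) (by omega) h1 h2 h3
    · exact odd hf (by omega) (by omega) (by omega) h1.symm h3 h2
    · exact odd hf (by omega) (by omega) (by omega) h2.symm h3.symm h1
  · exact oee (by omega) h2.symm h3.symm h1 h2'.symm h3'.symm h1'
  · exact oee (by omega) h1.symm h3 h2 h1'.symm h3' h2'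
  · exact ooe (by omega) h3 h1.symm h2.symm h3' h1'.symm h2'.symm
  · exact oee (by omega) h1 h2 h3 h1' h2' h3'
  · exact ooe (by omega) h2 h1 h3.symm h2' h1' h3'.symm
  · exact ooe (by omega) h1 h2 h3 h1' h2' h3'
  · exact (h.three_odd (by omega) (by omega) (by omega) h1 h2).elim

end

/-! ### The doubled layout is good -/

section
variable {n : ℕ} {L : Layout (n + 1)} {top : ℤ → ℤ} (h : Stage n L top)

theorem side_eq (k b : ℤ) : side k b = 1 ∨ side k b = -1 := by
  unfold side
  split_ifs <;> simp

theorem foot_dir {m : ℕ} {s a : ℤ} (hf : FootAt (2 * m) s (2 * a))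
    (hs : s % 2 = 1) : FootAt (2 * m) (s + dir s) (2 * a) ∧
      ¬ FootAt (2 * m) (s - dir s) (2 * a) := by
  unfold FootAt dir at *
  split_ifs <;> omega

/-- The distances of two crossing new lines from their apices, at the crossing with a foot. -/
theorem offset_pair {k s b c : ℤ} (hbc : b ≠ c)
    (hd : s - 8 * k + 8 + 8 * (b + c) = 3 ∨ s - 8 * k + 8 + 8 * (b + c) = -3) :
    ∃ δ : ℤ, 1 ≤ δ ∧ ((|offset k b s| = 8 * δ + 3 ∧ |offset k c s| = 8 * δ - 3) ∨
      (|offset k b s| = 8 * δ - 3 ∧ |offset k c s| = 8 * δ + 3)) := by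
  refine ⟨|b - c|, by rcases abs_cases (b - c) with ⟨e, f⟩ | ⟨e, f⟩ <;> omega, ?_⟩
  unfold offset
  rcases abs_cases (b - c) with ⟨e, f⟩ | ⟨e, f⟩ <;> rw [e] <;>
  rcases abs_cases (s - 8 * k + 8 + 16 * b) with ⟨e1, f1⟩ | ⟨e1, f1⟩ <;> rw [e1] <;>
  rcases abs_cases (s - 8 * k + 8 + 16 * c) with ⟨e2, f2⟩ | ⟨e2, f2⟩ <;> rw [e2] <;> omega

theorem tube_values {δ : ℤ} : tubeLo (8 * δ + 3) = 2 * δ - 1 ∧ tubeHi (8 * δ + 3) = 2 * δ + 2 ∧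
    tubeLo (8 * δ - 3) = 2 * δ - 2 ∧ tubeHi (8 * δ - 3) = 2 * δ + 1 := by
  unfold tubeLo tubeHi
  omega

theorem tubeHi_adjacent {k b s t δ : ℤ} (ht : t = s + 1 ∨ t = s - 1)
    (h1 : |offset k b s| = 8 * δ + 3) : tubeHi |offset k b t| = 2 * δ + 2 := by
  unfold offset at *
  unfold tubeHi
  rcases abs_cases (s - 8 * k + 8 + 16 * b) with ⟨e1, f1⟩ | ⟨e1, f1⟩ <;>
  rcases abs_cases (t - 8 * k + 8 + 16 * b) with ⟨e2, f2⟩ | ⟨e2, f2⟩ <;> rw [e2] <;> omega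

theorem tubeLo_adjacent {k b s t δ : ℤ} (ht : t = s + 1 ∨ t = s - 1)
    (h1 : |offset k b s| = 8 * δ - 3) : tubeLo |offset k b t| = 2 * δ - 2 := by
  unfold offset at *
  unfold tubeLo
  rcases abs_cases (s - 8 * k + 8 + 16 * b) with ⟨e1, f1⟩ | ⟨e1, f1⟩ <;>
  rcases abs_cases (t - 8 * k + 8 + 16 * b) with ⟨e2, f2⟩ | ⟨e2, f2⟩ <;> rw [e2] <;> omega

include h

/-- The intervals of two new lines that cross each other at a foot. -/
theorem Stage.pair_values {s a b c : ℤ} (ha : 0 ≤ a ∧ a ≤ n) (hf : FootAt (2 * n) s (2 * a))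
    (hb : 0 ≤ b ∧ b < n) (hc : 0 ≤ c ∧ c < n) (hbc : b ≠ c)
    (hd : s - 8 * n + 8 + 8 * (b + c) = 3 ∨ s - 8 * n + 8 + 8 * (b + c) = -3) :
    (next L top).lo s (2 * b + 1) = 2 * n + 4 - tubeHi |offset n b s| ∧
      (next L top).hi s (2 * b + 1) = 2 * n + 4 - tubeLo |offset n b s| ∧
      1 ≤ (next L top).lo s (2 * b + 1) := by
  have hr : InRange (2 * n) s (2 * b + 1) := by unfold InRange; omega
  have hnf : ¬ FootAt (2 * n) s (2 * b + 1) := by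
    intro hf'
    have := eq_of_footAt (by omega) (by omega) hf hf'
    omega
  have o := h.odd_le hb.1 hb.2 hr
  have o1 := o.2.2.2.2.1.resolve_left fun k => hnf k.1
  refine ⟨o1.2.2, hi_odd hr ?_, o1.2.1⟩
  unfold offset
  omega

/-- An old line that has no foot at a slot where another one has. -/
theorem Stage.even_values {s a c : ℤ} (ha : 0 ≤ a ∧ a ≤ n) (hf : FootAt (2 * n) s (2 * a))
    (hac : a ≠ c) (hp : L.Pres (psi s) c) :
    1 ≤ L.lo (psi s) c ∧ (next L top).lo s (2 * c) = L.lo (psi s) c + (2 * n + 5) ∧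
      (next L top).hi s (2 * c) = L.hi (psi s) c + (2 * n + 5) := by
  have hc := h.pres_iff.1 hp
  have e := h.even_le hc.1.1 hc.1.2 ((psi_range hc.1.1 hc.1.2).1 hc.2)
  have e1 := e.2.2.2.2.2.resolve_left fun k => hac (by
    have := eq_of_footAt (by omega) (by omega) hf k.1
    omega)
  exact ⟨e1.2.1, e1.2.2, e.2.2.2.2.1⟩

theorem Stage.foot_values {s a : ℤ} (ha : 0 ≤ a ∧ a ≤ n) (hf : FootAt (2 * n) s (2 * a)) :
    (next L top).lo s (2 * a) = 0 ∧ L.lo (psi s) a = 0 ∧ 1 ≤ L.hi (psi s) a ∧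
      (next L top).hi s (2 * a) = L.hi (psi s) a + (2 * n + 5) := by
  have e := h.even_le ha.1 ha.2 (inRange_of_foot (by omega) hf)
  have e1 := h.lo_foot ha.1 ha.2 ((psi_foot ha.1 ha.2).2 hf)
  exact ⟨lo_of_foot hf, e1, by omega, e.2.2.2.2.1⟩

theorem Stage.spike_values {s b : ℤ} (hb : 0 ≤ b ∧ b < n) (h1 : -3 ≤ offset n b s)
    (h2 : offset n b s ≤ 3) : 1 ≤ (next L top).lo s (2 * b + 1) ∧
      (next L top).lo s (2 * b + 1) ≤ 2 * n + 2 ∧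
      (next L top).hi s (2 * b + 1) = top b + (2 * n + 5) := by
  have hr : InRange (2 * n) s (2 * b + 1) := by unfold InRange; unfold offset at *; omega
  have hnf : ¬ FootAt (2 * n) s (2 * b + 1) := by unfold FootAt; unfold offset at *; omega
  have o := h.odd_le hb.1 hb.2 hr
  have o1 := o.2.2.2.2.1.resolve_left fun k => hnf k.1
  have := tube_bounds (offset n b s)
  exact ⟨o1.2.1, by omega, hi_spike hb.1 hb.2 h1 h2⟩

theorem Stage.foot_three_next {s v l u : ℤ} (hf : (next L top).foot s v) (hvl : v ≠ l)
    (hvu : v ≠ u) (hlu : l ≠ u) (h1 : (next L top).Near s v l) (h2 : (next L top).Near s v u)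
    (h3 : (next L top).Near s l u) : (next L top).lo s v < (next L top).lo s l ∧
      (next L top).hi s l ≤ (next L top).hi s v ∧
      (((next L top).lo s l < (next L top).lo s u ∧ (next L top).hi s l < (next L top).hi s u) ∨
      ((next L top).lo s u < (next L top).lo s l ∧ (next L top).hi s u < (next L top).hi s l)) := by
  obtain ⟨a, rfl, ha, hfa, hc⟩ := h.foot_cases hf hvl hvu hlu h1 h2 h3
  have v1 := h.foot_values ha hfa
  rcases hc with ⟨c, d, rfl, rfl, k1, k2, k3⟩ | ⟨b, c, rfl, rfl, hbc, hb, hc, k1, k2⟩ |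
    ⟨b, hb, rfl, k1, k2, k3⟩
  · have := h.good.foot_three (h.foot_iff.2 ⟨ha, (psi_foot ha.1 ha.2).2 hfa⟩) (by omega) (by omega)
      (by omega) k1 k2 k3
    have := h.even_values ha hfa (by omega) k1.2.1
    have := h.even_values ha hfa (by omega) k2.2.1
    omega
  · have v2 := h.pair_values ha hfa hb hc hbc k2
    have v3 := h.pair_values ha hfa hc hb hbc.symm (by omega)
    obtain ⟨δ, hδ, h8 | h8⟩ := offset_pair hbc k2
    all_goals
      have hv := tube_values (δ := δ)
      rw [h8.1] at v2
      rw [h8.2] at v3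
      omega
  · have hs := side_eq n b
    have v2 := h.spike_values hb (s := s) (by omega) (by omega)
    have v3 := h.even_values ha hfa (c := reached n b) (by omega) k2.2.1
    have v4 := h.top_lt_hi hb.1 hb.2 (t := s) (by omega) (by omega)
    have v5 := h.hi_le hb.1 hb.2 k1
    rcases k3 with ⟨rfl, rfl⟩ | ⟨rfl, rfl⟩ <;> omega

theorem Stage.partner_next {s v l u u' : ℤ} (hf : (next L top).foot s v) (hvl : v ≠ l)
    (hvu : v ≠ u) (hvu' : v ≠ u') (hlu : l ≠ u) (hlu' : l ≠ u')
    (h1 : (next L top).Near s v l) (h2 : (next L top).Near s v u) (h3 : (next L top).Near s v u')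
    (h4 : (next L top).Near s l u) (h5 : (next L top).Near s l u') : u = u' := by
  obtain ⟨a, rfl, ha, hfa, hc⟩ := h.foot_cases hf hvl hvu hlu h1 h2 h4
  obtain ⟨a', ha', -, -, hc'⟩ := h.foot_cases hf hvl hvu' hlu' h1 h3 h5
  obtain rfl : a = a' := by omega
  have noc : ∀ {b d : ℤ}, (0 ≤ b ∧ b < n) → a = crossed n b → offset n b s = 3 * side n b →
      a ≠ d → reached n b ≠ d → ¬ L.Near (psi s) (reached n b) d := by
    intro b d hb hab hd h1 h2
    exact h.not_near hb.1 hb.2 hd (by omega) h2.symm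
  have side_eq := side_eq n
  rcases hc with ⟨c, d, rfl, rfl, k1, k2, k3⟩ | ⟨b, c, rfl, rfl, hbc, hb, hc, k1, k2⟩ |
    ⟨b, hb, k0, k1, k2, ⟨rfl, rfl⟩ | ⟨rfl, rfl⟩⟩
  · rcases hc' with ⟨c', d', e1, rfl, k1', k2', k3'⟩ | ⟨b, c, e1, -⟩ |
      ⟨b, hb, k0, k4, k5, ⟨e1, -⟩ | ⟨e1, e2⟩⟩
    · obtain rfl : c = c' := by omega
      rw [h.good.partner (h.foot_iff.2 ⟨ha, (psi_foot ha.1 ha.2).2 hfa⟩) (by omega) (by omega)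
        (by omega) (by omega) (by omega) k1 k2 k2' k3 k3']
    · omega
    · omega
    · obtain rfl : c = reached n b := by omega
      exact absurd k3 (noc hb k0 k4 (by omega) (by omega))
  · rcases hc' with ⟨c', d', e1, -⟩ | ⟨b', c', e1, rfl, -, -, -, -, k3⟩ |
      ⟨b', hb', k0, k4, k5, ⟨e1, e2⟩ | ⟨-, e1⟩⟩
    · omega
    · omega
    · have := side_eq b'
      unfold offset at k4
      omega
    · omega
  · rcases hc' with ⟨c', d', e1, -⟩ | ⟨b', c', e1, rfl, -, -, -, -, k3⟩ |
      ⟨b', hb', k0', k4, k5, ⟨e1, e2⟩ | ⟨-, e1⟩⟩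
    · omega
    · have := side_eq b
      unfold offset at k1
      omega
    · obtain rfl : b = b' := by omega
      exact e2.symm
    · omega
  · rcases hc' with ⟨c', d', e1, rfl, k1', k2', k3'⟩ | ⟨b', c', e1, -⟩ |
      ⟨b', hb', k0', k4, k5, ⟨e1, e2⟩ | ⟨rfl, e1⟩⟩
    · obtain rfl : c' = reached n b := by omega
      exact absurd k3' (noc hb k0 k1 (by omega) (by omega))
    · omega
    · omega
    · have := side_eq b
      have := side_eq b'
      unfold offset at *
      omega

theorem Stage.squeeze_in_next {s v l u : ℤ} (ht : (next L top).Trip s v l u) :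
    (next L top).lo (s + dir s) v ≤ (next L top).lo s v ∧
      (next L top).hi s v ≤ (next L top).hi (s + dir s) v := by
  have hs := h.trip_odd_next ht
  obtain ⟨a, rfl, ha, hfa, -⟩ := h.trip_cases ht
  have v1 := h.foot_values ha hfa
  have v2 := h.foot_values ha (foot_dir hfa hs).1
  have hp := psi_odd_of_foot hfa hs
  have := h.hi_in ha.1 ha.2 ((psi_foot ha.1 ha.2).2 hfa) hp
  rw [(psi_dir hp).1, ← (psi_dir hp).2.1] at this
  omega

theorem Stage.squeeze_out_next {s v l u : ℤ} (ht : (next L top).Trip s v l u)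
    (hv : (next L top).Pres (s - dir s) v) :
    (next L top).lo s v ≤ (next L top).lo (s - dir s) v ∧
      (next L top).hi (s - dir s) v ≤ (next L top).hi s v ∧
      ((next L top).hi (s - dir s) v ≤ (next L top).lo s u ∨
        (next L top).hi s l ≤ (next L top).lo (s - dir s) v) := by
  have hs := h.trip_odd_next ht
  obtain ⟨a, rfl, ha, hfa, hc⟩ := h.trip_cases ht
  have v1 := h.foot_values ha hfa
  have hr := h.pres_next.1 hv
  have e := h.even_le ha.1 ha.2 hr.2
  have hd := foot_dir hfa hs
  have e1 := e.2.2.2.2.2.resolve_left fun k => hd.2 k.1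
  have hp := psi_odd_of_foot hfa hs
  have hpd := psi_dir hp
  have hpr : L.Pres (psi (s - dir s)) a :=
    h.pres_iff.2 ⟨ha, (psi_range ha.1 ha.2).2 hr.2⟩
  have ho := h.hi_out ha.1 ha.2 ((psi_foot ha.1 ha.2).2 hfa) hp (by rwa [hpd.1, ← hpd.2.2])
  rw [hpd.1, ← hpd.2.2] at ho
  refine ⟨by omega, by omega, ?_⟩
  rcases hc with ⟨c, d, rfl, rfl, k⟩ | ⟨b, c, rfl, rfl, hbc, hb, hc, k1, k2, k3⟩ |
    ⟨b, hb, rfl, k1, k2, rfl, rfl⟩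
  · have w1 := h.even_values ha hfa k.2.1 k.2.2.2.1.2.1
    have w2 := h.even_values ha hfa k.2.2.1 k.2.2.2.2.1.2.1
    have := (h.good.squeeze_out k (by rwa [hpd.1, ← hpd.2.2])).2.2
    rw [hpd.1, ← hpd.2.2] at this
    omega
  · have v2 := h.pair_values ha hfa hb hc hbc k2
    have := tube_bounds (offset n b s)
    omega
  · have hs' := side_eq n b
    have v2 := h.spike_values hb (s := s) (by omega) (by omega)
    have hd' : offset n b (s - dir s) = 2 * side n b := by
      have : dir s = side n b := by
        unfold offset at k1
        unfold dir
        split_ifs <;> omega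
      rw [this]
      unfold offset at *
      omega
    have := h.top_le_lo hb.1 hb.2 (t := s - dir s) (by omega) (by omega)
      (fun he => by
        have := ht.2.2.1
        omega) hpr (fun k => hd.2 ((psi_foot ha.1 ha.2).1 k))
    omega

theorem Stage.not_near_next {s v l u : ℤ} (ht : (next L top).Trip s v l u) :
    ¬ (next L top).Near (s - dir s) v l ∧ ¬ (next L top).Near (s - dir s) v u := by
  have hs := h.trip_odd_next ht
  obtain ⟨a, rfl, ha, hfa, hc⟩ := h.trip_cases ht
  have hd := (foot_dir hfa hs).2
  have hdir := dir_eq s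
  have hpd := psi_dir (psi_odd_of_foot hfa hs)
  rcases hc with ⟨c, d, rfl, rfl, k⟩ | ⟨b, c, rfl, rfl, hbc, hb, hc, k1, k2, k3⟩ |
    ⟨b, hb, rfl, k1, k2, rfl, rfl⟩
  · have := h.good.not_near k
    rw [hpd.1, ← hpd.2.2] at this
    rwa [h.near_even_even, h.near_even_even]
  · have key : ∀ {x : ℤ}, (0 ≤ x ∧ x < n) → (offset n x s ≤ -5 ∨ 5 ≤ offset n x s) →
        ¬ (next L top).Near (s - dir s) (2 * a) (2 * x + 1) := by
      intro x hx hdx hn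
      have hn := hn.symm
      rw [h.near_odd_even hx ha] at hn
      unfold FootAt at hd
      unfold offset at *
      omega
    exact ⟨key hb (by unfold offset; omega), key hc (by unfold offset; omega)⟩
  · have hs' := side_eq n b
    have hd' : offset n b (s - dir s) = 2 * side n b := by
      have : dir s = side n b := by
        unfold offset at k1
        unfold dir
        split_ifs <;> omega
      rw [this]
      unfold offset at *
      omega
    constructor
    · intro hn
      have hn := hn.symm
      rw [h.near_odd_even hb ha] at hn
      have := ht.2.2.1
      unfold FootAt at hd
      omega
    · rw [h.near_even_even]
      exact h.not_near_out hb.1 hb.2 hd'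

theorem Stage.clear_lower_next {s v l u t : ℤ} (ht : (next L top).Trip s v l u)
    (hst : t = s + 1 ∨ t = s - 1) (hl : (next L top).Pres t l) :
    (next L top).lo t l < (next L top).lo s u ∧ (next L top).lo s l < (next L top).hi t l := by
  have hs := h.trip_odd_next ht
  obtain ⟨a, rfl, ha, hfa, hc⟩ := h.trip_cases ht
  have hr := h.pres_next.1 hl
  have hp := psi_odd (psi_odd_of_foot hfa hs)
  rcases hc with ⟨c, d, rfl, rfl, k⟩ | ⟨b, c, rfl, rfl, hbc, hb, hc, k1, k2, k3⟩ |
    ⟨b, hb, rfl, k1, k2, rfl, rfl⟩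
  · have w1 := h.even_values ha hfa k.2.1 k.2.2.2.1.2.1
    have w2 := h.even_values ha hfa k.2.2.1 k.2.2.2.2.1.2.1
    have e := h.even_le (by omega) (by omega) hr.2
    have := h.good.clear_lower k (t := psi t) (by rcases hst with rfl | rfl <;> omega)
      (h.pres_iff.2 ⟨by omega, (psi_range (by omega) (by omega)).2 hr.2⟩)
    omega
  · have v2 := h.pair_values ha hfa hb hc hbc k2
    have v3 := h.pair_values ha hfa hc hb hbc.symm (by omega)
    have o := h.odd_le hb.1 hb.2 hr.2
    have ha := tube_adjacent n b hst
    obtain ⟨δ, hδ, h8 | h8⟩ := offset_pair hbc k2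
    all_goals
      have hv := tube_values (δ := δ)
      rw [h8.1, h8.2] at k3
    · rw [h8.2] at v3
      have := tubeHi_adjacent hst h8.1
      omega
    · omega
  · have hs' := side_eq n b
    have v2 := h.spike_values hb (s := s) (by omega) (by omega)
    have v3 := h.even_values ha hfa (c := reached n b) (by have := ht.2.2.1; omega) k2.2.1
    have o := h.odd_le hb.1 hb.2 hr.2
    have := tube_bounds (offset n b t)
    have := tube_adjacent n b hst
    have hnf : ¬ FootAt (2 * n) s (2 * b + 1) := fun k => by
      have := eq_of_footAt (by omega) (by omega) hfa k
      omega
    have o' := (h.odd_le hb.1 hb.2 (h.pres_next.1 ht.2.2.2.1.2.1).2)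
    have := o'.2.2.2.2.1.resolve_left fun k => hnf k.1
    omega

theorem Stage.clear_upper_next {s v l u t : ℤ} (ht : (next L top).Trip s v l u)
    (hst : t = s + 1 ∨ t = s - 1) (hl : (next L top).Pres t u) :
    (next L top).lo t u < (next L top).hi s u ∧ (next L top).hi s l < (next L top).hi t u := by
  have hs := h.trip_odd_next ht
  obtain ⟨a, rfl, ha, hfa, hc⟩ := h.trip_cases ht
  have hr := h.pres_next.1 hl
  have hp := psi_odd (psi_odd_of_foot hfa hs)
  rcases hc with ⟨c, d, rfl, rfl, k⟩ | ⟨b, c, rfl, rfl, hbc, hb, hc, k1, k2, k3⟩ |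
    ⟨b, hb, rfl, k1, k2, rfl, rfl⟩
  · have w1 := h.even_values ha hfa k.2.1 k.2.2.2.1.2.1
    have w2 := h.even_values ha hfa k.2.2.1 k.2.2.2.2.1.2.1
    have e := h.even_le (by omega) (by omega) hr.2
    have := h.good.clear_upper k (t := psi t) (by rcases hst with rfl | rfl <;> omega)
      (h.pres_iff.2 ⟨by omega, (psi_range (by omega) (by omega)).2 hr.2⟩)
    omega
  · have v2 := h.pair_values ha hfa hb hc hbc k2
    have v3 := h.pair_values ha hfa hc hb hbc.symm (by omega)
    have o := h.odd_le hc.1 hc.2 hr.2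
    have ha := tube_adjacent n c hst
    obtain ⟨δ, hδ, h8 | h8⟩ := offset_pair hbc k2
    all_goals
      have hv := tube_values (δ := δ)
      rw [h8.1, h8.2] at k3
    · rw [h8.1] at v2
      have := tubeLo_adjacent hst h8.2
      omega
    · omega
  · have hs' := side_eq n b
    have hq := reached_range hb.1 hb.2
    have v2 := h.spike_values hb (s := s) (by omega) (by omega)
    have v3 := h.even_values ha hfa (c := reached n b) (by have := ht.2.2.1; omega) k2.2.1
    have e := h.even_le hq.1 hq.2 hr.2
    have hpt : L.Pres (psi t) (reached n b) := h.pres_iff.2 ⟨hq, (psi_range hq.1 hq.2).2 hr.2⟩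
    have hdt : offset n b t = offset n b s + 1 ∨ offset n b t = offset n b s - 1 := by
      unfold offset
      omega
    have := h.top_lt_hi hb.1 hb.2 (t := t) (by omega) (by omega)
    have key : L.lo (psi t) (reached n b) < L.hi (psi s) (reached n b) := by
      rcases hst with rfl | rfl
      · rw [hp.2.2.1] at hpt ⊢
        exact (h.good.pres_cont k2.2.1 hpt).2
      · have h2 := k2.2.1
        rw [hp.2.2.2] at hpt ⊢
        rw [show psi s = psi s - 1 + 1 by ring] at h2
        have := (h.good.pres_cont hpt h2).1
        rwa [sub_add_cancel] at this
    omega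

theorem Stage.trip_end_next {s v l u : ℤ} (ht : (next L top).Trip s v l u) :
    ¬ (next L top).Near (s - 1) l u ∨ ¬ (next L top).Near (s + 1) l u := by
  have hs := h.trip_odd_next ht
  obtain ⟨a, rfl, ha, hfa, hc⟩ := h.trip_cases ht
  have hp := psi_odd (psi_odd_of_foot hfa hs)
  rcases hc with ⟨c, d, rfl, rfl, k⟩ | ⟨b, c, rfl, rfl, hbc, hb, hc, k1, k2, k3⟩ |
    ⟨b, hb, rfl, k1, k2, rfl, rfl⟩
  · have := h.good.trip_end k
    rwa [h.near_even_even, h.near_even_even, hp.2.2.1, hp.2.2.2]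
  · rw [h.near_odd_odd hb hc hbc, h.near_odd_odd hb hc hbc]
    omega
  · have hq := reached_range hb.1 hb.2
    rw [h.near_odd_even hb hq, h.near_odd_even hb hq]
    have := ht.2.2.1
    unfold offset reached side at *
    split_ifs at * <;> omega

/-- The doubling step preserves the conditions on layouts. -/
theorem Stage.good_next : (next L top).Good where
  foot_unique := fun h1 h2 => eq_of_footAt h1.1 h2.1 h1.2 h2.2
  foot_bounded := by
    refine ⟨8 * n + 5, ?_⟩
    rintro s v ⟨hv, hf⟩
    unfold FootAt at hf
    rw [abs_le]
    omega
  pres_ord := by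
    intro a b c i h1 h2 hab hbc
    rw [h.pres_next] at *
    unfold InRange at *
    omega
  pres_cont := h.pres_cont_next
  near_ord := h.near_ord_next
  near_cont := h.near_cont_next
  near_pair := by
    intro i j h1 h2 h3 h4 h5
    push_cast at h2 h4
    exact h.near_pair_next ⟨h1, by omega⟩ ⟨h3, by omega⟩ h5
  near_three := h.near_three_next
  three_slot := h.three_slot_next
  foot_three := h.foot_three_next
  partner := h.partner_next
  trip_odd := h.trip_odd_next
  squeeze_in := h.squeeze_in_next
  squeeze_out := h.squeeze_out_next
  not_near := h.not_near_next
  clear_lower := h.clear_lower_next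
  clear_upper := h.clear_upper_next
  trip_end := h.trip_end_next

end

/-! ### Repeating the doubling step -/

section
variable {n : ℕ} {L : Layout (n + 1)} {top : ℤ → ℤ} (h : Stage n L top)

/-- The heights of the spikes of the lines to be added to `next L top`. -/
def nextTop (n : ℕ) (b : ℤ) : ℤ := if b < n then 2 * n + 2 - 2 * b else 2 * (b - n) + 4

theorem psi_pos {V r : ℤ} (hV : 1 ≤ V) (h1 : -4 ≤ r) (h2 : r ≤ 4) : ∃ e, psi (8 * V + r) = 4 * V + e ∧
    ((r = -4 ∧ e = 0) ∨ (r = -3 ∧ e = 1) ∨ (-2 ≤ r ∧ r ≤ 2 ∧ e = 2) ∨ (r = 3 ∧ e = 3) ∨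
      (r = 4 ∧ e = 4)) := by
  refine ⟨psi (8 * V + r) - 4 * V, by ring, ?_⟩
  unfold psi
  split_ifs <;> omega

theorem psi_neg {V r : ℤ} (hV : V ≤ -1) (h1 : -4 ≤ r) (h2 : r ≤ 4) :
    ∃ e, psi (8 * V + r) = 4 * V - e ∧
    ((r = -4 ∧ e = 4) ∨ (r = -3 ∧ e = 3) ∨ (-2 ≤ r ∧ r ≤ 2 ∧ e = 2) ∨ (r = 3 ∧ e = 1) ∨
      (r = 4 ∧ e = 0)) := by
  refine ⟨4 * V - psi (8 * V + r), by ring, ?_⟩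
  unfold psi
  split_ifs <;> omega

/-- The position of the next spikes: they lie next to a foot of a line that has just been added,
on the inner side of this foot. Here `2 * c + 1` is this line, `8 * k + 4 + e` is the distance from
its apex, and the foot begins at `e = 3`. -/
theorem spike_position {b t : ℤ} (hb : 0 ≤ b) (hb' : b < 2 * n) (h1 : -4 ≤ offset (2 * n) b t)
    (h2 : offset (2 * n) b t ≤ 4) : ∃ c k e : ℤ, (0 ≤ c ∧ c < n) ∧ (0 ≤ k ∧ k < n) ∧
      reached (2 * n) b = 2 * c + 1 ∧ nextTop n b = 2 * n + 2 - 2 * k ∧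
      |offset n c (psi t)| = 8 * k + 4 + e ∧
      ((k = c ∧ psi t = 8 * n - 8 * c - 4 + e ∧ side (2 * n) b = -1 ∧
        crossed (2 * n) b = 2 * (c + 1)) ∨
      (k = n - 1 - c ∧ psi t = - 8 * c - 4 - e ∧ side (2 * n) b = 1 ∧
        crossed (2 * n) b = 2 * c)) ∧
      ((offset (2 * n) b t = 4 * side (2 * n) b ∧ e = 0) ∨
        (offset (2 * n) b t = 3 * side (2 * n) b ∧ e = 1) ∨
        (-2 ≤ offset (2 * n) b t ∧ offset (2 * n) b t ≤ 2 ∧ e = 2) ∨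
        (offset (2 * n) b t = -3 * side (2 * n) b ∧ e = 3) ∨
        (offset (2 * n) b t = -4 * side (2 * n) b ∧ e = 4)) := by
  by_cases hbn : b < n
  · have hs : side (2 * n) b = -1 := by unfold side; rw [if_pos (by omega)]
    obtain ⟨e, he, he'⟩ := psi_pos (V := 2 * (n - b) - 1) (r := offset (2 * n) b t) (by omega) h1 h2
    rw [show 8 * (2 * (n - b) - 1) + offset (2 * n) b t = t by unfold offset; ring] at he
    refine ⟨b, b, e, by omega, by omega, ?_, ?_, ?_, Or.inl ⟨rfl, by omega, hs, ?_⟩, by omega⟩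
    · unfold reached; rw [if_pos (by omega)]
    · unfold nextTop; rw [if_pos hbn]
    · rw [he]; unfold offset; rw [abs_of_nonneg (by omega)]; ring
    · unfold crossed; rw [if_pos (by omega)]; ring
  · have hs : side (2 * n) b = 1 := by unfold side; rw [if_neg (by omega)]
    obtain ⟨e, he, he'⟩ := psi_neg (V := 2 * (n - b) - 1) (r := offset (2 * n) b t) (by omega) h1 h2
    rw [show 8 * (2 * (n - b) - 1) + offset (2 * n) b t = t by unfold offset; ring] at he
    refine ⟨b - n, n - 1 - (b - n), e, by omega, by omega, ?_, ?_, ?_,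
      Or.inr ⟨rfl, by omega, hs, ?_⟩, by omega⟩
    · unfold reached; rw [if_neg (by omega)]; ring
    · unfold nextTop; rw [if_neg hbn]; ring
    · rw [he]; unfold offset; rw [abs_of_neg (by omega)]; ring
    · unfold crossed; rw [if_neg (by omega), if_neg (by omega)]; ring

theorem tube_spike {k e : ℤ} (h0 : 0 ≤ e) (h4 : e ≤ 4) : tubeLo (8 * k + 4 + e) = 2 * k ∧
    (e = 1 → tubeHi (8 * k + 4 + e) = 2 * k + 3) ∧
    (e = 2 → tubeHi (8 * k + 4 + e) = 2 * k + 4) := by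
  unfold tubeLo tubeHi
  omega

/-- The upper end of a new line is constant around its feet. -/
theorem hi_near_foot {s t b : ℤ} (hb : 0 ≤ b ∧ b < n) (hs : FootAt (2 * n) s (2 * b + 1))
    (ht : InRange (2 * n) t (2 * b + 1)) (hst : t = s + 1 ∨ t = s - 1) :
    (next L top).hi t (2 * b + 1) = (next L top).hi s (2 * b + 1) := by
  have hs' := inRange_of_foot (by omega) hs
  rw [hi_odd ht (by unfold FootAt at hs; unfold offset; omega),
    hi_odd hs' (by unfold FootAt at hs; unfold offset; omega)]
  congr 1
  unfold FootAt InRange at *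
  unfold tubeLo offset
  rcases abs_cases (s - 8 * n + 8 + 16 * b) with ⟨e1, f1⟩ | ⟨e1, f1⟩ <;> rw [e1] <;>
  rcases abs_cases (t - 8 * n + 8 + 16 * b) with ⟨e2, f2⟩ | ⟨e2, f2⟩ <;> rw [e2] <;> omega

include h

/-- The doubling step can be repeated. -/
theorem Stage.next : Stage (2 * n) (next L top) (nextTop n) := by
  have hN : ((2 * n : ℕ) : ℤ) = 2 * n := by push_cast; ring
  have wire : ∀ {c k e u : ℤ}, (0 ≤ c ∧ c < n) → (0 ≤ k ∧ k < n) → 0 ≤ e → e ≤ 4 →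
      |offset n c u| = 8 * k + 4 + e → (e ≤ 2 → ¬ FootAt (2 * n) u (2 * c + 1)) →
      (3 ≤ e → FootAt (2 * n) u (2 * c + 1)) → InRange (2 * n) u (2 * c + 1) →
      (Doubling.next L top).hi u (2 * c + 1) = 2 * n + 4 - 2 * k ∧
      (1 ≤ e → (Doubling.next L top).lo u (2 * c + 1) < 2 * n + 2 - 2 * k) := by
    intro c k e u hc hk h0 h4 hd hf hf' hr
    have ht := tube_spike (k := k) h0 h4
    refine ⟨?_, fun h1 => ?_⟩
    · rw [hi_odd hr, hd, ht.1]
      intro hcon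
      have := abs_le.2 hcon
      omega
    · by_cases he : e ≤ 2
      · rw [lo_odd hr (hf he), hd]
        omega
      · rw [lo_of_foot (hf' (by omega))]
        omega
  refine ⟨h.good_next, ?_, ?_, ?_, ?_, ?_, ?_, ?_, ?_, ?_, ?_, ?_, ?_⟩
  · intro s v
    rw [hN]
    rfl
  · intro s i
    rw [hN]
    exact h.pres_next
  · intro s v _ _ hf
    rw [hN] at hf
    exact lo_of_foot hf
  · intro s i hp hf
    rw [hN] at hf
    have hr := h.pres_next.1 hp
    obtain ⟨a, rfl | rfl⟩ := Int.even_or_odd' i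
    · have := (h.even_le (by omega) (by omega) hr.2).2.2.2.2.2.resolve_left fun k => hf k.1
      omega
    · exact ((h.odd_le (b := a) (by omega) (by omega) hr.2).2.2.2.2.1.resolve_left
        fun k => hf k.1).2.1
  · intro s v h0 hv hf hs
    rw [hN] at hf hv
    obtain ⟨a, rfl | rfl⟩ := Int.even_or_odd' v
    · have hd := (foot_dir hf hs).1
      have hp := psi_odd_of_foot hf hs
      have := h.hi_in (by omega) (by omega) ((psi_foot (by omega) (by omega)).2 hf) hp
      rw [(psi_dir hp).1, ← (psi_dir hp).2.1] at this
      rw [hi_even (inRange_of_foot (by omega) hf), hi_even (inRange_of_foot (by omega) hd)]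
      omega
    · refine (hi_near_foot (by omega) hf ?_ ?_).ge
      · unfold FootAt InRange dir at *
        split_ifs <;> omega
      · have := dir_eq s
        omega
  · intro s v h0 hv hf hs hpr
    rw [hN] at hf hv
    have hr := (h.pres_next.1 hpr).2
    obtain ⟨a, rfl | rfl⟩ := Int.even_or_odd' v
    · have hp := psi_odd_of_foot hf hs
      have hpd := psi_dir hp
      have hpr' : L.Pres (psi (s - dir s)) a :=
        h.pres_iff.2 ⟨by omega, (psi_range (by omega) (by omega)).2 hr⟩
      have ho := h.hi_out (by omega) (by omega) ((psi_foot (by omega) (by omega)).2 hf) hp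
        (by rwa [hpd.1, ← hpd.2.2])
      rw [hpd.1, ← hpd.2.2] at ho
      rw [hi_even hr, hi_even (inRange_of_foot (by omega) hf)]
      omega
    · refine (hi_near_foot (by omega) hf hr ?_).le
      have := dir_eq s
      omega
  · intro b t h0 hb h1 h2
    rw [hN] at *
    obtain ⟨c, k, e, hc, hk, hq, htop, hd, hpos, he⟩ := spike_position h0 hb h1 h2
    rw [hq, htop]
    have := wire (e := e) hc hk (by omega) (by omega) hd (by unfold FootAt; omega)
      (by unfold FootAt; omega) (by unfold InRange; omega)
    omega
  · intro b t h0 hb h1 h2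
    rw [hN] at *
    obtain ⟨c, k, e, hc, hk, hq, htop, hd, hpos, he⟩ :=
      spike_position h0 hb (t := t) (by omega) (by omega)
    rw [hq, htop]
    have hs := side_eq (2 * n) b
    exact (wire (e := e) hc hk (by omega) (by omega) hd (by unfold FootAt; omega)
      (by unfold FootAt; omega) (by unfold InRange; omega)).2 (by omega)
  · intro b t x h0 hb h1 h2 hx hp hf
    rw [hN] at *
    obtain ⟨c, k, e, hc, hk, hq, htop, hd, hpos, he⟩ :=
      spike_position h0 hb (t := t) (by omega) (by omega)
    rw [htop]
    have hs := side_eq (2 * n) b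
    have hr := h.pres_next.1 hp
    obtain ⟨a, rfl | rfl⟩ := Int.even_or_odd' x
    · have := (h.even_le (by omega) (by omega) hr.2).2.2.2.2.2.resolve_left fun k => hf k.1
      omega
    · rw [lo_odd hr.2 hf]
      have hr' := hr.2
      unfold InRange at hr'
      have : |offset n a (psi t)| ≤ 8 * k - 5 := by
        rw [abs_le]
        unfold offset
        omega
      have := abs_nonneg (offset n a (psi t))
      unfold tubeHi
      omega
  · intro b t h0 hb h1
    rw [hN] at *
    have hs := side_eq (2 * n) b
    obtain ⟨c, k, e, hc, hk, hq, htop, hd, hpos, he⟩ :=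
      spike_position h0 hb (t := t) (by omega) (by omega)
    intro hn
    rw [hq] at hn
    rcases hpos with ⟨-, hp, -, hcr⟩ | ⟨-, hp, -, hcr⟩
    all_goals
      rw [hcr, hp] at hn
      have hn := hn.symm
      rw [h.near_odd_even hc (by omega)] at hn
      unfold offset at hn
      omega
  · intro b t h0 hb h1
    rw [hN] at *
    have hs := side_eq (2 * n) b
    obtain ⟨c, k, e, hc, hk, hq, htop, hd, hpos, he⟩ :=
      spike_position h0 hb (t := t) (by omega) (by omega)
    rw [hq, (wire (e := e) hc hk (by omega) (by omega) hd (by unfold FootAt; omega)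
      (by unfold FootAt; omega) (by unfold InRange; omega)).1]
    rcases hpos with ⟨-, hp, -, hcr⟩ | ⟨-, hp, -, hcr⟩
    all_goals
      rw [hcr]
      have := h.foot_values (by omega) (a := crossed (2 * n) b / 2) (s := psi t)
        (by unfold FootAt; omega)
      rw [hcr, Int.mul_ediv_cancel_left _ two_ne_zero] at this
      omega
  · intro b t x h0 hb h1 hx hx' hn
    rw [hN] at *
    have hs := side_eq (2 * n) b
    obtain ⟨c, k, e, hc, hk, hq, htop, hd, hpos, he⟩ :=
      spike_position h0 hb (t := t) (by omega) (by omega)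
    have hr := near_range hn
    rw [hq] at hn hx'
    obtain ⟨a, rfl | rfl⟩ := Int.even_or_odd' x
    · rw [h.near_odd_even hc (by omega)] at hn
      unfold offset at hn
      omega
    · rw [h.near_odd_odd hc (by omega) (by omega)] at hn
      omega

end

/-! ### The first stage -/

/-- The layout of two lines with which the doubling construction starts. -/
def base : Layout (1 + 1) where
  lo s i :=
    if i = 0 then (if -2 ≤ s ∧ s ≤ 6 then 5 else 0) else (if -6 ≤ s ∧ s ≤ 2 then 1 else 0)
  hi s i :=
    if i = 0 then (if -5 ≤ s ∧ s ≤ 9 then 8 else 0) else (if -9 ≤ s ∧ s ≤ 5 then 4 else 0)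
  foot s v := (0 ≤ v ∧ v ≤ 1) ∧ FootAt 1 s v

theorem base_pres {s i : ℤ} :
    base.Pres s i ↔ (i = 0 ∧ -5 ≤ s ∧ s ≤ 9) ∨ (i = 1 ∧ -9 ≤ s ∧ s ≤ 5) := by
  simp only [Layout.Pres, base]
  push_cast
  split_ifs <;> omega

theorem base_near {s i j : ℤ} (hij : i ≠ j) : base.Near s i j ↔
    ((i = 0 ∧ j = 1) ∨ (i = 1 ∧ j = 0)) ∧ -5 ≤ s ∧ s ≤ -3 := by
  unfold Layout.Near
  rw [base_pres, base_pres]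
  simp only [base]
  split_ifs <;> omega

/-- Two lines form no triples. -/
theorem base_three {s i j k : ℤ} (hij : i ≠ j) (hik : i ≠ k) (hjk : j ≠ k)
    (h1 : base.Near s i j) (h2 : base.Near s i k) : False := by
  rw [base_near (by omega)] at h1 h2
  omega

theorem base_trip {s v l u : ℤ} : ¬ base.Trip s v l u := by
  rintro ⟨-, h1, h2, h3, h4, -, h5⟩
  exact base_three h1 h2 (by rintro rfl; omega) h3 h4

theorem base_good : base.Good where
  foot_unique h1 h2 := eq_of_footAt h1.1 h2.1 h1.2 h2.2
  foot_bounded := by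
    refine ⟨9, ?_⟩
    rintro s v ⟨hv, hf⟩
    unfold FootAt at hf
    rw [abs_le]
    omega
  pres_ord := by
    intro a b c i h1 h2 hab hbc
    rw [base_pres] at *
    omega
  pres_cont := by
    intro s i h1 h2
    rw [base_pres] at *
    simp only [base]
    split_ifs <;> omega
  near_ord := by
    intro a b c i j hij h1 h2 hab hbc
    rw [base_near hij] at *
    omega
  near_cont := by
    intro s i j hij h1 h2
    rw [base_near hij] at *
    simp only [base]
    split_ifs <;> omega
  near_pair := by
    intro i j h1 h2 h3 h4 h5
    push_cast at h2 h4
    exact ⟨-4, (base_near h5).2 (by omega), fun v => ⟨base_trip, base_trip⟩⟩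
  near_three h1 h2 h3 h4 h5 _ := (base_three h1 h2 h3 h4 h5).elim
  three_slot h1 h2 h3 h4 h5 _ _ _ _ := (base_three h1 h2 h3 h4 h5).elim
  foot_three _ h1 h2 h3 h4 h5 _ := (base_three h1 h2 h3 h4 h5).elim
  partner _ h1 h2 _ h3 _ h4 h5 _ _ _ := (base_three h1 h2 h3 h4 h5).elim
  trip_odd h := (base_trip h).elim
  squeeze_in h := (base_trip h).elim
  squeeze_out h := (base_trip h).elim
  not_near h := (base_trip h).elim
  clear_lower h := (base_trip h).elim
  clear_upper h := (base_trip h).elim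
  trip_end h := (base_trip h).elim

theorem base_triples : base.triples = ∅ := by
  ext τ
  simp only [Set.mem_empty_iff_false, iff_false]
  rintro ⟨hc, s, hs⟩
  obtain ⟨i, j, k, hij, hik, hjk, rfl⟩ := Finset.card_eq_three.1 hc
  exact base_three hij hik hjk (hs i (by simp) j (by simp) hij) (hs i (by simp) k (by simp) hik)

theorem psi_base {t : ℤ} (h1 : -4 ≤ t) (h2 : t ≤ 4) : psi t = t := by
  unfold psi
  split_ifs <;> omega

theorem base_offset {t b : ℤ} (h0 : 0 ≤ b) (h1 : b < (1 : ℕ)) : b = 0 ∧ offset (1 : ℕ) b t = t ∧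
    reached (1 : ℕ) b = 1 ∧ crossed (1 : ℕ) b = 0 ∧ side (1 : ℕ) b = -1 := by
  obtain rfl : b = 0 := by omega
  refine ⟨rfl, ?_, by decide, by decide, by decide⟩
  unfold offset
  push_cast
  ring

theorem base_stage : Stage 1 base fun _ => 2 := by
  refine ⟨base_good, ?_, ?_, ?_, ?_, ?_, ?_, ?_, ?_, ?_, ?_, ?_, ?_⟩
  · intro s v
    rfl
  · intro s i
    rw [base_pres]
    unfold InRange
    push_cast
    omega
  · intro s v h0 h1 h2
    unfold FootAt at h2
    push_cast at h1 h2
    simp only [base]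
    split_ifs <;> omega
  · intro s i h1 h2
    rw [base_pres] at h1
    unfold FootAt at h2
    push_cast at h2
    simp only [base]
    split_ifs <;> omega
  · intro s v h0 h1 h2 h3
    unfold FootAt at h2
    push_cast at h1 h2
    simp only [base]
    unfold dir
    split_ifs <;> omega
  · intro s v h0 h1 h2 h3 h4
    unfold FootAt at h2
    push_cast at h1 h2
    rw [base_pres] at h4
    simp only [base]
    split_ifs <;> omega
  · intro b t h0 h1 h2 h3
    obtain ⟨rfl, hd, hq, hp, hs⟩ := base_offset (t := t) h0 h1
    rw [hd] at h2 h3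
    rw [hq, psi_base (by omega) (by omega)]
    simp only [base]
    split_ifs <;> omega
  · intro b t h0 h1 h2 h3
    obtain ⟨rfl, hd, hq, hp, hs⟩ := base_offset (t := t) h0 h1
    rw [hd] at h2 h3
    rw [hq, psi_base (by omega) (by omega)]
    simp only [base]
    split_ifs <;> omega
  · intro b t x h0 h1 h2 h3 h4 h5 h6
    obtain ⟨rfl, hd, hq, hp, hs⟩ := base_offset (t := t) h0 h1
    rw [hd] at h2 h3
    rw [psi_base (by omega) (by omega)] at *
    rw [hq] at h4
    rw [base_pres] at h5
    unfold FootAt at h6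
    push_cast at h6
    simp only [base]
    split_ifs <;> omega
  · intro b t h0 h1 h2
    obtain ⟨rfl, hd, hq, hp, hs⟩ := base_offset (t := t) h0 h1
    rw [hd, hs] at h2
    rw [psi_base (by omega) (by omega), hp, hq, base_near (by omega)]
    omega
  · intro b t h0 h1 h2
    obtain ⟨rfl, hd, hq, hp, hs⟩ := base_offset (t := t) h0 h1
    rw [hd, hs] at h2
    rw [psi_base (by omega) (by omega), hp, hq]
    simp only [base]
    split_ifs <;> omega
  · intro b t x h0 h1 h2 h3 h4
    obtain ⟨rfl, hd, hq, hp, hs⟩ := base_offset (t := t) h0 h1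
    rw [hq] at h4 ⊢
    rw [hp] at h3
    rw [base_near h4.symm]
    omega

/-! ### Counting the triples of the doubled layout -/

section
variable {n : ℕ} {L : Layout (n + 1)} {top : ℤ → ℤ} (h : Stage n L top)

/-- The line `2 * meet n b c` is the one whose foot meets the new lines `2 * b + 1` and
`2 * c + 1`, to the right of their crossing if `b < c` and to the left of it if `c < b`. -/
def meet (n b c : ℤ) : ℤ :=
  if b < c then (if n ≤ b + c then b + c - n else b + c + 1)
  else if n ≤ b + c + 1 then b + c + 1 - n else b + c + 2

/-- The triples of lines created by the doubling step. -/
def newTriple (n : ℤ) (p : ℤ × ℤ) : Finset ℤ :=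
  if p.1 = p.2 then {2 * p.1 + 1, 2 * crossed n p.1, 2 * reached n p.1}
  else {2 * p.1 + 1, 2 * p.2 + 1, 2 * meet n p.1 p.2}

theorem mem_newTriple {m b c x : ℤ} : x ∈ newTriple m (b, c) ↔
    (b = c ∧ (x = 2 * b + 1 ∨ x = 2 * crossed m b ∨ x = 2 * reached m b)) ∨
    (b ≠ c ∧ (x = 2 * b + 1 ∨ x = 2 * c + 1 ∨ x = 2 * meet m b c)) := by
  unfold newTriple
  by_cases hbc : b = c <;> simp [hbc]

theorem odd_mem_newTriple {m b c x : ℤ} : 2 * x + 1 ∈ newTriple m (b, c) ↔ x = b ∨ x = c := by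
  rw [mem_newTriple]
  omega

theorem newTriple_injective {m : ℤ} (hm : 1 ≤ m) : Function.Injective (newTriple m) := by
  rintro ⟨b, c⟩ ⟨b', c'⟩ he
  have key : ∀ x, x ∈ newTriple m (b, c) ↔ x ∈ newTriple m (b', c') := fun x => by rw [he]
  have k1 := odd_mem_newTriple.1 ((key _).1 (odd_mem_newTriple.2 (Or.inl rfl)))
  have k2 := odd_mem_newTriple.1 ((key _).1 (odd_mem_newTriple.2 (Or.inr rfl)))
  have k3 := odd_mem_newTriple.1 ((key _).2 (odd_mem_newTriple.2 (Or.inl rfl)))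
  have k4 := odd_mem_newTriple.1 ((key _).2 (odd_mem_newTriple.2 (Or.inr rfl)))
  rcases (show (b = b' ∧ c = c') ∨ (b = c' ∧ c = b' ∧ b ≠ c) by omega) with
    ⟨rfl, rfl⟩ | ⟨rfl, rfl, hbc⟩
  · rfl
  · have k5 : 2 * meet m b c ∈ newTriple m (c, b) :=
      (key _).1 (mem_newTriple.2 (Or.inr ⟨hbc, Or.inr (Or.inr rfl)⟩))
    have k6 : meet m b c = meet m c b := by
      rw [mem_newTriple] at k5
      omega
    unfold meet at k6
    split_ifs at k6 <;> omega

include h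

theorem Stage.newTriple_mem {b c : ℤ} (hb : 0 ≤ b ∧ b < n) (hc : 0 ≤ c ∧ c < n) :
    newTriple n (b, c) ∈ (Doubling.next L top).triples := by
  unfold newTriple
  dsimp only
  by_cases hbc : b = c
  · rw [if_pos hbc]
    have hp := crossed_range hb.1 hb.2
    have hq := reached_range hb.1 hb.2
    have hs := side_eq n b
    have hd : ∃ t, offset n b t = 3 * side n b := ⟨3 * side n b + 8 * n - 8 - 16 * b, by
      unfold offset; ring⟩
    obtain ⟨t, hd⟩ := hd
    have hf : FootAt (2 * n) t (2 * crossed n b) ∧ InRange (2 * n) t (2 * reached n b) ∧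
        crossed n b ≠ reached n b := by
      unfold FootAt InRange
      unfold offset crossed reached side at *
      split_ifs at * <;> omega
    have h1 := h.lo_lt_top hb.1 hb.2 (t := t) (by omega) (by omega)
    have h2 := h.top_lt_hi hb.1 hb.2 (t := t) (by omega) (by omega)
    have h3 := h.hi_le hb.1 hb.2 hd
    have h4 := h.top_pos hb.1 hb.2
    have h5 := h.lo_foot hp.1 hp.2 ((psi_foot hp.1 hp.2).2 hf.1)
    have h6 : L.Near (psi t) (crossed n b) (reached n b) :=
      ⟨h.pres_iff.2 ⟨hp, (psi_range hp.1 hp.2).2 (inRange_of_foot (by omega) hf.1)⟩,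
        h.pres_iff.2 ⟨hq, (psi_range hq.1 hq.2).2 hf.2.1⟩, by omega, by omega⟩
    refine mem_triples (s := t) (by omega) (by omega) (by omega) ?_ ?_ (h.near_even_even.2 h6)
    · rw [h.near_odd_even hb hp]
      have hf' := hf.1
      unfold FootAt at hf'
      unfold offset crossed side at *
      split_ifs at * <;> omega
    · rw [h.near_odd_even hb hq]
      omega
  · rw [if_neg hbc]
    have ha : 0 ≤ meet n b c ∧ meet n b c ≤ n := by
      unfold meet
      split_ifs <;> omega
    refine mem_triples (s := 8 * n - 8 - 8 * (b + c) + if b < c then 3 else -3) (by omega)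
      (by omega) (by omega) ?_ ?_ ?_
    · rw [h.near_odd_odd hb hc hbc]
      split_ifs <;> omega
    · rw [h.near_odd_even hb ha]
      unfold meet
      split_ifs <;> omega
    · rw [h.near_odd_even hc ha]
      unfold meet
      split_ifs <;> omega

/-- The triples of the doubled layout are the old ones, and one for each ordered pair of new lines,
equal lines included. -/
theorem Stage.triples_next : (Doubling.next L top).triples =
    Finset.image (2 * ·) '' L.triples ∪
      newTriple n '' ((Finset.Ico (0 : ℤ) n ×ˢ Finset.Ico (0 : ℤ) n : Finset (ℤ × ℤ))) := by
  ext τ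
  constructor
  · rintro ⟨hc, s, hs⟩
    obtain ⟨v, l, u, hvl, hvu, hlu, hf, rfl⟩ : ∃ v l u, v ≠ l ∧ v ≠ u ∧ l ≠ u ∧
        (Doubling.next L top).foot s v ∧ τ = {v, l, u} := by
      obtain ⟨i, j, k, hij, hik, hjk, rfl⟩ := Finset.card_eq_three.1 hc
      rcases h.near_three_next hij hik hjk (hs i (by simp) j (by simp) hij)
        (hs i (by simp) k (by simp) hik) (hs j (by simp) k (by simp) hjk) with hf | hf | hf
      · exact ⟨i, j, k, hij, hik, hjk, hf, rfl⟩
      · exact ⟨j, i, k, hij.symm, hjk, hik, hf, by grind⟩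
      · exact ⟨k, i, j, hik.symm, hjk.symm, hij, hf, by grind⟩
    have h1 := hs v (by simp) l (by simp) hvl
    have h2 := hs v (by simp) u (by simp) hvu
    have h3 := hs l (by simp) u (by simp) hlu
    obtain ⟨a, rfl, ha, hfa, hc⟩ := h.foot_cases hf hvl hvu hlu h1 h2 h3
    rcases hc with ⟨c, d, rfl, rfl, k1, k2, k3⟩ | ⟨b, c, rfl, rfl, hbc, hb, hc, k1, k2⟩ |
      ⟨b, hb, rfl, k1, k2, k3⟩
    · exact Or.inl ⟨{a, c, d}, mem_triples (by omega) (by omega) (by omega) k1 k2 k3, by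
        simp [Finset.image_insert]⟩
    · right
      have hm : a = meet n b c ∨ a = meet n c b := by
        unfold FootAt at hfa
        unfold meet
        split_ifs <;> omega
      rcases hm with rfl | rfl
      · refine ⟨(b, c), by simp; omega, ?_⟩
        unfold newTriple
        rw [if_neg hbc]
        grind
      · refine ⟨(c, b), by simp; omega, ?_⟩
        unfold newTriple
        rw [if_neg hbc.symm]
        grind
    · right
      refine ⟨(b, b), by simp; omega, ?_⟩
      unfold newTriple
      rw [if_pos rfl]
      rcases k3 with ⟨rfl, rfl⟩ | ⟨rfl, rfl⟩ <;> grind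
  · rintro (⟨τ, ⟨hc, s, hs⟩, rfl⟩ | ⟨⟨b, c⟩, hbc, rfl⟩)
    · obtain ⟨t, rfl⟩ := psi_surjective s
      obtain ⟨i, j, k, hij, hik, hjk, rfl⟩ := Finset.card_eq_three.1 hc
      simp only [Finset.image_insert, Finset.image_singleton]
      exact mem_triples (by omega) (by omega) (by omega)
        (h.near_even_even.2 (hs i (by simp) j (by simp) hij))
        (h.near_even_even.2 (hs i (by simp) k (by simp) hik))
        (h.near_even_even.2 (hs j (by simp) k (by simp) hjk))
    · simp only [Finset.coe_product, Finset.coe_Ico, Set.mem_prod, Set.mem_Ico] at hbc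
      exact h.newTriple_mem hbc.1 hbc.2

theorem Stage.ncard_triples_next (hn : 1 ≤ n) :
    (Doubling.next L top).triples.ncard = L.triples.ncard + n ^ 2 := by
  rw [h.triples_next, Set.ncard_union_eq ?_ ((triples_finite L).image _) (Set.toFinite _),
    Set.ncard_image_of_injective _ (Finset.image_injective (mul_right_injective₀ two_ne_zero)),
    Set.ncard_image_of_injective _ (newTriple_injective (by omega)), Set.ncard_coe_finset,
    Finset.card_product]
  · simp [sq]
  · rw [Set.disjoint_left]
    rintro _ ⟨τ, -, rfl⟩ ⟨⟨b, c⟩, -, he⟩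
    have h1 : 2 * b + 1 ∈ newTriple n (b, c) := mem_newTriple.2 (by omega)
    rw [he, Finset.mem_image] at h1
    obtain ⟨x, -, hx⟩ := h1
    omega

end

/-- The layouts of `2 ^ r + 1` lines obtained by repeated doubling. -/
theorem exists_stage (r : ℕ) : ∃ (n : ℕ) (L : Layout (n + 1)) (top : ℤ → ℤ), n = 2 ^ r ∧
    Stage n L top ∧ 3 * L.triples.ncard + 1 = n ^ 2 := by
  induction r with
  | zero => exact ⟨1, base, _, rfl, base_stage, by rw [base_triples, Set.ncard_empty]; norm_num⟩
  | succ r ih =>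
    obtain ⟨n, L, top, hn, h, hc⟩ := ih
    refine ⟨2 * n, Doubling.next L top, _, by rw [hn, pow_succ'], h.next, ?_⟩
    rw [h.ncard_triples_next (by rw [hn]; exact Nat.one_le_two_pow)]
    linarith

end Doubling

theorem theorem2p4 :
    (∀ n : ℕ, 6 ≤ n → ∃ A : Fin n → Set Plane, IsSpecialFamily A ∧
      ((n - 1).choose 2 : ℝ) + ((n : ℝ) ^ 2 - 6 * (n : ℝ) + 3) / 3 ≤ (fNum 2 A : ℝ)) ∧
    {n : ℕ | ∃ B : Fin n → Set Plane, IsSpecialFamily B ∧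
      (fNum 2 B : ℝ) = ((n - 1).choose 2 : ℝ) + ((n : ℝ) ^ 2 - 4 * (n : ℝ) + 3) / 3}.Infinite := by
  constructor
  · intro n hn
    obtain ⟨m, rfl⟩ : ∃ m, n = m + 1 := ⟨n - 1, by omega⟩
    have hc := Deltoid.le_ncard_triples (m := m) (by omega)
    have ht : (Deltoid.layout m).triples.Nonempty := by
      rw [← Set.ncard_pos (Layout.triples_finite _)]
      nlinarith
    refine ⟨_, Deltoid.good.isSpecialFamily (by omega) ht, ?_⟩
    rw [Deltoid.good.fNum_two, Nat.add_sub_cancel]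
    have hc' : (m : ℝ) * m ≤ 3 * (Deltoid.layout m).triples.ncard + 3 * m := by exact_mod_cast hc
    push_cast
    linarith
  · refine Set.infinite_of_injective_forall_mem (f := fun r : ℕ => 2 ^ (r + 1) + 2) ?_ fun r => ?_
    · intro r r' hr
      have := Nat.pow_right_injective le_rfl (Nat.add_right_cancel hr)
      omega
    · obtain ⟨n, L, top, hn, h, hc⟩ := Doubling.exists_stage (r + 1)
      have h2 : 2 ≤ n := by
        rw [hn, pow_succ']
        have := Nat.one_le_two_pow (n := r)
        omega
      have ht : L.triples.Nonempty := by
        rw [← Set.ncard_pos (Layout.triples_finite _)]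
        nlinarith
      simp only [← hn, Set.mem_ofPred_eq]
      refine ⟨_, h.good.isSpecialFamily (by omega) ht, ?_⟩
      rw [h.good.fNum_two, show n + 2 - 1 = n + 1 by omega]
      have hc' : 3 * (L.triples.ncard : ℝ) + 1 = (n : ℝ) ^ 2 := by exact_mod_cast hc
      push_cast
      linarith
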